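/- Let $n\ge 1$, let $\mathbb{T}^n=\mathbb{R}^n/\mathbb{Z}^n$, and let $p\in(1,\infty)$. Let $r,q$ satisfy $$\frac{n}{2q}+\frac1r\le 1,\qquad \begin{cases} r\in[1,\infty),\ q\in(n/2,\infty] & \text{if } n\ge 2,\\ r\in[1,2],\ q\in[1,\infty] & \text{if } n=1.\end{cases}$$ For every $M\ge 0$ there is a constant $C$, depending only on $n,p,q,r$ and $M$, with the following property. Let $\tau<T$, let $b:\mathbb{T}^n\times(\tau,T)\to\mathbb{R}^n$ be in $L^2_{\mathrm{loc}}((\tau,T);L^2(\mathbb{T}^n))$ with distributional divergence $\mathrm{div}(b)\in L^r(\tau,T;L^q(\mathbb{T}^n))$ and $\|\mathrm{div}(b)\|_{L^r(\tau,T;L^q(\mathbb{T}^n))}\le M$, let $f\in L^1(\tau,T;L^p(\mathbb{T}^n))$ and $v_T\in L^p(\mathbb{T}^n)$. Let $v$ be any energy solution of $$-\partial_t v-\Delta v-b(x,t)\cdot Dv=f(x,t)\ \text{ in } \mathbb{T}^n\times(\tau,T),\qquad v(x,T)=v_T(x)\ \text{ in } \mathbb{T}^n,$$ that is, $v\in L^2_{\mathrm{loc}}((\tau,T);H^1(\mathbb{T}^n))\cap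 C((\tau,T];L^{\min(p,2)}(\mathbb{T}^n))$, $v(T)=v_T$ almost everywhere, and $$\int_\tau^T\!\!\int_{\mathbb{T}^n}\big(v\,\partial_t\varphi+Dv\cdot D\varphi-(b\cdot Dv)\,\varphi\big)\,dx\,dt=\int_\tau^T\!\!\int_{\mathbb{T}^n} f\varphi\,dx\,dt\qquad\text{for all }\varphi\in C_c^\infty(\mathbb{T}^n\times(\tau,T)).$$ (In particular, $v$ may be any weak solution with $v\in L^2(\tau,T;H^1(\mathbb{T}^n))$ and $\partial_t v\in L^2(\tau,T;H^{-1}(\mathbb{T}^n))$.) Then, for all $t\in(\tau,T)$, $$\|v(\cdot,t)\|_{L^p(\mathbb{T}^n)}\le C\left(\|v_T\|_{L^p(\mathbb{T}^n)}+\int_t^T\|f(\cdot,s)\|_{L^p(\mathbb{T}^n)}\,ds\right).$$ -/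

import Mathlib

open MeasureTheory Set Filter Topology
open scoped ENNReal NNReal

namespace DriftDiffusion

noncomputable section

/-- The flat torus `ℝⁿ / ℤⁿ`, with its Haar measure of total mass one. -/
abbrev Torus (n : ℕ) : Type := UnitAddTorus (Fin n)

/-- The vectors of `ℝⁿ`, with the Euclidean norm and inner product. -/
abbrev Vec (n : ℕ) : Type := EuclideanSpace ℝ (Fin n)

/-- The measure `dt dx` on the space-time cylinder `(a, b) × 𝕋ⁿ`. -/
def cylinder (n : ℕ) (a b : ℝ) : Measure (ℝ × Torus n) :=
  (volume.restrict (Ioo a b)).prod volume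

/-- The classical gradient of a function on the torus, through derivatives along the
one-parameter translations in the coordinate directions. -/
def grad {n : ℕ} (φ : Torus n → ℝ) (x : Torus n) : Vec n :=
  WithLp.toLp 2 fun i => deriv (fun s : ℝ => φ (x + Pi.single i (s : UnitAddCircle))) 0

/-- Test functions on `(τ, T) × 𝕋ⁿ`: smooth functions of time and space (the lift to
`ℝ × ℝⁿ` is smooth), with support in a compact subset of `(τ, T) × 𝕋ⁿ`. -/
structure IsTestFunction {n : ℕ} (τ T : ℝ) (φ : ℝ → Torus n → ℝ) : Prop where
  smooth : ContDiff ℝ ((⊤ : ℕ∞) : WithTop ℕ∞) fun z : ℝ × (Fin n → ℝ) => φ z.1 fun i => (z.2 i : UnitAddCircle)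
  support : ∃ a b : ℝ, τ < a ∧ b < T ∧ ∀ t, t ∉ Icc a b → ∀ x, φ t x = 0

/-- `w` belongs to `L²_loc((τ, T); L²(𝕋ⁿ))`. -/
def LocL2 {n : ℕ} {E : Type*} [NormedAddCommGroup E] (τ T : ℝ) (w : ℝ → Torus n → E) : Prop :=
  ∀ a b : ℝ, τ < a → a < b → b < T → MemLp (Function.uncurry w) 2 (cylinder n a b)

/-- The norm of `w` in `L^r(τ, T; L^q(𝕋ⁿ))`, with value in `[0, ∞]`. -/
def mixedNorm {n : ℕ} (τ T : ℝ) (r q : ℝ≥0∞) (w : ℝ → Torus n → ℝ) : ℝ≥0∞ :=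
  eLpNorm (fun t => eLpNorm (w t) q volume) r (volume.restrict (Ioo τ T))

/-- `w` belongs to `L^r(τ, T; L^q(𝕋ⁿ))`. -/
def MemMixed {n : ℕ} (τ T : ℝ) (r q : ℝ≥0∞) (w : ℝ → Torus n → ℝ) : Prop :=
  AEStronglyMeasurable (Function.uncurry w) (cylinder n τ T) ∧ mixedNorm τ T r q w < ⊤

/-- `G` is the spatial gradient of `v` in the sense of distributions on `(τ, T) × 𝕋ⁿ`. -/
def IsWeakGrad {n : ℕ} (τ T : ℝ) (v : ℝ → Torus n → ℝ) (G : ℝ → Torus n → Vec n) : Prop :=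
  ∀ φ : ℝ → Torus n → ℝ, IsTestFunction τ T φ → ∀ i : Fin n,
    ∫ z, v z.1 z.2 * grad (φ z.1) z.2 i ∂cylinder n τ T =
      -∫ z, G z.1 z.2 i * φ z.1 z.2 ∂cylinder n τ T

/-- `d` is the spatial divergence of `b` in the sense of distributions on `(τ, T) × 𝕋ⁿ`. -/
def IsWeakDiv {n : ℕ} (τ T : ℝ) (b : ℝ → Torus n → Vec n) (d : ℝ → Torus n → ℝ) : Prop :=
  ∀ φ : ℝ → Torus n → ℝ, IsTestFunction τ T φ →
    ∫ z, inner ℝ (b z.1 z.2) (grad (φ z.1) z.2) ∂cylinder n τ T =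
      -∫ z, d z.1 z.2 * φ z.1 z.2 ∂cylinder n τ T

/-- The admissible exponents `r` (in time) and `q` (in space) for the divergence of the drift. -/
def AdmissibleExponents (n : ℕ) (r q : ℝ≥0∞) : Prop :=
  (n : ℝ≥0∞) / (2 * q) + 1 / r ≤ 1 ∧
    ((2 ≤ n ∧ 1 ≤ r ∧ r < ⊤ ∧ (n : ℝ≥0∞) / 2 < q) ∨
      (n = 1 ∧ 1 ≤ r ∧ r ≤ 2 ∧ 1 ≤ q))

/-- `v` is an energy solution of `-∂ₜv - Δv - b · Dv = f` in `(τ, T) × 𝕋ⁿ`, `v(T) = vT`: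
`v` is in `L²_loc((τ, T); H¹(𝕋ⁿ))` and, as a curve on `(τ, T]`, continuous with values in
`L^min(p,2)(𝕋ⁿ)`, it satisfies the equation in the sense of distributions, and its value at the
time `T` is `vT`.  Solutions in the class `L²(τ, T; H¹)` with `∂ₜv ∈ L²(τ, T; H⁻¹)`, which are
continuous with values in `L²`, are of this kind for every `p`. -/
structure IsSolution {n : ℕ} (p : ℝ≥0∞) (τ T : ℝ) (b : ℝ → Torus n → Vec n)
    (f : ℝ → Torus n → ℝ) (vT : Torus n → ℝ) (v : ℝ → Torus n → ℝ) : Prop where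
  locL2 : LocL2 τ T v
  memLp : ∀ t ∈ Ioc τ T, MemLp (v t) (min p 2) volume
  continuous : ∀ t ∈ Ioc τ T,
    Tendsto (fun s => eLpNorm (v s - v t) (min p 2) volume) (𝓝[Ioc τ T] t) (𝓝 0)
  terminal : v T =ᵐ[volume] vT
  equation : ∃ Dv : ℝ → Torus n → Vec n, LocL2 τ T Dv ∧ IsWeakGrad τ T v Dv ∧
    ∀ φ : ℝ → Torus n → ℝ, IsTestFunction τ T φ →
      ∫ z, (v z.1 z.2 * deriv (fun s => φ s z.2) z.1
          + inner ℝ (Dv z.1 z.2) (grad (φ z.1) z.2)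
          - inner ℝ (b z.1 z.2) (Dv z.1 z.2) * φ z.1 z.2) ∂cylinder n τ T =
        ∫ z, f z.1 z.2 * φ z.1 z.2 ∂cylinder n τ T

end

end DriftDiffusion

namespace DriftDiffusion

noncomputable section

variable {n : ℕ}

/-! Formally, the equation is tested with F(u - c), where c is a constant and the primitive β of F
behaves like |s|^p. The diffusion yields a dissipation controlling w = G(u - c), where G behaves
like |s|^(p/2): this is the inequality of Stroock and Varopoulos. The drift enters only through its
divergence, because F(u - c) b · Du = b · Dβ(u - c) and β ≤ 2 G², so its contribution is at most 2 ∫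
|div b| w². The source is handled by Hölder's inequality. By `exists_absorption`, a consequence of
the weighted Gagliardo–Nirenberg inequality `exists_gagliardo_nirenberg`, the integral ∫ |div b| w²
is at most a small multiple of the dissipation plus (μ + C ‖div b‖_q^r) ∫ w². The exponents enter
here: n/(2q) + 1/r ≤ 1 says that 2/(2 - n/q) ≤ r. Grönwall's inequality in the form
`IsBackward.gronwall`, applied to the power 1/p of ∫ β, then gives a factor exp(C M^r), but also a
factor exponential in the length of the time interval, because of μ.

To make the constant independent of that length, the same computation is done for the oscillation
u(x) - u(y) on the product of two tori. This function is antisymmetric, so `poincare_antisymm`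
bounds ∫ w² by the dissipation; the term with μ is absorbed and the oscillation decays exponentially
(`IsSlice.energy_osc_le`). Over a step of a suitable fixed length the oscillation is halved, up to
the source, while the estimate for u - c controls how far the solution moves from a constant. The
constants chosen in successive steps differ by at most the oscillation and the source, and these sum
up (`HasSteps.exists_const`, `HasSteps.norm_le`).

No nonlinear function is differentiated twice. The energy of w is expressed by its L² modulus of
continuity along the axes (`ShiftBound`), which `translation_bound_of_monotone` obtains from -∫ F(u)
∂ᵢ∂ᵢu by cutting a translation into many short ones. The functional inequalities are proved for this
modulus, by averaging over cubes.

The solution is too irregular for these tests. It is convolved in space with a smooth kernel; at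
every point the result is absolutely continuous in time, with a commutator error that vanishes in L¹
since both b and Du are in L² (`IsSlice.tendsto_commutator`). The L¹ convergence of the commutator
requires F to be bounded, and integrability is known only up to the exponent min(p, 2). So F follows
t^(p-1) up to a level k, then a multiple of t^(m-1) with 1 < m < 2 and m ≤ p up to a level l, and
descends linearly to zero between l and 2l. The descent keeps β comparable to G² but destroys
monotonicity; the loss is governed by its slope, of order l^(m-2), and this tends to zero. The
limits are taken in this order: the kernel, l, the regularisation δ in Grönwall's inequality, the
later end of the time interval, and finally k. -/

instance : IsProbabilityMeasure (volume : Measure UnitAddCircle) :=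
  ⟨by simp [AddCircle.measure_univ]⟩

instance : IsProbabilityMeasure (volume : Measure (Torus n)) :=
  inferInstanceAs (IsProbabilityMeasure (Measure.pi fun _ : Fin n => (volume : Measure UnitAddCircle)))

instance : (volume : Measure (Torus n)).IsNegInvariant :=
  Measure.IsAddHaarMeasure.isNegInvariant_of_regular _

/-! ### Partial derivatives on the torus along the coordinate circles. -/

/-- The point of the torus on the `i`-th coordinate circle with parameter `s`. -/
def axis (i : Fin n) (s : ℝ) : Torus n := Pi.single i (s : UnitAddCircle)

lemma axis_zero (i : Fin n) : axis i 0 = 0 := by simp [axis]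

lemma axis_add (i : Fin n) (s t : ℝ) : axis i (s + t) = axis i s + axis i t := by
  simp [axis, ← Pi.single_add]

lemma axis_neg (i : Fin n) (s : ℝ) : axis i (-s) = -axis i s := by
  simp [axis, ← Pi.single_neg]

/-- `φ'` is the classical `i`-th partial derivative of `φ`. -/
def HasPD (i : Fin n) (φ φ' : Torus n → ℝ) : Prop :=
  ∀ x, HasDerivAt (fun s : ℝ => φ (x + axis i s)) (φ' x) 0

lemma HasPD.hasDerivAt {i : Fin n} {φ φ' : Torus n → ℝ} (h : HasPD i φ φ') (x : Torus n) (s : ℝ) :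
    HasDerivAt (fun s : ℝ => φ (x + axis i s)) (φ' (x + axis i s)) s := by
  have h1 := h (x + axis i s)
  have h2 : HasDerivAt (fun t : ℝ => t - s) 1 s := (hasDerivAt_id s).sub_const s
  have h3 := HasDerivAt.scomp (h := fun t : ℝ => t - s) s (by simpa using h1) h2
  simp only [one_smul] at h3
  refine h3.congr_of_eventuallyEq (Eventually.of_forall fun t => ?_)
  simp only [Function.comp, add_assoc, ← axis_add]
  congr 3; ring

lemma HasPD.grad_apply {i : Fin n} {φ φ' : Torus n → ℝ} (h : HasPD i φ φ') (x : Torus n) :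
    grad φ x i = φ' x := (h x).deriv

lemma HasPD.comp_real {i : Fin n} {φ φ' : Torus n → ℝ} (h : HasPD i φ φ') {β β' : ℝ → ℝ}
    (hβ : ∀ s, HasDerivAt β (β' s) s) : HasPD i (fun x => β (φ x)) (fun x => β' (φ x) * φ' x) := by
  intro x
  have h1 : HasDerivAt β (β' (φ (x + axis i 0))) (φ (x + axis i 0)) := hβ _
  have h2 := h1.comp (0 : ℝ) (h x)
  simpa [axis_zero, Function.comp_def] using h2

lemma HasPD.mul {i : Fin n} {φ φ' ψ ψ' : Torus n → ℝ} (h : HasPD i φ φ') (h' : HasPD i ψ ψ') :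
    HasPD i (fun x => φ x * ψ x) (fun x => φ' x * ψ x + φ x * ψ' x) := by
  intro x
  have := (h x).mul (h' x)
  simp only [axis_zero, add_zero] at this
  exact this

lemma HasPD.sub_const {i : Fin n} {φ φ' : Torus n → ℝ} (h : HasPD i φ φ') (c : ℝ) :
    HasPD i (fun x => φ x - c) φ' := fun x => (h x).sub_const c

/-- Reflection `y ↦ x - y` changes the sign of the derivative. -/
lemma HasPD.reflect {i : Fin n} {φ φ' : Torus n → ℝ} (h : HasPD i φ φ') (x : Torus n) :
    HasPD i (fun y => φ (x - y)) (fun y => -φ' (x - y)) := by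
  intro y
  have h1 := h (x - y)
  have h2 : HasDerivAt (fun t : ℝ => -t) (-1) 0 := (hasDerivAt_id (0 : ℝ)).neg
  rw [← neg_zero] at h1
  have h3 := h1.scomp (0 : ℝ) h2
  simp only [neg_smul, one_smul] at h3
  refine h3.congr_of_eventuallyEq (Eventually.of_forall fun t => ?_)
  simp only [Function.comp, axis_neg]
  congr 1; abel

lemma _root_.Continuous.integrable_torus {E : Type*} [NormedAddCommGroup E] {X : Type*}
    [TopologicalSpace X] [CompactSpace X] [MeasurableSpace X] [OpensMeasurableSpace X]
    [SecondCountableTopologyEither X E] {μ : Measure X}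
    [IsFiniteMeasureOnCompacts μ] {φ : X → E} (h : Continuous φ) : Integrable φ μ :=
  h.integrable_of_hasCompactSupport (HasCompactSupport.of_compactSpace φ)

/-- The pointwise form, so that nested rewrites with `integral_sub` and `integral_add` match
syntactically. -/
lemma _root_.MeasureTheory.Integrable.fsub {X E : Type*} [MeasurableSpace X] [NormedAddCommGroup E]
    {μ : Measure X} {f g : X → E} (hf : Integrable f μ) (hg : Integrable g μ) :
    Integrable (fun x => f x - g x) μ := hf.sub hg

lemma _root_.MeasureTheory.Integrable.fadd {X E : Type*} [MeasurableSpace X] [NormedAddCommGroup E]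
    {μ : Measure X} {f g : X → E} (hf : Integrable f μ) (hg : Integrable g μ) :
    Integrable (fun x => f x + g x) μ := hf.add hg

lemma exists_bound_of_continuous {X : Type*} [TopologicalSpace X] [CompactSpace X] {φ : X → ℝ}
    (h : Continuous φ) : ∃ C, 0 ≤ C ∧ ∀ x, |φ x| ≤ C := by
  obtain ⟨C, hC⟩ := isCompact_univ.exists_bound_of_continuousOn h.continuousOn
  exact ⟨max C 0, le_max_right _ _, fun x => (hC x trivial).trans (le_max_left _ _)⟩

/-- Differentiation under the integral, along translations in the direction of an axis. -/
lemma hasDerivAt_integral_translate {i : Fin n} {φ φ' g : Torus n → ℝ} (h : HasPD i φ φ')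
    (hφ : Continuous φ) (hφ' : Continuous φ') (hg : Integrable g volume) (s : ℝ) :
    HasDerivAt (fun s => ∫ x, g x * φ (x + axis i s)) (∫ x, g x * φ' (x + axis i s)) s := by
  obtain ⟨C, hC0, hC⟩ := exists_bound_of_continuous hφ'
  obtain ⟨C₁, hC0₁, hC₁⟩ := exists_bound_of_continuous hφ
  refine (hasDerivAt_integral_of_dominated_loc_of_deriv_le (𝕜 := ℝ)
    (F := fun s x => g x * φ (x + axis i s)) (F' := fun s x => g x * φ' (x + axis i s))
    (s := univ) (bound := fun x => |g x| * C)
    univ_mem ?_ ?_ ?_ ?_ ?_ ?_).2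
  · exact Eventually.of_forall fun t => hg.aestronglyMeasurable.mul
      (hφ.comp (continuous_id.add continuous_const)).aestronglyMeasurable
  · exact hg.mul_bdd (c := C₁) (hφ.comp (continuous_id.add continuous_const)).aestronglyMeasurable
      (Eventually.of_forall fun x => hC₁ _)
  · exact hg.aestronglyMeasurable.mul
      (hφ'.comp (continuous_id.add continuous_const)).aestronglyMeasurable
  · refine Eventually.of_forall fun x t _ => ?_
    rw [norm_mul]
    exact mul_le_mul_of_nonneg_left (hC _) (norm_nonneg _)
  · exact hg.abs.mul_const C
  · exact Eventually.of_forall fun x t _ => (h.hasDerivAt x t).const_mul _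

/-- The integral of a translate does not depend on the translation, so its derivative vanishes. -/
lemma integral_pd_eq_zero {i : Fin n} {φ φ' : Torus n → ℝ} (h : HasPD i φ φ')
    (hφ : Continuous φ) (hφ' : Continuous φ') : ∫ x, φ' x = 0 := by
  have h1 := hasDerivAt_integral_translate h hφ hφ' (integrable_const (1 : ℝ)) 0
  simp only [one_mul, integral_add_right_eq_self] at h1
  exact h1.unique (hasDerivAt_const _ _)

lemma integral_mul_pd {i : Fin n} {φ φ' ψ ψ' : Torus n → ℝ} (h : HasPD i φ φ') (h' : HasPD i ψ ψ')
    (hφ : Continuous φ) (hφ' : Continuous φ') (hψ : Continuous ψ) (hψ' : Continuous ψ') :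
    ∫ x, φ' x * ψ x = -∫ x, φ x * ψ' x := by
  have h1 := integral_pd_eq_zero (h.mul h') (hφ.mul hψ) ((hφ'.mul hψ).add (hφ.mul hψ'))
  have i1 : Integrable (fun x => φ' x * ψ x) volume := (hφ'.mul hψ).integrable_torus
  have i2 : Integrable (fun x => φ x * ψ' x) volume := (hφ.mul hψ').integrable_torus
  rw [integral_add i1 i2] at h1
  linarith

/-! ### Second differences and the Stroock–Varopoulos inequality. -/

/-- Summation by parts for the second difference quotient. -/
lemma integral_second_difference {i : Fin n} {u : Torus n → ℝ} (hu : Continuous u) {F : ℝ → ℝ}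
    (hF : Continuous F) (h : ℝ) :
    ∫ x, (F (u (x + axis i h)) - F (u x)) * (u (x + axis i h) - u x) =
      2 * (∫ x, F (u x) * u (x + axis i 0)) - (∫ x, F (u x) * u (x + axis i h))
        - ∫ x, F (u x) * u (x + axis i (-h)) := by
  have c : ∀ t, Continuous fun x : Torus n => u (x + axis i t) := fun t =>
    hu.comp (continuous_id.add continuous_const)
  have c' := c h
  have i1 : Integrable (fun x => F (u (x + axis i h)) * u (x + axis i h)) volume :=
    Continuous.integrable_torus (by fun_prop)
  have i2 : Integrable (fun x => F (u (x + axis i h)) * u x) volume :=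
    Continuous.integrable_torus (by fun_prop)
  have i3 : Integrable (fun x => F (u x) * u (x + axis i h)) volume :=
    Continuous.integrable_torus (by fun_prop)
  have i4 : Integrable (fun x => F (u x) * u x) volume :=
    Continuous.integrable_torus (by fun_prop)
  have e1 : ∫ x, F (u (x + axis i h)) * u (x + axis i h) = ∫ x, F (u x) * u x :=
    integral_add_right_eq_self (fun x => F (u x) * u x) (axis i h)
  have e2 : ∫ x, F (u x) * u (x + axis i (-h)) = ∫ x, F (u (x + axis i h)) * u x := by
    rw [← integral_add_right_eq_self (fun x => F (u x) * u (x + axis i (-h))) (axis i h)]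
    refine integral_congr_ae (Eventually.of_forall fun x => ?_)
    simp [axis_neg]
  rw [e2, axis_zero]
  simp only [add_zero]
  have : ∀ x, (F (u (x + axis i h)) - F (u x)) * (u (x + axis i h) - u x) =
      (F (u (x + axis i h)) * u (x + axis i h) - F (u (x + axis i h)) * u x)
        - (F (u x) * u (x + axis i h) - F (u x) * u x) := fun x => by ring
  simp only [this]
  rw [integral_sub (i1.fsub i2) (i3.fsub i4), integral_sub i1 i2, integral_sub i3 i4, e1]
  ring

/-- The second difference quotient of a twice differentiable function. -/
lemma tendsto_second_difference {J J' : ℝ → ℝ} {J'' : ℝ} (h1 : ∀ s, HasDerivAt J (J' s) s)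
    (h2 : HasDerivAt J' J'' 0) :
    Tendsto (fun h => (2 * J 0 - J h - J (-h)) / h ^ 2) (𝓝[>] 0) (𝓝 (-J'')) := by
  have hn : ∀ s, HasDerivAt (fun h => J (-h)) (-J' (-s)) s := fun s => by
    have := (h1 (-s)).scomp s (hasDerivAt_neg s)
    simp only [smul_eq_mul, neg_mul, one_mul] at this
    exact this
  have hn' : HasDerivAt (fun h => J' (-h)) (-J'') 0 := by
    rw [← neg_zero] at h2
    have := h2.scomp (0 : ℝ) (hasDerivAt_neg 0)
    simp only [smul_eq_mul, neg_mul, one_mul] at this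
    exact this
  -- One application of l'Hôpital's rule leaves the symmetric difference quotient of J' at 0, so the
  -- second derivative is needed only there.
  refine HasDerivAt.lhopital_zero_nhdsGT (f' := fun h => -J' h + J' (-h)) (g' := fun h => 2 * h)
    ?_ ?_ ?_ ?_ ?_ ?_
  · refine Eventually.of_forall fun h => ?_
    have := ((h1 h).const_sub (2 * J 0)).sub (hn h)
    rw [sub_neg_eq_add] at this
    exact this
  · refine Eventually.of_forall fun h => ?_
    simpa using hasDerivAt_pow 2 h
  · filter_upwards [self_mem_nhdsWithin] with h hh
    have : (0 : ℝ) < h := hh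
    positivity
  · have : Continuous fun h => 2 * J 0 - J h - J (-h) := by
      have hJ : Continuous J := continuous_iff_continuousAt.2 fun s => (h1 s).continuousAt
      fun_prop
    have h3 := this.tendsto 0
    simp only [neg_zero] at h3
    rw [show 2 * J 0 - J 0 - J 0 = 0 by ring] at h3
    exact h3.mono_left nhdsWithin_le_nhds
  · have : Tendsto (fun h : ℝ => h ^ 2) (𝓝 0) (𝓝 (0 ^ 2)) := (continuous_pow 2).tendsto 0
    simp only [ne_eq, OfNat.ofNat_ne_zero, not_false_eq_true, zero_pow] at this
    exact this.mono_left nhdsWithin_le_nhds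
  · have h3 : HasDerivAt (fun h => -J' h + J' (-h)) (-J'' + -J'') 0 := h2.neg.add hn'
    have h4 := (hasDerivAt_iff_tendsto_slope.1 h3).mono_left
      (nhdsWithin_mono (0 : ℝ) (fun x (hx : x ∈ Ioi (0 : ℝ)) => ne_of_gt hx))
    have h5 := h4.div_const 2
    rw [show (-J'' + -J'') / 2 = -J'' by ring] at h5
    refine h5.congr' ?_
    filter_upwards [self_mem_nhdsWithin] with h hh
    have : (0 : ℝ) < h := hh
    simp only [slope_def_field, sub_zero, neg_zero, neg_add_cancel]
    field_simp

/-- With J(s) = ∫ F(u(x)) u(x + s eᵢ) dx, the numerator is the second difference of J. Both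
derivatives fall on u, so F need only be continuous. -/
lemma tendsto_difference_form {i : Fin n} {u u' u'' : Torus n → ℝ} (h1 : HasPD i u u')
    (h2 : HasPD i u' u'') (hu : Continuous u) (hu' : Continuous u') (hu'' : Continuous u'')
    {F : ℝ → ℝ} (hF : Continuous F) :
    Tendsto (fun h => (∫ x, (F (u (x + axis i h)) - F (u x)) * (u (x + axis i h) - u x)) / h ^ 2)
      (𝓝[>] 0) (𝓝 (-∫ x, F (u x) * u'' x)) := by
  have hg : Integrable (fun x => F (u x)) (volume : Measure (Torus n)) :=
    (hF.comp hu).integrable_torus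
  have h3 := hasDerivAt_integral_translate h2 hu' hu'' hg 0
  simp only [axis_zero, add_zero] at h3
  have := tendsto_second_difference (fun s => hasDerivAt_integral_translate h1 hu hu' hg s) h3
  simpa only [integral_second_difference hu hF] using this

/-- The energy inequality of Stroock and Varopoulos, in terms of translations. -/
lemma translation_bound_of_monotone {i : Fin n} {u u' u'' : Torus n → ℝ} (h1 : HasPD i u u')
    (h2 : HasPD i u' u'') (hu : Continuous u) (hu' : Continuous u') (hu'' : Continuous u'')
    {F G : ℝ → ℝ} (hF : Continuous F) (hG : Continuous G)
    (hFG : ∀ a b, (G a - G b) ^ 2 ≤ (F a - F b) * (a - b)) {h : ℝ} (hh : 0 < h) :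
    ∫ x, (G (u (x + axis i h)) - G (u x)) ^ 2 ≤ h ^ 2 * -∫ x, F (u x) * u'' x := by
  have c : ∀ t, Continuous fun x : Torus n => u (x + axis i t) := fun t =>
    hu.comp (continuous_id.add continuous_const)
  -- The translation by h is a chain of j translations by h/j. Cauchy–Schwarz costs a factor j and
  -- invariance makes the j terms equal; the total factor j² is the one hidden in (h/j)². As j → ∞
  -- the quotient tends to the Dirichlet form.
  have key : ∀ j : ℕ, 0 < j → ∫ x, (G (u (x + axis i h)) - G (u x)) ^ 2 ≤
      h ^ 2 * ((∫ x, (F (u (x + axis i (h / j))) - F (u x)) * (u (x + axis i (h / j)) - u x))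
        / (h / j) ^ 2) := by
    intro j hj
    have hj' : (0 : ℝ) < j := by exact_mod_cast hj
    set a : ℕ → Torus n → ℝ := fun k x => G (u (x + axis i (k * (h / j)))) with ha
    have hac : ∀ k, Continuous (a k) := fun k => hG.comp (c _)
    have s1 : ∀ x, (G (u (x + axis i h)) - G (u x)) ^ 2 ≤
        j * ∑ k ∈ Finset.range j, (a (k + 1) x - a k x) ^ 2 := by
      intro x
      have : G (u (x + axis i h)) - G (u x) = ∑ k ∈ Finset.range j, (a (k + 1) x - a k x) := by
        rw [Finset.sum_range_sub (fun k => a k x)]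
        simp [ha, axis_zero, mul_div_cancel₀ h hj'.ne']
      rw [this]
      simpa using sq_sum_le_card_mul_sum_sq (s := Finset.range j) (f := fun k => a (k + 1) x - a k x)
    have s2 : ∀ k, ∫ x, (a (k + 1) x - a k x) ^ 2 =
        ∫ x, (G (u (x + axis i (h / j))) - G (u x)) ^ 2 := by
      intro k
      rw [← integral_add_right_eq_self (fun x => (G (u (x + axis i (h / j))) - G (u x)) ^ 2)
        (axis i (k * (h / j)))]
      refine integral_congr_ae (Eventually.of_forall fun x => ?_)
      simp only [ha, add_assoc, ← axis_add]
      congr 5; push_cast; ring_nf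
    have s3 : ∫ x, (G (u (x + axis i (h / j))) - G (u x)) ^ 2 ≤
        ∫ x, (F (u (x + axis i (h / j))) - F (u x)) * (u (x + axis i (h / j)) - u x) := by
      refine integral_mono ?_ ?_ fun x => hFG _ _
      · exact (((hG.comp (c _)).sub (hG.comp hu)).pow 2).integrable_torus
      · exact (((hF.comp (c _)).sub (hF.comp hu)).mul ((c _).sub hu)).integrable_torus
    have hint : ∀ k ∈ Finset.range j, Integrable (fun x => (a (k + 1) x - a k x) ^ 2)
        (volume : Measure (Torus n)) := fun k _ =>
      (((hac (k + 1)).sub (hac k)).pow 2).integrable_torus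
    calc ∫ x, (G (u (x + axis i h)) - G (u x)) ^ 2
        ≤ ∫ x, j * ∑ k ∈ Finset.range j, (a (k + 1) x - a k x) ^ 2 := by
          refine integral_mono ?_ ?_ s1
          · exact (((hG.comp (c _)).sub (hG.comp hu)).pow 2).integrable_torus
          · exact (integrable_finsetSum _ hint).const_mul _
      _ = j * (j * ∫ x, (G (u (x + axis i (h / j))) - G (u x)) ^ 2) := by
          rw [integral_const_mul, integral_finsetSum _ hint, Finset.sum_congr rfl fun k _ => s2 k]
          simp
      _ ≤ j * (j * ∫ x, (F (u (x + axis i (h / j))) - F (u x)) * (u (x + axis i (h / j)) - u x)) := by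
          gcongr
      _ = _ := by field_simp
  have lim : Tendsto (fun j : ℕ => h / (j : ℝ)) atTop (𝓝[>] 0) := by
    refine tendsto_nhdsWithin_iff.2 ⟨tendsto_const_div_atTop_nhds_zero_nat h, ?_⟩
    filter_upwards [eventually_gt_atTop 0] with j hj
    have : (0 : ℝ) < j := by exact_mod_cast hj
    exact div_pos hh this
  have := ((tendsto_difference_form h1 h2 hu hu' hu'' hF).comp lim).const_mul (h ^ 2)
  refine ge_of_tendsto this ?_
  filter_upwards [eventually_gt_atTop 0] with j hj using key j hj

/-- The case `G = 0` of the preceding bound: monotonicity of F replaces the sign of its derivative.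
-/
lemma integral_mul_pd_pd_nonpos {i : Fin n} {u u' u'' : Torus n → ℝ} (h1 : HasPD i u u')
    (h2 : HasPD i u' u'') (hu : Continuous u) (hu' : Continuous u') (hu'' : Continuous u'')
    {F : ℝ → ℝ} (hF : Continuous F) (hm : ∀ a b, 0 ≤ (F a - F b) * (a - b)) :
    0 ≤ -∫ x, F (u x) * u'' x := by
  have := translation_bound_of_monotone h1 h2 hu hu' hu'' hF (G := fun _ => 0) continuous_const
    (by simpa using hm) one_pos
  simpa using this

lemma abs_integral_le_of_abs_le {X : Type*} [MeasurableSpace X] {μ : Measure X} {f g : X → ℝ}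
    (hg : Integrable g μ) (h : ∀ x, |f x| ≤ g x) : |∫ x, f x ∂μ| ≤ ∫ x, g x ∂μ := by
  rw [← Real.norm_eq_abs]
  exact norm_integral_le_of_norm_le hg (Eventually.of_forall h)

/-! ### Smooth functions on the torus and smoothing kernels. -/

/-- The projection of `ℝⁿ` onto the torus. -/
def proj (z : Fin n → ℝ) : Torus n := fun i => (z i : UnitAddCircle)

lemma proj_surjective : Function.Surjective (proj (n := n)) := fun x =>
  ⟨fun i => (QuotientAddGroup.mk_surjective (x i)).choose, funext fun i =>
    (QuotientAddGroup.mk_surjective (x i)).choose_spec⟩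

lemma proj_sub (z w : Fin n → ℝ) : proj (z - w) = proj z - proj w := by
  ext i; simp [proj]

lemma proj_add_single (z : Fin n → ℝ) (i : Fin n) (s : ℝ) :
    proj (z + s • Pi.single i 1) = proj z + axis i s := by
  ext j
  by_cases h : j = i
  · subst h; simp [proj, axis]
  · simp [proj, axis, h]

lemma isOpenQuotientMap_proj : IsOpenQuotientMap (proj (n := n)) :=
  IsOpenQuotientMap.piMap fun _ => QuotientAddGroup.isOpenQuotientMap_mk

/-- A function on the torus whose lift to `ℝⁿ` is smooth. -/
def TSmooth (k : Torus n → ℝ) : Prop :=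
  ContDiff ℝ ((⊤ : ℕ∞) : WithTop ℕ∞) fun z : Fin n → ℝ => k (proj z)

lemma TSmooth.continuous {k : Torus n → ℝ} (h : TSmooth k) : Continuous k :=
  isOpenQuotientMap_proj.isQuotientMap.continuous_iff.2 (ContDiff.continuous h)

lemma TSmooth.hasDerivAt_line {k : Torus n → ℝ} (h : TSmooth k) (i : Fin n) (z : Fin n → ℝ) :
    HasDerivAt (fun s : ℝ => k (proj z + axis i s))
      (fderiv ℝ (fun z : Fin n → ℝ => k (proj z)) z (Pi.single i 1)) 0 := by
  have h1 : HasFDerivAt (fun z : Fin n → ℝ => k (proj z))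
      (fderiv ℝ (fun z : Fin n → ℝ => k (proj z)) z) (z + (0 : ℝ) • Pi.single i 1) := by
    rw [zero_smul, add_zero]
    exact ((ContDiff.differentiable h (by simp)) z).hasFDerivAt
  have h2 : HasDerivAt (fun s : ℝ => z + s • (Pi.single i 1 : Fin n → ℝ)) (Pi.single i 1) 0 := by
    simpa using ((hasDerivAt_id (0 : ℝ)).smul_const (Pi.single i 1 : Fin n → ℝ)).const_add z
  simpa only [Function.comp_def, proj_add_single] using h1.comp_hasDerivAt (0 : ℝ) h2

lemma TSmooth.hasPD {k : Torus n → ℝ} (h : TSmooth k) (i : Fin n) :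
    HasPD i k (fun x => grad k x i) := by
  intro x
  obtain ⟨z, rfl⟩ := proj_surjective x
  exact (h.hasDerivAt_line i z).differentiableAt.hasDerivAt

lemma TSmooth.grad {k : Torus n → ℝ} (h : TSmooth k) (i : Fin n) :
    TSmooth (fun x => grad k x i) := by
  have : (fun z : Fin n → ℝ => DriftDiffusion.grad k (proj z) i) =
      fun z => fderiv ℝ (fun z : Fin n → ℝ => k (proj z)) z (Pi.single i 1) :=
    funext fun z => (h.hasDerivAt_line i z).deriv
  unfold TSmooth
  rw [this]
  exact (ContDiff.fderiv_right (m := ((⊤ : ℕ∞) : WithTop ℕ∞)) h (by simp)).clm_apply contDiff_const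

/-- These products are the only test functions inserted in the weak formulations: they turn them
into statements on the convolution with k at the point x. -/
lemma TSmooth.isTestFunction {k : Torus n → ℝ} (h : TSmooth k) (x : Torus n) {τ T a b : ℝ}
    {η : ℝ → ℝ} (hη : ContDiff ℝ ((⊤ : ℕ∞) : WithTop ℕ∞) η) (ha : τ < a) (hb : b < T)
    (hs : ∀ t, t ∉ Icc a b → η t = 0) : IsTestFunction τ T fun t y => η t * k (x - y) := by
  refine ⟨?_, a, b, ha, hb, fun t ht y => by simp [hs t ht]⟩
  obtain ⟨w, rfl⟩ := proj_surjective x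
  have : (fun z : ℝ × (Fin n → ℝ) => η z.1 * k (proj w - fun i => (z.2 i : UnitAddCircle))) =
      fun z => η z.1 * k (proj (w - z.2)) := by
    funext z; rw [proj_sub]; rfl
  rw [this]
  exact (hη.comp contDiff_fst).mul (ContDiff.comp (g := fun z : Fin n → ℝ => k (proj z)) h (contDiff_const.sub contDiff_snd))

/-- The function `cos (2 π y)` on the circle. -/
def circleCos (y : UnitAddCircle) : ℝ := (fourier (T := 1) 1 y : ℂ).re

lemma circleCos_coe (s : ℝ) : circleCos (s : UnitAddCircle) = Real.cos (2 * Real.pi * s) := by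
  unfold circleCos
  rw [fourier_coe_apply, ← Complex.exp_ofReal_mul_I_re]
  congr 2; push_cast; ring

lemma continuous_circleCos : Continuous circleCos :=
  Complex.continuous_re.comp (fourier (T := 1) 1).continuous

lemma circleCos_neg (y : UnitAddCircle) : circleCos (-y) = circleCos y := by
  obtain ⟨s, rfl⟩ := QuotientAddGroup.mk_surjective y
  have := circleCos_coe (-s)
  simp only [mul_neg, Real.cos_neg] at this
  exact this.trans (circleCos_coe s).symm

lemma circleCos_le_one (y : UnitAddCircle) : circleCos y ≤ 1 := by
  obtain ⟨s, rfl⟩ := QuotientAddGroup.mk_surjective y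
  exact (circleCos_coe s).trans_le (Real.cos_le_one _)

lemma eq_zero_of_circleCos_eq_one {y : UnitAddCircle} (h : circleCos y = 1) : y = 0 := by
  obtain ⟨s, rfl⟩ := QuotientAddGroup.mk_surjective y
  have h1 := (circleCos_coe s).symm.trans h
  obtain ⟨m, hm⟩ := (Real.cos_eq_one_iff _).1 h1
  have : s = m := by
    have := Real.pi_pos
    nlinarith [mul_left_cancel₀ (by positivity : (2 * Real.pi) ≠ 0)
      (show 2 * Real.pi * (m : ℝ) = 2 * Real.pi * s by linarith)]
  rw [this]
  exact (AddCircle.coe_eq_zero_iff 1).2 ⟨m, by simp⟩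

/-- A smooth function on the torus which vanishes only at the origin. -/
def bowl (x : Torus n) : ℝ := ∑ i, (1 - circleCos (x i))

lemma continuous_bowl : Continuous (bowl (n := n)) :=
  continuous_finsetSum _ fun i _ => continuous_const.sub (continuous_circleCos.comp (continuous_apply i))

lemma bowl_zero : bowl (0 : Torus n) = 0 := by
  have := circleCos_coe 0
  simp only [mul_zero, Real.cos_zero] at this
  refine Finset.sum_eq_zero fun i _ => ?_
  change 1 - circleCos 0 = 0
  rw [show (0 : UnitAddCircle) = ((0 : ℝ) : UnitAddCircle) from rfl, this, sub_self]

lemma bowl_neg (x : Torus n) : bowl (-x) = bowl x := by simp [bowl, circleCos_neg]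

lemma eq_zero_of_bowl_nonpos {x : Torus n} (h : bowl x ≤ 0) : x = 0 := by
  have h0 : ∀ i ∈ Finset.univ, 0 ≤ 1 - circleCos (x i) := fun i _ => sub_nonneg.2 (circleCos_le_one _)
  have h1 := (Finset.sum_eq_zero_iff_of_nonneg h0).1 (le_antisymm h (Finset.sum_nonneg h0))
  funext i
  exact eq_zero_of_circleCos_eq_one (by linarith [h1 i (Finset.mem_univ i)])

/-- A smooth bump function around the origin of the torus. -/
def preKernel (n j : ℕ) (x : Torus n) : ℝ := Real.smoothTransition (1 / ((j : ℝ) + 1) - bowl x)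

lemma tsmooth_preKernel (j : ℕ) : TSmooth (preKernel n j) := by
  have : (fun z : Fin n → ℝ => preKernel n j (proj z)) = fun z => Real.smoothTransition
      (1 / ((j : ℝ) + 1) - ∑ i, (1 - Real.cos (2 * Real.pi * z i))) := by
    funext z
    simp only [preKernel, bowl, proj, circleCos_coe]
  unfold TSmooth
  rw [this]
  refine Real.smoothTransition.contDiff.comp (contDiff_const.sub (ContDiff.sum fun i _ => ?_))
  exact contDiff_const.sub (Real.contDiff_cos.comp (contDiff_const.mul (contDiff_apply ℝ ℝ i)))

lemma preKernel_nonneg (j : ℕ) (x : Torus n) : 0 ≤ preKernel n j x :=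
  Real.smoothTransition.nonneg _

lemma integral_preKernel_pos (j : ℕ) : 0 < ∫ x, preKernel n j x := by
  refine (tsmooth_preKernel j).continuous.integral_pos_of_hasCompactSupport_nonneg_nonzero
    (HasCompactSupport.of_compactSpace _) (preKernel_nonneg j) (x := 0) ?_
  refine (Real.smoothTransition.pos_of_pos ?_).ne'
  rw [bowl_zero]; simp; positivity

/-- The smoothing kernels on the torus. -/
def kernel (n j : ℕ) (x : Torus n) : ℝ := (∫ y, preKernel n j y)⁻¹ * preKernel n j x

lemma tsmooth_kernel (j : ℕ) : TSmooth (kernel n j) := contDiff_const.mul (tsmooth_preKernel j)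

lemma continuous_kernel (j : ℕ) : Continuous (kernel n j) := (tsmooth_kernel j).continuous

lemma kernel_nonneg (j : ℕ) (x : Torus n) : 0 ≤ kernel n j x :=
  mul_nonneg (inv_nonneg.2 (integral_preKernel_pos j).le) (preKernel_nonneg j x)

lemma integral_kernel (j : ℕ) : ∫ x, kernel n j x = 1 := by
  unfold kernel
  rw [integral_const_mul, inv_mul_cancel₀ (integral_preKernel_pos j).ne']

lemma kernel_neg (j : ℕ) (x : Torus n) : kernel n j (-x) = kernel n j x := by
  simp [kernel, preKernel, bowl_neg]

lemma kernel_sub_comm (j : ℕ) (x y : Torus n) : kernel n j (x - y) = kernel n j (y - x) := by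
  rw [← kernel_neg, neg_sub]

/-- The supports of the kernels shrink to the origin. -/
lemma eventually_kernel_eq_zero {U : Set (Torus n)} (hU : U ∈ 𝓝 0) :
    ∀ᶠ j in atTop, ∀ x ∉ U, kernel n j x = 0 := by
  obtain ⟨V, hVU, hV, h0⟩ := mem_nhds_iff.1 hU
  have hc : IsCompact Vᶜ := hV.isClosed_compl.isCompact
  -- Compactness: off a neighbourhood of the origin `bowl` has a positive minimum, and the kernel
  -- lives where `bowl` is less than 1/(j+1).
  obtain ⟨ε, hε, hb⟩ : ∃ ε > 0, ∀ x ∈ Vᶜ, ε ≤ bowl x := by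
    rcases (Vᶜ).eq_empty_or_nonempty with h | h
    · exact ⟨1, one_pos, by simp [h]⟩
    · obtain ⟨x, hx, hm⟩ := hc.exists_isMinOn h continuous_bowl.continuousOn
      refine ⟨bowl x, ?_, fun y hy => hm hy⟩
      by_contra hneg
      exact hx (eq_zero_of_bowl_nonpos (not_lt.1 hneg) ▸ h0)
  have := tendsto_one_div_add_atTop_nhds_zero_nat (𝕜 := ℝ)
  filter_upwards [this.eventually (gt_mem_nhds hε)] with j hj x hx
  have := hb x fun h => hx (hVU h)
  simp only [kernel, preKernel]
  rw [Real.smoothTransition.zero_of_nonpos (by linarith), mul_zero]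

/-! ### Convolution: derivatives, contraction in L^p, convergence. -/

/-- Convolution on the torus. -/
def conv (k g : Torus n → ℝ) (x : Torus n) : ℝ := ∫ y, k (x - y) * g y

lemma conv_eq (k g : Torus n → ℝ) (x : Torus n) : conv k g x = ∫ z, g (x - z) * k z := by
  unfold conv
  rw [← integral_sub_left_eq_self (fun z => g (x - z) * k z) volume x]
  simp [mul_comm]

lemma integrable_conv {k g : Torus n → ℝ} (hk : Continuous k) (hg : Integrable g volume)
    (x : Torus n) : Integrable (fun y => k (x - y) * g y) volume := by
  obtain ⟨C, _, hC⟩ := exists_bound_of_continuous hk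
  exact hg.bdd_mul (c := C) (hk.comp (continuous_const.sub continuous_id)).aestronglyMeasurable
    (Eventually.of_forall fun x => hC _)

lemma continuous_conv {k g : Torus n → ℝ} (hk : Continuous k) (hg : Integrable g volume) :
    Continuous (conv k g) := by
  obtain ⟨C, _, hC⟩ := exists_bound_of_continuous hk
  change Continuous fun x => ∫ y, k (x - y) * g y
  refine continuous_of_dominated (F := fun x y => k (x - y) * g y) (bound := fun y => C * |g y|)
    (fun x => (integrable_conv hk hg x).aestronglyMeasurable) (fun x => ?_) (hg.abs.const_mul C) ?_
  · refine Eventually.of_forall fun y => ?_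
    rw [norm_mul]
    exact mul_le_mul_of_nonneg_right (hC _) (norm_nonneg _)
  · exact Eventually.of_forall fun y => (hk.comp (continuous_id.sub continuous_const)).mul
      continuous_const

lemma abs_conv_le {k g : Torus n → ℝ} {C : ℝ} (hC : ∀ x, |k x| ≤ C)
    (hg : Integrable g volume) (x : Torus n) : |conv k g x| ≤ C * ∫ y, |g y| := by
  rw [← integral_const_mul]
  refine abs_integral_le_of_abs_le (hg.abs.const_mul C) fun y => ?_
  rw [abs_mul]
  exact mul_le_mul_of_nonneg_right (hC _) (abs_nonneg _)

lemma conv_sub {k g g' : Torus n → ℝ} (hk : Continuous k) (hg : Integrable g volume)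
    (hg' : Integrable g' volume) (x : Torus n) :
    conv k (fun y => g y - g' y) x = conv k g x - conv k g' x := by
  unfold conv
  rw [← integral_sub (integrable_conv hk hg x) (integrable_conv hk hg' x)]
  simp only [mul_sub]

/-- A change of variables moves the translation from g to k, so the derivative falls on the smooth
factor. -/
lemma hasPD_conv {i : Fin n} {k k' g : Torus n → ℝ} (h : HasPD i k k') (hk : Continuous k)
    (hk' : Continuous k') (hg : Integrable g volume) : HasPD i (conv k g) (conv k' g) := by
  intro x
  have := hasDerivAt_integral_translate h hk hk' (hg.comp_sub_left x) 0
  simp only [axis_zero, add_zero] at this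
  rw [conv_eq]
  refine this.congr_of_eventuallyEq (Eventually.of_forall fun s => ?_)
  simp only
  rw [conv_eq, ← integral_add_right_eq_self (fun z => g (x + axis i s - z) * k z) (axis i s)]
  simp

lemma eventually_conv_kernel_sub_le {ψ : Torus n → ℝ} (hψ : Continuous ψ) {ε : ℝ} (hε : 0 < ε) :
    ∀ᶠ j in atTop, ∀ x, |conv (kernel n j) ψ x - ψ x| ≤ ε := by
  have hu := CompactSpace.uniformContinuous_of_continuous hψ
  obtain ⟨δ, hδ, hu⟩ := Metric.uniformContinuous_iff.1 hu ε hε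
  filter_upwards [eventually_kernel_eq_zero (Metric.ball_mem_nhds (0 : Torus n) hδ)] with j hj x
  have e : ψ x = ∫ z, ψ x * kernel n j z := by rw [integral_const_mul, integral_kernel, mul_one]
  have i1 : Integrable (fun z => ψ (x - z) * kernel n j z) volume :=
    ((hψ.comp (continuous_const.sub continuous_id)).mul (continuous_kernel j)).integrable_torus
  have i2 : Integrable (fun z => ψ x * kernel n j z) volume :=
    (continuous_const.mul (continuous_kernel j)).integrable_torus
  rw [conv_eq]
  rw [e]
  rw [← integral_sub i1 i2]
  calc |∫ z, (ψ (x - z) * kernel n j z - ψ x * kernel n j z)| ≤ ∫ z, ε * kernel n j z := by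
        refine abs_integral_le_of_abs_le
          ((continuous_kernel j).integrable_torus.const_mul ε) fun z => ?_
        rw [← sub_mul, abs_mul, abs_of_nonneg (kernel_nonneg j z)]
        by_cases hz : z ∈ Metric.ball (0 : Torus n) δ
        · refine mul_le_mul_of_nonneg_right ?_ (kernel_nonneg j z)
          refine (le_of_lt ?_ : dist (ψ (x - z)) (ψ x) ≤ ε)
          apply hu
          simpa [dist_eq_norm] using hz
        · simp [hj z hz]
    _ = ε := by rw [integral_const_mul, integral_kernel, mul_one]

/-- Jensen's inequality, read off from the monotonicity of L^p norms on a probability space. -/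
lemma rpow_lintegral_le_lintegral_rpow {X : Type*} [MeasurableSpace X] {ν : Measure X}
    [IsProbabilityMeasure ν] {h : X → ℝ≥0∞} (hh : AEMeasurable h ν) {p : ℝ} (hp : 1 ≤ p) :
    (∫⁻ x, h x ∂ν) ^ p ≤ ∫⁻ x, h x ^ p ∂ν := by
  have hp0 : 0 < p := by linarith
  have h1 : (1 : ℝ≥0∞) ≤ ENNReal.ofReal p := by
    rw [← ENNReal.ofReal_one]; exact ENNReal.ofReal_le_ofReal hp
  have h2 := eLpNorm_le_eLpNorm_of_exponent_le (μ := ν) h1 hh.aestronglyMeasurable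
  rw [eLpNorm_one_eq_lintegral_enorm, eLpNorm_eq_lintegral_rpow_enorm_toReal
    (by positivity) ENNReal.ofReal_ne_top, ENNReal.toReal_ofReal hp0.le] at h2
  simp only [enorm_eq_self] at h2
  have h3 := ENNReal.rpow_le_rpow h2 hp0.le
  rwa [← ENNReal.rpow_mul, one_div, inv_mul_cancel₀ hp0.ne', ENNReal.rpow_one] at h3

lemma rpow_lintegral_mul_le {X : Type*} [MeasurableSpace X] {μ : Measure X} {w h : X → ℝ≥0∞}
    (hw : Measurable w) (hw1 : ∫⁻ x, w x ∂μ = 1) (hh : AEMeasurable h μ) {p : ℝ} (hp : 1 ≤ p) :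
    (∫⁻ x, w x * h x ∂μ) ^ p ≤ ∫⁻ x, w x * h x ^ p ∂μ := by
  have : IsProbabilityMeasure (μ.withDensity w) := ⟨by simp [withDensity_apply, hw1]⟩
  have h1 := rpow_lintegral_le_lintegral_rpow (ν := μ.withDensity w)
    (hh.mono_ac (withDensity_absolutelyContinuous μ w)) hp
  rw [lintegral_withDensity_eq_lintegral_mul₀ hw.aemeasurable hh,
    lintegral_withDensity_eq_lintegral_mul₀ hw.aemeasurable (hh.pow_const p)] at h1
  exact h1

lemma lintegral_enorm_kernel (j : ℕ) : ∫⁻ x, ‖kernel n j x‖ₑ = 1 := by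
  rw [← ofReal_integral_norm_eq_lintegral_enorm (continuous_kernel j).integrable_torus]
  simp only [Real.norm_of_nonneg (kernel_nonneg j _), integral_kernel, ENNReal.ofReal_one]

/-- Jensen's inequality for the probability density k(x - ·), integrated in x by Tonelli's theorem.
-/
lemma eLpNorm_conv_kernel_le (j : ℕ) {g : Torus n → ℝ} (hg : AEStronglyMeasurable g volume)
    {p : ℝ≥0∞} (hp : 1 ≤ p) (hp' : p ≠ ⊤) :
    eLpNorm (conv (kernel n j) g) p volume ≤ eLpNorm g p volume := by
  obtain ⟨g', hg', hgg'⟩ := hg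
  have e : conv (kernel n j) g = conv (kernel n j) g' := by
    funext x
    refine integral_congr_ae ?_
    filter_upwards [hgg'] with y hy using by rw [hy]
  rw [e, eLpNorm_congr_ae hgg']
  have hp0 : p ≠ 0 := (zero_lt_one.trans_le hp).ne'
  have hp1 : 1 ≤ p.toReal := by
    rw [← ENNReal.toReal_one]; exact (ENNReal.toReal_le_toReal ENNReal.one_ne_top hp').2 hp
  rw [eLpNorm_eq_lintegral_rpow_enorm_toReal hp0 hp', eLpNorm_eq_lintegral_rpow_enorm_toReal hp0 hp']
  refine ENNReal.rpow_le_rpow ?_ (by positivity)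
  have hK : Measurable fun x => ‖kernel n j x‖ₑ := (continuous_kernel j).measurable.enorm
  have s1 : ∀ x, ‖conv (kernel n j) g' x‖ₑ ^ p.toReal ≤
      ∫⁻ y, ‖kernel n j (x - y)‖ₑ * ‖g' y‖ₑ ^ p.toReal := by
    intro x
    have h1 : ‖conv (kernel n j) g' x‖ₑ ≤ ∫⁻ y, ‖kernel n j (x - y)‖ₑ * ‖g' y‖ₑ := by
      refine (enorm_integral_le_lintegral_enorm _).trans_eq ?_
      simp only [enorm_mul]
    refine (ENNReal.rpow_le_rpow h1 (by positivity)).trans ?_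
    refine rpow_lintegral_mul_le (w := fun y => ‖kernel n j (x - y)‖ₑ)
      (hK.comp (measurable_const.sub measurable_id)) ?_ hg'.measurable.enorm.aemeasurable hp1
    rw [lintegral_sub_left_eq_self (fun y => ‖kernel n j y‖ₑ) x, lintegral_enorm_kernel]
  refine (lintegral_mono s1).trans_eq ?_
  rw [lintegral_lintegral_swap]
  · refine lintegral_congr fun y => ?_
    have hK' : Measurable fun x => ‖kernel n j (x - y)‖ₑ :=
      hK.comp (measurable_id.sub measurable_const)
    rw [lintegral_mul_const _ hK', lintegral_sub_right_eq_self (fun x => ‖kernel n j x‖ₑ) y, lintegral_enorm_kernel, one_mul]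
  · refine Measurable.aemeasurable ?_
    exact (hK.comp (measurable_fst.sub measurable_snd)).mul
      ((hg'.measurable.comp measurable_snd).enorm.pow_const _)

lemma memLp_conv_kernel {g : Torus n → ℝ} {p : ℝ≥0∞} (hg : MemLp g p volume) (hp : 1 ≤ p)
    (hp' : p ≠ ⊤) (j : ℕ) : MemLp (conv (kernel n j) g) p volume :=
  ⟨(continuous_conv (continuous_kernel j) (hg.integrable hp)).aestronglyMeasurable,
    (eLpNorm_conv_kernel_le j hg.1 hp hp').trans_lt hg.2⟩

/-- Continuous functions are dense in L^p, convolution converges uniformly on them, and it is a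
contraction: three errors of size ε/3. -/
lemma tendsto_eLpNorm_conv_kernel_sub {g : Torus n → ℝ} {p : ℝ≥0∞} (hg : MemLp g p volume)
    (hp : 1 ≤ p) (hp' : p ≠ ⊤) :
    Tendsto (fun j => eLpNorm (fun x => conv (kernel n j) g x - g x) p volume) atTop (𝓝 0) := by
  rw [ENNReal.tendsto_nhds_zero]
  intro ε hε
  rcases eq_or_ne ε ⊤ with rfl | hε'
  · exact Eventually.of_forall fun _ => le_top
  have hδ : ε / 3 ≠ 0 := by simp [hε.ne']
  obtain ⟨ψ, hψ, hψm⟩ := hg.exists_boundedContinuous_eLpNorm_sub_le hp' hδ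
  have hδ' : 0 < (ε / 3).toReal := ENNReal.toReal_pos hδ (by finiteness)
  filter_upwards [eventually_conv_kernel_sub_le ψ.continuous hδ'] with j hj
  have hgψ : MemLp (fun x => g x - ψ x) p volume := hg.sub hψm
  have hgi := hg.integrable hp
  have hψi := hψm.integrable hp
  have e : (fun x => conv (kernel n j) g x - g x) =
      ((conv (kernel n j) fun x => g x - ψ x) + fun x => conv (kernel n j) ψ x - ψ x)
        + fun x => -(g x - ψ x) := by
    funext x
    simp only [Pi.add_apply, conv_sub (continuous_kernel j) hgi hψi]
    ring
  have m1 : AEStronglyMeasurable (conv (kernel n j) fun x => g x - ψ x) volume :=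
    (memLp_conv_kernel hgψ hp hp' j).1
  have m2 : AEStronglyMeasurable (fun x => conv (kernel n j) ψ x - ψ x) volume :=
    ((memLp_conv_kernel hψm hp hp' j).sub hψm).1
  have b2 : eLpNorm (fun x => conv (kernel n j) ψ x - ψ x) p volume ≤ ε / 3 := by
    have := eLpNorm_le_of_ae_bound (p := p) (μ := (volume : Measure (Torus n)))
      (Eventually.of_forall hj : ∀ᵐ x ∂volume, ‖conv (kernel n j) ψ x - ψ x‖ ≤ (ε / 3).toReal)
    rw [ENNReal.ofReal_toReal (show ε / 3 ≠ ⊤ by finiteness)] at this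
    simpa using this
  rw [e]
  calc _ ≤ ε / 3 + ε / 3 + ε / 3 := by
        refine (eLpNorm_add_le (m1.add m2) hgψ.neg.1 hp).trans (add_le_add
          ((eLpNorm_add_le m1 m2 hp).trans (add_le_add ?_ b2)) ?_)
        · exact (eLpNorm_conv_kernel_le j hgψ.1 hp hp').trans hψ
        · exact (eLpNorm_neg (fun x => g x - ψ x) p volume).le.trans hψ
    _ = ε := ENNReal.add_thirds ε

/-! ### Translations in L² and averages over cubes. -/

/-- The squared modulus of continuity in `L²` of `w` along the axes is controlled by `D`. -/
def ShiftBound (w : Torus n → ℝ) (D : ℝ) : Prop :=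
  ∀ (i : Fin n) (h : ℝ), 0 < h → ∫ x, (w (x + axis i h) - w x) ^ 2 ≤ h ^ 2 * D

lemma ShiftBound.abs {w : Torus n → ℝ} {D : ℝ} (hD : ShiftBound w D) (i : Fin n) (h : ℝ) :
    ∫ x, (w (x + axis i h) - w x) ^ 2 ≤ h ^ 2 * D := by
  rcases lt_trichotomy h 0 with hh | rfl | hh
  · have h1 := hD i (-h) (by linarith)
    rw [← integral_add_right_eq_self _ (axis i h)] at h1
    simp only [axis_neg, add_neg_cancel_right, even_two.neg_pow] at h1
    refine le_trans (le_of_eq ?_) h1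
    exact integral_congr_ae (Eventually.of_forall fun x => by ring)
  · simp [axis_zero]
  · exact hD i h hh

/-- Minkowski's inequality for squares, from Young's inequality with weight m. Adding one increment
to m others gives (m + 1)², so an induction costs only the square of the number of increments. The
weight 1/m forces the case m = 0 apart. -/
lemma integral_sq_add_le {X : Type*} [MeasurableSpace X] {μ : Measure X} {f g : X → ℝ} {m c : ℝ}
    (hm : 0 ≤ m) (hf : Integrable (fun x => f x ^ 2) μ)
    (hg : Integrable (fun x => g x ^ 2) μ)
    (h1 : ∫ x, f x ^ 2 ∂μ ≤ m ^ 2 * c) (h2 : ∫ x, g x ^ 2 ∂μ ≤ c) :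
    ∫ x, (f x + g x) ^ 2 ∂μ ≤ (m + 1) ^ 2 * c := by
  rcases hm.eq_or_lt with rfl | hm
  · have h3 : ∫ x, f x ^ 2 ∂μ = 0 :=
      le_antisymm (by simpa using h1) (integral_nonneg fun x => sq_nonneg _)
    have h4 := (integral_eq_zero_iff_of_nonneg (fun x => sq_nonneg (f x)) hf).1 h3
    have h5 : ∫ x, (f x + g x) ^ 2 ∂μ = ∫ x, g x ^ 2 ∂μ := by
      refine integral_congr_ae ?_
      filter_upwards [h4] with x hx
      have : f x = 0 := by simpa using hx
      simp [this]
    rw [h5]; linarith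
  · calc ∫ x, (f x + g x) ^ 2 ∂μ ≤ ∫ x, ((1 + 1 / m) * f x ^ 2 + (1 + m) * g x ^ 2) ∂μ := by
          refine integral_mono_of_nonneg (Eventually.of_forall fun x => sq_nonneg _)
            ((hf.const_mul _).add (hg.const_mul _)) (Eventually.of_forall fun x => ?_)
          have : (1 + 1 / m) * f x ^ 2 + (1 + m) * g x ^ 2 - (f x + g x) ^ 2
              = (f x - m * g x) ^ 2 / m := by field_simp; ring
          have h0 : 0 ≤ (f x - m * g x) ^ 2 / m := by positivity
          simp only; linarith
      _ = (1 + 1 / m) * ∫ x, f x ^ 2 ∂μ + (1 + m) * ∫ x, g x ^ 2 ∂μ := by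
          rw [integral_add (hf.const_mul _) (hg.const_mul _), integral_const_mul, integral_const_mul]
      _ ≤ (1 + 1 / m) * (m ^ 2 * c) + (1 + m) * c := by gcongr
      _ = (m + 1) ^ 2 * c := by field_simp; ring

/-- Subtracting the nearest integer gives each coordinate a real representative as short as its norm
on the circle. -/
lemma exists_axis_sum (z : Torus n) :
    ∃ s : Fin n → ℝ, (∀ i, |s i| = ‖z i‖) ∧ z = ∑ i, axis i (s i) := by
  have : ∀ y : UnitAddCircle, ∃ s : ℝ, |s| = ‖y‖ ∧ y = (s : UnitAddCircle) := by
    intro y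
    obtain ⟨t, rfl⟩ := QuotientAddGroup.mk_surjective y
    refine ⟨t - round t, (UnitAddCircle.norm_eq).symm, ?_⟩
    have : ((round t : ℝ) : UnitAddCircle) = 0 := (AddCircle.coe_eq_zero_iff 1).2 ⟨round t, by simp⟩
    rw [AddCircle.coe_sub, this, sub_zero]
  choose s hs hs' using fun i => this (z i)
  refine ⟨s, hs, ?_⟩
  ext i
  rw [Finset.sum_apply, Finset.sum_eq_single i]
  · simp [axis, ← hs']
  · intro j _ hj; simp [axis, hj.symm]
  · simp

/-- The point z is reached by moving one coordinate at a time; `integral_sq_add_le` adds up the n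
increments. -/
lemma ShiftBound.translate {w : Torus n → ℝ} {D : ℝ} (hD : ShiftBound w D) (hw : Continuous w)
    (hD0 : 0 ≤ D) {η : ℝ} {z : Torus n} (hz : ‖z‖ ≤ η) :
    ∫ x, (w (x + z) - w x) ^ 2 ≤ n ^ 2 * (η ^ 2 * D) := by
  obtain ⟨s, hs, rfl⟩ := exists_axis_sum z
  have key : ∀ S : Finset (Fin n),
      ∫ x, (w (x + ∑ i ∈ S, axis i (s i)) - w x) ^ 2 ≤ (S.card : ℝ) ^ 2 * (η ^ 2 * D) := by
    intro S
    induction S using Finset.induction_on with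
    | empty => simp
    | insert i S hi ih =>
      rw [Finset.card_insert_of_notMem hi]
      push_cast
      have c1 : Continuous fun x => w (x + axis i (s i) + ∑ j ∈ S, axis j (s j)) := by fun_prop
      have c2 : Continuous fun x => w (x + axis i (s i)) := by fun_prop
      have e : ∀ x, w (x + ∑ j ∈ insert i S, axis j (s j)) - w x =
          (w (x + axis i (s i) + ∑ j ∈ S, axis j (s j)) - w (x + axis i (s i)))
            + (w (x + axis i (s i)) - w x) := by
        intro x; rw [Finset.sum_insert hi, add_assoc]; ring
      simp only [e]
      have hs2 : s i ^ 2 ≤ η ^ 2 := by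
        rw [← sq_abs]
        exact pow_le_pow_left₀ (abs_nonneg _) ((hs i).trans_le ((norm_le_pi_norm _ i).trans hz)) 2
      refine integral_sq_add_le (by positivity) ?_ ?_ ?_ ?_
      · exact Continuous.integrable_torus (by fun_prop)
      · exact Continuous.integrable_torus (by fun_prop)
      · rw [integral_add_right_eq_self
          (fun x => (w (x + ∑ j ∈ S, axis j (s j)) - w x) ^ 2) (axis i (s i))]
        exact ih
      · exact (hD.abs i (s i)).trans (by gcongr)
  simpa using key Finset.univ

/-- The average of translates of `g` with respect to `ν`. -/
def avg (ν : Measure (Torus n)) (g : Torus n → ℝ) (x : Torus n) : ℝ := ∫ z, g (x + z) ∂ν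

section avg

variable {ν ν' : Measure (Torus n)} [IsProbabilityMeasure ν] [IsProbabilityMeasure ν']
  {g w : Torus n → ℝ}

lemma continuous_avg (hg : Continuous g) : Continuous (avg ν g) := by
  obtain ⟨C, _, hC⟩ := exists_bound_of_continuous hg
  change Continuous fun x => ∫ z, g (x + z) ∂ν
  refine continuous_of_dominated (F := fun x z => g (x + z)) (bound := fun _ => C)
    (fun x => ?_) (fun x => ?_) (integrable_const C) ?_
  · exact (hg.comp (continuous_const.add continuous_id)).aestronglyMeasurable
  · exact Eventually.of_forall fun z => hC _
  · exact Eventually.of_forall fun z => hg.comp (continuous_id.add continuous_const)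

lemma avg_sub (hg : Continuous g) (hw : Continuous w) (x : Torus n) :
    avg ν (fun y => g y - w y) x = avg ν g x - avg ν w x :=
  integral_sub (Continuous.integrable_torus (by fun_prop)) (Continuous.integrable_torus (by fun_prop))

/-- Fubini. Commuting averages allow a difference of squares of averaging operators to be factored
in `ShiftBound.dyadic_piece`. -/
lemma avg_comm (hg : Continuous g) (x : Torus n) : avg ν (avg ν' g) x = avg ν' (avg ν g) x := by
  have hi : Integrable (Function.uncurry fun z z' => g (x + z + z')) (ν.prod ν') :=
    Continuous.integrable_torus (by unfold Function.uncurry; fun_prop)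
  unfold avg
  rw [integral_integral_swap hi]
  simp only [add_right_comm]

lemma abs_avg_sub_le {ε : ℝ} (hg : Continuous g) (x : Torus n)
    (h : ∀ᵐ z ∂ν, |g (x + z) - g x| ≤ ε) : |avg ν g x - g x| ≤ ε := by
  have e : avg ν g x - g x = ∫ z, (g (x + z) - g x) ∂ν := by
    rw [integral_sub (Continuous.integrable_torus (by fun_prop)) (integrable_const _)]
    simp [avg]
  rw [e]
  have := norm_integral_le_of_norm_le_const (μ := ν) (f := fun z => g (x + z) - g x) h
  simpa using this

lemma abs_avg_le {ε : ℝ} (hg : ∀ x, |g x| ≤ ε) (x : Torus n) : |avg ν g x| ≤ ε := by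
  have := norm_integral_le_of_norm_le_const (μ := ν) (f := fun z => g (x + z))
    (Eventually.of_forall fun z => hg _)
  simpa [avg] using this

lemma sq_integral_le {f : Torus n → ℝ} (hf : Continuous f) :
    (∫ z, f z ∂ν) ^ 2 ≤ ∫ z, f z ^ 2 ∂ν := by
  have h1 : Integrable f ν := hf.integrable_torus
  have h2 : Integrable (fun z => f z ^ 2) ν := (hf.pow 2).integrable_torus
  exact ConvexOn.map_integral_le (g := fun x : ℝ => x ^ 2) (s := univ) (even_two.convexOn_pow)
    (continuous_pow 2).continuousOn isClosed_univ (by simp) h1 h2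

/-- Jensen's inequality in z, then Fubini: an average of translates is no further from w than the
translates themselves. -/
lemma integral_avg_sub_sq_le {E : ℝ} (hw : Continuous w)
    (h : ∀ᵐ z ∂ν, ∫ x, (w (x + z) - w x) ^ 2 ≤ E) : ∫ x, (avg ν w x - w x) ^ 2 ≤ E := by
  have e : ∀ x, avg ν w x - w x = ∫ z, (w (x + z) - w x) ∂ν := fun x => by
    rw [integral_sub (Continuous.integrable_torus (by fun_prop)) (integrable_const _)]
    simp [avg]
  have hi : Integrable (Function.uncurry fun x z => (w (x + z) - w x) ^ 2)
      ((volume : Measure (Torus n)).prod ν) :=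
    Continuous.integrable_torus (by unfold Function.uncurry; fun_prop)
  calc ∫ x, (avg ν w x - w x) ^ 2 ≤ ∫ x, ∫ z, (w (x + z) - w x) ^ 2 ∂ν := by
        refine integral_mono ?_ hi.integral_prod_left fun x => ?_
        · exact (((continuous_avg hw).sub hw).pow 2).integrable_torus
        · simp only [e]
          exact sq_integral_le (by fun_prop)
    _ = ∫ z, (∫ x, (w (x + z) - w x) ^ 2) ∂ν := integral_integral_swap hi
    _ ≤ ∫ _, E ∂ν := integral_mono_ae hi.integral_prod_right (integrable_const _) h
    _ = E := by simp

lemma integral_avg_sq_le (hg : Continuous g) : ∫ x, avg ν g x ^ 2 ≤ ∫ x, g x ^ 2 := by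
  have hi : Integrable (Function.uncurry fun x z => g (x + z) ^ 2)
      ((volume : Measure (Torus n)).prod ν) :=
    Continuous.integrable_torus (by unfold Function.uncurry; fun_prop)
  calc ∫ x, avg ν g x ^ 2 ≤ ∫ x, ∫ z, g (x + z) ^ 2 ∂ν := by
        refine integral_mono ?_ hi.integral_prod_left fun x => ?_
        · exact ((continuous_avg hg).pow 2).integrable_torus
        · exact sq_integral_le (by fun_prop)
    _ = ∫ z, (∫ x, g (x + z) ^ 2) ∂ν := integral_integral_swap hi
    _ = ∫ x, g x ^ 2 := by
        simp only [integral_add_right_eq_self fun x => g x ^ 2]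
        simp

/-- Averaging smooths from L² to L^∞ when the measure has bounded density; a cube of side h has
density h^(-n). -/
lemma avg_sq_le {Γ : ℝ} (hΓ : 0 ≤ Γ) (hν : ν ≤ ENNReal.ofReal Γ • volume) (hg : Continuous g)
    (x : Torus n) : avg ν g x ^ 2 ≤ Γ * ∫ y, g y ^ 2 := by
  have hc : Continuous fun z => g (x + z) ^ 2 := by fun_prop
  calc avg ν g x ^ 2 ≤ ∫ z, g (x + z) ^ 2 ∂ν := sq_integral_le (by fun_prop)
    _ ≤ ∫ z, g (x + z) ^ 2 ∂(ENNReal.ofReal Γ • volume) := by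
        refine integral_mono_measure hν (Eventually.of_forall fun z => sq_nonneg _) ?_
        exact (hc.integrable_torus (μ := volume)).smul_measure ENNReal.ofReal_ne_top
    _ = Γ * ∫ y, g y ^ 2 := by
        rw [integral_smul_measure, integral_add_left_eq_self (fun z => g z ^ 2) x,
          ENNReal.toReal_ofReal hΓ, smul_eq_mul]

end avg

/-- The normalised restriction of the Haar measure to a cube of side `h`. -/
def cube (n : ℕ) (h : ℝ) : Measure (Torus n) :=
  ProbabilityTheory.cond volume (Metric.closedBall (0 : Torus n) (h / 2))

lemma volume_closedBall_torus {h : ℝ} (h0 : 0 < h) (h1 : h ≤ 1) :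
    volume (Metric.closedBall (0 : Torus n) (h / 2)) = ENNReal.ofReal (h ^ n) := by
  rw [closedBall_pi _ (by positivity), volume_pi_pi]
  have : ∀ i : Fin n, volume (Metric.closedBall ((0 : Torus n) i) (h / 2)) = ENNReal.ofReal h := by
    intro i
    rw [AddCircle.volume_closedBall]
    congr 1
    rw [min_eq_right] <;> linarith
  simp only [this, Finset.prod_const, Finset.card_univ, Fintype.card_fin]
  rw [ENNReal.ofReal_pow h0.le]

lemma isProbabilityMeasure_cube {h : ℝ} (h0 : 0 < h) (h1 : h ≤ 1) :
    IsProbabilityMeasure (cube n h) := by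
  refine ProbabilityTheory.cond_isProbabilityMeasure ?_
  rw [volume_closedBall_torus h0 h1]
  simp; positivity

lemma cube_le {h : ℝ} (h0 : 0 < h) (h1 : h ≤ 1) :
    cube n h ≤ ENNReal.ofReal ((h ^ n)⁻¹) • volume := by
  rw [cube, ProbabilityTheory.cond, volume_closedBall_torus h0 h1,
    ENNReal.ofReal_inv_of_pos (by positivity)]
  refine Measure.le_iff.2 fun s hs => ?_
  simp only [Measure.smul_apply, smul_eq_mul]
  gcongr
  exact Measure.restrict_le_self

lemma ae_cube {h : ℝ} : ∀ᵐ z ∂cube n h, ‖z‖ ≤ h / 2 := by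
  have : ∀ᵐ z ∂(volume : Measure (Torus n)).restrict (Metric.closedBall 0 (h / 2)),
      z ∈ Metric.closedBall (0 : Torus n) (h / 2) :=
    ae_restrict_mem Metric.isClosed_closedBall.measurableSet
  have := Measure.ae_smul_measure this (volume (Metric.closedBall (0 : Torus n) (h / 2)))⁻¹
  filter_upwards [this] with z hz using by simpa using hz

/-! ### The weighted Gagliardo–Nirenberg inequality and absorption. -/

/-- Hölder's inequality with respect to the measure `g² dx`. -/
lemma integral_abs_mul_sq_le {q : ℝ≥0∞} (hq : 1 ≤ q) {d g : Torus n → ℝ} (hd : MemLp d q volume)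
    (hg : Continuous g) {Γ S : ℝ} (hΓ : 0 ≤ Γ) (hgΓ : ∀ x, g x ^ 2 ≤ Γ) (hS : ∫ x, g x ^ 2 ≤ S) :
    ∫ x, |d x| * g x ^ 2 ≤
      (eLpNorm d q volume).toReal * (Γ ^ (1 / q.toReal) * S ^ (1 - 1 / q.toReal)) := by
  have hS0 : 0 ≤ S := (integral_nonneg fun x => sq_nonneg _).trans hS
  rcases hΓ.eq_or_lt with rfl | hΓ
  · have : ∀ x, g x ^ 2 = 0 := fun x => le_antisymm (hgΓ x) (sq_nonneg _)
    simp only [this, mul_zero, integral_zero]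
    positivity
  -- For q = ⊤ the conventions give `1 / q.toReal = 0`, which is the intended value of 1/q.
  have ha : 1 / q.toReal ≤ 1 := by
    rcases eq_or_ne q ⊤ with rfl | hq'
    · simp
    · have : 1 ≤ q.toReal := by
        rw [← ENNReal.toReal_one]
        exact (ENNReal.toReal_le_toReal ENNReal.one_ne_top hq').2 hq
      rw [div_le_one (by linarith)]; exact this
  -- With μ = g² dx the left side is the L¹(μ) norm of d. Comparison with its L^q(μ) norm costs
  -- μ(univ)^(1 - 1/q), and μ ≤ Γ dx costs Γ^(1/q). The endpoints q = 1 and q = ⊤ need no separate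
  -- treatment.
  set μ : Measure (Torus n) := volume.withDensity fun x => ENNReal.ofReal (g x ^ 2) with hμ
  have hmeas : Measurable fun x => ENNReal.ofReal (g x ^ 2) :=
    (hg.pow 2).measurable.ennreal_ofReal
  have hμΓ : μ ≤ ENNReal.ofReal Γ • volume := by
    rw [← withDensity_const]
    exact withDensity_mono (Eventually.of_forall fun x => ENNReal.ofReal_le_ofReal (hgΓ x))
  have hμu : μ univ = ENNReal.ofReal (∫ x, g x ^ 2) := by
    rw [hμ, withDensity_apply _ MeasurableSet.univ, Measure.restrict_univ,
      ofReal_integral_eq_lintegral_ofReal (Continuous.integrable_torus (by fun_prop))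
        (Eventually.of_forall fun x => sq_nonneg _)]
  have hdμ : AEStronglyMeasurable d μ := hd.1.mono_ac (withDensity_absolutelyContinuous _ _)
  have h1 := eLpNorm_le_eLpNorm_mul_rpow_measure_univ hq hdμ
  have h2 : eLpNorm d q μ ≤ ENNReal.ofReal Γ ^ (1 / q.toReal) * eLpNorm d q volume := by
    refine (eLpNorm_mono_measure d hμΓ).trans_eq ?_
    rw [eLpNorm_smul_measure_of_ne_zero (by simpa using hΓ)]
    simp
  have h3 : eLpNorm d 1 μ = ENNReal.ofReal (∫ x, |d x| * g x ^ 2) := by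
    rw [eLpNorm_one_eq_lintegral_enorm, lintegral_withDensity_eq_lintegral_mul₀
      hmeas.aemeasurable hd.1.enorm, ofReal_integral_eq_lintegral_ofReal]
    · refine lintegral_congr fun x => ?_
      rw [Pi.mul_apply, mul_comm, ENNReal.ofReal_mul (abs_nonneg _), ← Real.norm_eq_abs,
        ofReal_norm]
    · exact (hd.integrable hq).abs.mul_bdd (c := Γ) (hg.pow 2).aestronglyMeasurable
        (Eventually.of_forall fun x => by
          rw [Real.norm_of_nonneg (sq_nonneg _)]; exact hgΓ x)
    · exact Eventually.of_forall fun x => by positivity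
  rw [h3, hμu] at h1
  have hX : eLpNorm d q volume = ENNReal.ofReal (eLpNorm d q volume).toReal :=
    (ENNReal.ofReal_toReal hd.2.ne).symm
  have h4 : ENNReal.ofReal (∫ x, |d x| * g x ^ 2) ≤
      ENNReal.ofReal ((eLpNorm d q volume).toReal * (Γ ^ (1 / q.toReal) * S ^ (1 - 1 / q.toReal))) := by
    rw [ENNReal.ofReal_mul ENNReal.toReal_nonneg, ENNReal.ofReal_mul (by positivity),
      ← ENNReal.ofReal_rpow_of_nonneg hΓ.le (by positivity),
      ← ENNReal.ofReal_rpow_of_nonneg hS0 (by linarith), ← hX]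
    refine h1.trans ?_
    simp only [ENNReal.toReal_one, div_one]
    calc _ ≤ (ENNReal.ofReal Γ ^ (1 / q.toReal) * eLpNorm d q volume) *
          ENNReal.ofReal S ^ (1 - 1 / q.toReal) := by
            gcongr
      _ = _ := by ring
  exact (ENNReal.ofReal_le_ofReal_iff (by positivity)).1 h4

lemma one_div_toReal_le_one {q : ℝ≥0∞} (hq : 1 ≤ q) : 1 / q.toReal ≤ 1 := by
  rcases eq_or_ne q ⊤ with rfl | hq'
  · simp
  · have : 1 ≤ q.toReal := by
      rw [← ENNReal.toReal_one]
      exact (ENNReal.toReal_le_toReal ENNReal.one_ne_top hq').2 hq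
    rw [div_le_one (by linarith)]; exact this

lemma rpow_mul_rpow_one_sub {h B a : ℝ} (hh : 0 < h) (hB : 0 ≤ B) (ha : 0 ≤ a) (ha' : a ≤ 1) :
    ((h ^ n)⁻¹ * B) ^ a * B ^ (1 - a) = h ^ (-(n * a)) * B := by
  rw [Real.mul_rpow (by positivity) hB, mul_assoc, ← Real.rpow_add_of_nonneg hB ha (by linarith)]
  rw [add_sub_cancel, Real.rpow_one, ← Real.rpow_natCast, ← Real.rpow_neg hh.le, ← Real.rpow_mul hh.le]
  congr 2; ring

lemma integrable_abs_mul_sq {q : ℝ≥0∞} (hq : 1 ≤ q) {d g : Torus n → ℝ} (hd : MemLp d q volume)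
    (hg : Continuous g) : Integrable (fun x => |d x| * g x ^ 2) volume := by
  obtain ⟨C, _, hC⟩ := exists_bound_of_continuous (hg.pow 2)
  exact (hd.integrable hq).abs.mul_bdd (c := C) (hg.pow 2).aestronglyMeasurable
    (Eventually.of_forall hC)

lemma ShiftBound.avg_sub_le {w : Torus n → ℝ} {D : ℝ} (hD : ShiftBound w D) (hw : Continuous w)
    (hD0 : 0 ≤ D) {h : ℝ} (h0 : 0 < h) (h1 : h ≤ 1) :
    ∫ x, (avg (cube n h) w x - w x) ^ 2 ≤ n ^ 2 * ((h / 2) ^ 2 * D) := by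
  have := isProbabilityMeasure_cube (n := n) h0 h1
  refine integral_avg_sub_sq_le hw ?_
  filter_upwards [ae_cube (n := n) (h := h)] with z hz using hD.translate hw hD0 hz

/-- The dyadic pieces in the proof of the Gagliardo–Nirenberg inequality. -/
lemma ShiftBound.dyadic_piece {q : ℝ≥0∞} (hq : 1 ≤ q) {w : Torus n → ℝ} {D : ℝ}
    (hD : ShiftBound w D) (hw : Continuous w) (hD0 : 0 ≤ D) {d : Torus n → ℝ}
    (hd : MemLp d q volume) {h : ℝ} (h0 : 0 < h) (h1 : h ≤ 1) :
    ∫ x, |d x| * (avg (cube n (h / 2)) (avg (cube n (h / 2)) w) x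
        - avg (cube n h) (avg (cube n h) w) x) ^ 2 ≤
      (eLpNorm d q volume).toReal * (4 * 2 ^ n * n ^ 2 * D * h ^ (2 - n * (1 / q.toReal))) := by
  have hh0 : 0 < h / 2 := by positivity
  have hh1 : h / 2 ≤ 1 := by linarith
  have := isProbabilityMeasure_cube (n := n) h0 h1
  have := isProbabilityMeasure_cube (n := n) hh0 hh1
  set ν := cube n h
  set ν' := cube n (h / 2)
  set g : Torus n → ℝ := fun x => avg ν' w x - avg ν w x with hg
  have cν : Continuous (avg ν w) := continuous_avg hw
  have cν' : Continuous (avg ν' w) := continuous_avg hw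
  have cg : Continuous g := cν'.sub cν
  -- As the averages A and A' commute, A'² - A² = (A' + A)(A' - A). The function g = (A' - A) w is
  -- small in L² by the shift bound, and the remaining average bounds it in L^∞: this is why
  -- averages are taken twice.
  have e : ∀ x, avg ν' (avg ν' w) x - avg ν (avg ν w) x = avg ν' g x + avg ν g x := by
    intro x
    rw [hg, avg_sub cν' cν, avg_sub cν' cν, avg_comm (ν := ν') (ν' := ν) hw x]
    ring
  simp only [e]
  have cA : Continuous (avg ν' g) := continuous_avg cg
  have cB : Continuous (avg ν g) := continuous_avg cg
  set S : ℝ := n ^ 2 * h ^ 2 * D with hS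
  have hS0 : 0 ≤ S := by positivity
  have hgS : ∫ x, g x ^ 2 ≤ S := by
    have b1 := hD.avg_sub_le hw hD0 h0 h1
    have b2 := hD.avg_sub_le hw hD0 hh0 hh1
    have i1 : Integrable (fun x => (avg ν w x - w x) ^ 2) volume :=
      ((cν.sub hw).pow 2).integrable_torus
    have i2 : Integrable (fun x => (avg ν' w x - w x) ^ 2) volume :=
      ((cν'.sub hw).pow 2).integrable_torus
    calc ∫ x, g x ^ 2 ≤ ∫ x, (2 * (avg ν' w x - w x) ^ 2 + 2 * (avg ν w x - w x) ^ 2) := by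
          refine integral_mono (cg.pow 2).integrable_torus
            ((i2.const_mul 2).add (i1.const_mul 2)) fun x => ?_
          simp only [hg]
          nlinarith [sq_nonneg ((avg ν' w x - w x) + (avg ν w x - w x))]
      _ = 2 * (∫ x, (avg ν' w x - w x) ^ 2) + 2 * ∫ x, (avg ν w x - w x) ^ 2 := by
          rw [integral_add (i2.const_mul 2) (i1.const_mul 2), integral_const_mul,
            integral_const_mul]
      _ ≤ 2 * (n ^ 2 * ((h / 2 / 2) ^ 2 * D)) + 2 * (n ^ 2 * ((h / 2) ^ 2 * D)) := by gcongr
      _ ≤ S := by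
          have : 0 ≤ (n : ℝ) ^ 2 * h ^ 2 * D := hS0
          rw [hS]; nlinarith
  have hg0 : 0 ≤ ∫ x, g x ^ 2 := integral_nonneg fun x => sq_nonneg _
  have p1 : ∀ x, avg ν g x ^ 2 ≤ (h ^ n)⁻¹ * S := fun x =>
    (avg_sq_le (by positivity) (cube_le h0 h1) cg x).trans (by gcongr)
  have p2 : ∀ x, avg ν' g x ^ 2 ≤ 2 ^ n * ((h ^ n)⁻¹ * S) := fun x => by
    refine (avg_sq_le (by positivity) (cube_le hh0 hh1) cg x).trans ?_
    rw [div_pow, inv_div, ← mul_assoc, div_eq_mul_inv]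
    gcongr
  have two : (1 : ℝ) ≤ 2 ^ n := one_le_pow₀ (by norm_num)
  have hΓ : ∀ x, (avg ν' g x + avg ν g x) ^ 2 ≤ (h ^ n)⁻¹ * (4 * 2 ^ n * S) := by
    intro x
    have : 0 ≤ (h ^ n)⁻¹ * S := by positivity
    nlinarith [p1 x, p2 x, sq_nonneg (avg ν' g x - avg ν g x)]
  have hL : ∫ x, (avg ν' g x + avg ν g x) ^ 2 ≤ 4 * 2 ^ n * S := by
    have b := integral_sq_add_le (μ := (volume : Measure (Torus n))) (f := avg ν' g) (g := avg ν g)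
      zero_le_one (c := S) (cA.pow 2).integrable_torus (cB.pow 2).integrable_torus
      (by rw [one_pow, one_mul]; exact (integral_avg_sq_le cg).trans hgS)
      ((integral_avg_sq_le cg).trans hgS)
    refine b.trans ?_
    nlinarith
  have := integral_abs_mul_sq_le hq hd (cA.add cB) (by positivity) hΓ hL
  refine this.trans (le_of_eq ?_)
  rw [rpow_mul_rpow_one_sub h0 (by positivity) (by positivity) (one_div_toReal_le_one hq), sub_eq_add_neg,
    Real.rpow_add h0, hS]
  rw [Real.rpow_two]
  ring

lemma tendsto_avg_avg_cube {w : Torus n → ℝ} (hw : Continuous w) {h : ℕ → ℝ} (h0 : ∀ j, 0 < h j)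
    (h1 : ∀ j, h j ≤ 1) (hlim : Tendsto h atTop (𝓝 0)) (x : Torus n) :
    Tendsto (fun j => avg (cube n (h j)) (avg (cube n (h j)) w) x) atTop (𝓝 (w x)) := by
  rw [Metric.tendsto_nhds]
  intro ε hε
  obtain ⟨δ, hδ, hu⟩ := Metric.uniformContinuous_iff.1
    (CompactSpace.uniformContinuous_of_continuous hw) (ε / 3) (by positivity)
  filter_upwards [hlim.eventually (gt_mem_nhds hδ)] with j hj
  have := isProbabilityMeasure_cube (n := n) (h0 j) (h1 j)
  have b1 : ∀ y, |avg (cube n (h j)) w y - w y| ≤ ε / 3 := fun y => by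
    refine abs_avg_sub_le hw y ?_
    filter_upwards [ae_cube (n := n) (h := h j)] with z hz
    refine (le_of_lt ?_ : dist (w (y + z)) (w y) ≤ ε / 3)
    refine hu ?_
    simp only [dist_eq_norm, add_sub_cancel_left]
    linarith [h0 j]
  have cν : Continuous (avg (cube n (h j)) w) := continuous_avg hw
  have b2 := abs_avg_le (ν := cube n (h j)) b1 x
  rw [avg_sub cν hw] at b2
  rw [Real.dist_eq]
  have := abs_add_le (avg (cube n (h j)) (avg (cube n (h j)) w) x - avg (cube n (h j)) w x)
    (avg (cube n (h j)) w x - w x)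
  rw [sub_add_sub_cancel] at this
  linarith [b1 x]

/-- A Gagliardo–Nirenberg inequality with a weight `d ∈ L^q`, for functions whose modulus of
continuity in `L²` is controlled. -/
lemma exists_gagliardo_nirenberg {q : ℝ≥0∞} (hq : 1 ≤ q) (hnq : n * (1 / q.toReal) < 2) :
    ∃ C : ℝ, 0 ≤ C ∧ ∀ (w : Torus n → ℝ) (D : ℝ), Continuous w → 0 ≤ D → ShiftBound w D →
      ∀ d : Torus n → ℝ, MemLp d q volume → ∀ δ : ℝ, 0 < δ → δ ≤ 1 →
        ∫ x, |d x| * w x ^ 2 ≤ C * (eLpNorm d q volume).toReal *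
          (δ ^ (2 - n * (1 / q.toReal)) * D + δ ^ (-(n * (1 / q.toReal))) * ∫ x, w x ^ 2) := by
  set a := 1 / q.toReal with ha
  have ha0 : 0 ≤ a := by positivity
  have ha1 : a ≤ 1 := one_div_toReal_le_one hq
  set e := 2 - n * a with he
  have he0 : 0 < e := by rw [he]; linarith
  -- Half of the decay rate: the j-th dyadic piece is of order (ρ^j)². In the Cauchy–Schwarz
  -- inequality with weights ρ^j one factor ρ^j is spent on the weights and the other keeps the sum
  -- convergent.
  set ρ : ℝ := (1 / 2 : ℝ) ^ (e / 2) with hρ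
  have hρ0 : 0 < ρ := by positivity
  have hρ1 : ρ < 1 := Real.rpow_lt_one (by norm_num) (by norm_num) (by positivity)
  set K : ℝ := 4 * 2 ^ n * n ^ 2 with hK
  have hr : 0 < (1 - ρ)⁻¹ := inv_pos.2 (by linarith)
  refine ⟨max 2 (2 * ((1 - ρ)⁻¹ * (1 - ρ)⁻¹ * K)), le_max_of_le_left (by norm_num), ?_⟩
  intro w D hw hD0 hD d hd δ hδ hδ1
  set X := (eLpNorm d q volume).toReal with hX
  have hX0 : 0 ≤ X := ENNReal.toReal_nonneg
  set h : ℕ → ℝ := fun j => δ * (1 / 2) ^ j with hh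
  have h0 : ∀ j, 0 < h j := fun j => by positivity
  have h1 : ∀ j, h j ≤ 1 := fun j =>
    mul_le_one₀ hδ1 (by positivity) (pow_le_one₀ (by norm_num) (by norm_num))
  have hlim : Tendsto h atTop (𝓝 0) := by
    have := (tendsto_pow_atTop_nhds_zero_of_lt_one (r := (1 / 2 : ℝ)) (by norm_num)
      (by norm_num)).const_mul δ
    rwa [mul_zero] at this
  have hP := fun j => isProbabilityMeasure_cube (n := n) (h0 j) (h1 j)
  -- Telescoping from scale δ, where w enters only through its L² norm, to scale 0, where W tends to
  -- w; the increments cost D.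
  set W : ℕ → Torus n → ℝ := fun j => avg (cube n (h j)) (avg (cube n (h j)) w) with hW
  have cW : ∀ j, Continuous (W j) := fun j => continuous_avg (continuous_avg hw)
  have piece : ∀ j, ∫ x, |d x| * (W (j + 1) x - W j x) ^ 2 ≤ X * (K * D * (δ ^ e * (ρ ^ j) ^ 2)) := by
    intro j
    have e1 : h (j + 1) = h j / 2 := by simp only [hh, pow_succ]; ring
    have := hD.dyadic_piece hq hw hD0 hd (h0 j) (h1 j)
    rw [← e1] at this
    refine this.trans (le_of_eq ?_)
    congr 2
    change (h j) ^ e = _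
    rw [Real.mul_rpow hδ.le (by positivity), hρ, ← pow_mul, ← Real.rpow_natCast, ← Real.rpow_natCast,
      ← Real.rpow_mul (by norm_num), ← Real.rpow_mul (by norm_num)]
    congr 2; push_cast; ring
  set I : ℝ := ∫ x, w x ^ 2 with hI
  have hI0 : 0 ≤ I := integral_nonneg fun x => sq_nonneg _
  have first : ∫ x, |d x| * W 0 x ^ 2 ≤ X * (δ ^ (-(n * a)) * I) := by
    have e0 : h 0 = δ := by simp [hh]
    have := hP 0
    have cν : Continuous (avg (cube n (h 0)) w) := continuous_avg hw
    have hL := integral_avg_sq_le (ν := cube n (h 0)) hw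
    have := integral_abs_mul_sq_le hq hd (cW 0) (Γ := (h 0 ^ n)⁻¹ * I) (S := I) (by positivity)
      (fun x => (avg_sq_le (by positivity) (cube_le (h0 0) (h1 0)) cν x).trans
        (mul_le_mul_of_nonneg_left hL (by positivity)))
      ((integral_avg_sq_le cν).trans hL)
    rwa [rpow_mul_rpow_one_sub (h0 0) hI0 ha0 ha1, e0] at this
  have bound : ∀ J, ∫ x, |d x| * W J x ^ 2 ≤
      2 * (X * (δ ^ (-(n * a)) * I)) + 2 * ((1 - ρ)⁻¹ * (X * (K * D * δ ^ e) * (1 - ρ)⁻¹)) := by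
    intro J
    have geo : ∑ j ∈ Finset.range J, ρ ^ j ≤ (1 - ρ)⁻¹ := by
      rw [← tsum_geometric_of_lt_one hρ0.le hρ1]
      exact (summable_geometric_of_lt_one hρ0.le hρ1).sum_le_tsum _ fun j _ => by positivity
    have pt : ∀ x, W J x ^ 2 ≤ 2 * W 0 x ^ 2 + 2 * ((1 - ρ)⁻¹ *
        ∑ j ∈ Finset.range J, (ρ ^ j)⁻¹ * (W (j + 1) x - W j x) ^ 2) := by
      intro x
      have t : W J x - W 0 x = ∑ j ∈ Finset.range J, (W (j + 1) x - W j x) :=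
        (Finset.sum_range_sub (fun j => W j x) J).symm
      have s : (W J x - W 0 x) ^ 2 ≤ (1 - ρ)⁻¹ *
          ∑ j ∈ Finset.range J, (ρ ^ j)⁻¹ * (W (j + 1) x - W j x) ^ 2 := by
        rw [t]
        have s1 := Finset.sum_sq_le_sum_mul_sum_of_sq_le_mul (Finset.range J)
          (r := fun j => W (j + 1) x - W j x)
          (f := fun j => ρ ^ j) (g := fun j => (ρ ^ j)⁻¹ * (W (j + 1) x - W j x) ^ 2)
          (fun j _ => by positivity) (fun j _ => by positivity) (fun j _ => le_of_eq (by field_simp))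
        refine s1.trans (mul_le_mul_of_nonneg_right geo (Finset.sum_nonneg fun j _ => by positivity))
      nlinarith [sq_nonneg (W J x - 2 * W 0 x)]
    have i0 := integrable_abs_mul_sq hq hd (cW 0)
    have iΔ : ∀ j, Integrable (fun x => |d x| * (W (j + 1) x - W j x) ^ 2) volume := fun j =>
      integrable_abs_mul_sq hq hd ((cW (j + 1)).sub (cW j))
    have iS : Integrable (fun x => ∑ j ∈ Finset.range J,
        (ρ ^ j)⁻¹ * (|d x| * (W (j + 1) x - W j x) ^ 2)) volume :=
      integrable_finsetSum _ fun j _ => (iΔ j).const_mul _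
    calc ∫ x, |d x| * W J x ^ 2 ≤ ∫ x, (2 * (|d x| * W 0 x ^ 2) + 2 * ((1 - ρ)⁻¹ *
          ∑ j ∈ Finset.range J, (ρ ^ j)⁻¹ * (|d x| * (W (j + 1) x - W j x) ^ 2))) := by
          refine integral_mono (integrable_abs_mul_sq hq hd (cW J))
            ((i0.const_mul 2).add ((iS.const_mul _).const_mul 2)) fun x => ?_
          refine (mul_le_mul_of_nonneg_left (pt x) (abs_nonneg (d x))).trans (le_of_eq ?_)
          simp only [Finset.mul_sum, mul_add]
          congr 1
          · ring
          · exact Finset.sum_congr rfl fun j _ => by ring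
      _ = 2 * (∫ x, |d x| * W 0 x ^ 2) + 2 * ((1 - ρ)⁻¹ *
          ∑ j ∈ Finset.range J, (ρ ^ j)⁻¹ * ∫ x, |d x| * (W (j + 1) x - W j x) ^ 2) := by
          rw [integral_add (i0.const_mul 2) ((iS.const_mul _).const_mul 2), integral_const_mul,
            integral_const_mul, integral_const_mul, integral_finsetSum _ fun j _ => (iΔ j).const_mul _]
          simp only [integral_const_mul]
      _ ≤ 2 * (X * (δ ^ (-(n * a)) * I)) + 2 * ((1 - ρ)⁻¹ *
          ∑ j ∈ Finset.range J, (ρ ^ j)⁻¹ * (X * (K * D * (δ ^ e * (ρ ^ j) ^ 2)))) := by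
          gcongr with j _
          exact piece j
      _ = 2 * (X * (δ ^ (-(n * a)) * I)) + 2 * ((1 - ρ)⁻¹ * (X * (K * D * δ ^ e) *
          ∑ j ∈ Finset.range J, ρ ^ j)) := by
          congr 3
          rw [Finset.mul_sum]
          refine Finset.sum_congr rfl fun j _ => ?_
          field_simp
      _ ≤ _ := by gcongr
  obtain ⟨Cw, _, hCw⟩ := exists_bound_of_continuous hw
  have lim : Tendsto (fun J => ∫ x, |d x| * W J x ^ 2) atTop (𝓝 (∫ x, |d x| * w x ^ 2)) := by
    refine tendsto_integral_of_dominated_convergence (fun x => |d x| * Cw ^ 2)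
      (fun J => (integrable_abs_mul_sq hq hd (cW J)).1) ((hd.integrable hq).abs.mul_const _)
      (fun J => Eventually.of_forall fun x => ?_) (Eventually.of_forall fun x => ?_)
    · have := hP J
      have : |W J x| ≤ Cw := abs_avg_le (fun y => abs_avg_le hCw y) x
      rw [norm_mul, Real.norm_eq_abs, abs_abs, Real.norm_eq_abs, abs_pow]
      gcongr
    · exact ((tendsto_avg_avg_cube hw h0 h1 hlim x).pow 2).const_mul _
  refine (le_of_tendsto' lim bound).trans ?_
  have m1 : 2 ≤ max 2 (2 * ((1 - ρ)⁻¹ * (1 - ρ)⁻¹ * K)) := le_max_left _ _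
  have m2 : 2 * ((1 - ρ)⁻¹ * (1 - ρ)⁻¹ * K) ≤ max 2 (2 * ((1 - ρ)⁻¹ * (1 - ρ)⁻¹ * K)) :=
    le_max_right _ _
  set M := max 2 (2 * ((1 - ρ)⁻¹ * (1 - ρ)⁻¹ * K))
  have t1 : 0 ≤ X * (δ ^ (-(n * a)) * I) := by positivity
  have t2 : 0 ≤ X * (D * δ ^ e) := by positivity
  calc _ = 2 * (X * (δ ^ (-(n * a)) * I))
        + 2 * ((1 - ρ)⁻¹ * (1 - ρ)⁻¹ * K) * (X * (D * δ ^ e)) := by ring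
    _ ≤ M * (X * (δ ^ (-(n * a)) * I)) + M * (X * (D * δ ^ e)) := by gcongr
    _ = _ := by ring

/-- Absorption of the zeroth order term into the dissipation. -/
lemma exists_absorption {q : ℝ≥0∞} (hq : 1 ≤ q) (hnq : n * (1 / q.toReal) < 2) {r : ℝ}
    (hr : 2 / (2 - n * (1 / q.toReal)) ≤ r) {κ μ : ℝ} (hκ : 0 < κ) (hμ : 0 < μ) :
    ∃ C : ℝ, 0 ≤ C ∧ ∀ (w : Torus n → ℝ) (D : ℝ), Continuous w → 0 ≤ D → ShiftBound w D →
      ∀ d : Torus n → ℝ, MemLp d q volume → ∫ x, |d x| * w x ^ 2 ≤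
        κ * D + (μ + C * (eLpNorm d q volume).toReal ^ r) * ∫ x, w x ^ 2 := by
  obtain ⟨C₀, hC₀, gn⟩ := exists_gagliardo_nirenberg hq hnq
  set b := n * (1 / q.toReal) with hb
  have hb0 : 0 ≤ b := by positivity
  have he : 0 < 2 - b := by linarith
  set ν := min κ μ with hν
  have hν0 : 0 < ν := lt_min hκ hμ
  refine ⟨ν * (C₀ / ν) ^ r, by positivity, ?_⟩
  intro w D hw hD0 hD d hd
  set X := (eLpNorm d q volume).toReal
  have hX0 : 0 ≤ X := ENNReal.toReal_nonneg
  have hI0 : 0 ≤ ∫ x, w x ^ 2 := integral_nonneg fun x => sq_nonneg _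
  have hY : C₀ * X = ν * (C₀ / ν * X) := by field_simp
  -- Write Y = C₀ X / ν. If Y ≤ 1, the scale δ = 1 is enough. Otherwise δ is chosen with δ^(2-b) =
  -- 1/Y, which gives the dissipation the coefficient ν; the other coefficient becomes ν
  -- Y^(2/(2-b)), at most ν Y^r because Y > 1.
  rcases le_or_gt (C₀ / ν * X) 1 with h | h
  · have := gn w D hw hD0 hD d hd 1 one_pos le_rfl
    simp only [Real.one_rpow, one_mul] at this
    have h1 : C₀ * X ≤ ν := by rw [hY]; nlinarith
    calc _ ≤ C₀ * X * (D + ∫ x, w x ^ 2) := this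
      _ ≤ ν * (D + ∫ x, w x ^ 2) := by gcongr
      _ = ν * D + ν * ∫ x, w x ^ 2 := by ring
      _ ≤ κ * D + (μ + ν * (C₀ / ν) ^ r * X ^ r) * ∫ x, w x ^ 2 := by
        gcongr
        · exact min_le_left _ _
        · have : 0 ≤ ν * (C₀ / ν) ^ r * X ^ r := by positivity
          linarith [min_le_right κ μ]
  · set Y := C₀ / ν * X with hYdef
    have hY0 : 0 < Y := by linarith
    set δ := Y ^ (-(1 / (2 - b))) with hδ
    have hδ0 : 0 < δ := by positivity
    have hδ1 : δ ≤ 1 := Real.rpow_le_one_of_one_le_of_nonpos h.le (by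
      have : 0 < 1 / (2 - b) := by positivity
      linarith)
    have e1 : δ ^ (2 - b) = Y⁻¹ := by
      rw [hδ, ← Real.rpow_mul hY0.le, ← Real.rpow_neg_one]
      congr 1; field_simp
    have e2 : Y * δ ^ (-b) = Y ^ (2 / (2 - b)) := by
      rw [hδ, ← Real.rpow_mul hY0.le]
      nth_rw 1 [← Real.rpow_one Y]
      rw [← Real.rpow_add hY0]
      congr 1; field_simp; ring
    have h3 : Y ^ (2 / (2 - b)) ≤ Y ^ r := Real.rpow_le_rpow_of_exponent_le h.le hr
    have h4 : Y ^ r = (C₀ / ν) ^ r * X ^ r := Real.mul_rpow (by positivity) hX0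
    have := gn w D hw hD0 hD d hd δ hδ0 hδ1
    calc _ ≤ C₀ * X * (δ ^ (2 - b) * D + δ ^ (-b) * ∫ x, w x ^ 2) := this
      _ = ν * (Y * δ ^ (2 - b)) * D + ν * (Y * δ ^ (-b)) * ∫ x, w x ^ 2 := by rw [hY]; ring
      _ = ν * D + ν * Y ^ (2 / (2 - b)) * ∫ x, w x ^ 2 := by
        rw [e1, e2, mul_inv_cancel₀ hY0.ne', mul_one]
      _ ≤ κ * D + (μ + ν * (C₀ / ν) ^ r * X ^ r) * ∫ x, w x ^ 2 := by
        gcongr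
        · exact min_le_left _ _
        · rw [mul_assoc, ← h4]
          have : ν * Y ^ (2 / (2 - b)) ≤ ν * Y ^ r := by gcongr
          linarith

/-! ### Poincaré inequalities. -/

/-- The Poincaré inequality, in terms of translations. -/
lemma ShiftBound.poincare {w : Torus n → ℝ} {D : ℝ} (hD : ShiftBound w D) (hw : Continuous w)
    (hD0 : 0 ≤ D) : ∫ x, w x ^ 2 ≤ (∫ x, w x) ^ 2 + n ^ 2 * D := by
  -- Averaging over the whole torus gives the mean, and every translation has sup norm at most 1.
  have h1 : ∫ x, (avg volume w x - w x) ^ 2 ≤ n ^ 2 * (1 ^ 2 * D) := by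
    refine integral_avg_sub_sq_le hw (Eventually.of_forall fun z => hD.translate hw hD0 ?_)
    refine (pi_norm_le_iff_of_nonneg zero_le_one).2 fun i => ?_
    have := AddCircle.norm_le_half_period 1 one_ne_zero (x := z i)
    norm_num at this
    linarith
  have e : ∀ x, avg volume w x = ∫ y, w y := fun x => integral_add_left_eq_self w x
  simp only [e] at h1
  have i1 : Integrable (fun x => w x ^ 2) volume := (hw.pow 2).integrable_torus
  have i2 : Integrable w volume := hw.integrable_torus
  have h2 : ∫ x, ((∫ y, w y) - w x) ^ 2 = (∫ x, w x ^ 2) - (∫ y, w y) ^ 2 := by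
    have : ∀ x, ((∫ y, w y) - w x) ^ 2 = (w x ^ 2 - 2 * (∫ y, w y) * w x) + (∫ y, w y) ^ 2 :=
      fun x => by ring
    simp only [this]
    rw [integral_add (i1.fsub (i2.const_mul _)) (integrable_const _), integral_sub i1 (i2.const_mul _),
      integral_const_mul]
    simp; ring
  rw [h2] at h1
  linarith

/-- The Poincaré inequality for antisymmetric functions of two variables, for which the mean
vanishes. -/
lemma poincare_antisymm {w : Torus n → Torus n → ℝ} {D : Torus n → ℝ}
    (hw : Continuous (Function.uncurry w)) (hanti : ∀ x y, w x y = -w y x)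
    (hD : ∀ y, ShiftBound (fun x => w x y) (D y)) (hD0 : ∀ y, 0 ≤ D y) (hDi : Integrable D volume) :
    ∫ y, ∫ x, w x y ^ 2 ≤ 2 * n ^ 2 * ∫ y, D y := by
  have cx : ∀ y, Continuous fun x => w x y := fun y => hw.comp (by fun_prop : Continuous fun x => (x, y))
  have cy : ∀ x, Continuous fun y => w x y := fun x => hw.comp (by fun_prop : Continuous fun y => (x, y))
  -- The slices of w have means ∓m, which need not vanish. But m has mean zero by antisymmetry, and
  -- it inherits a shift bound from w by Jensen's inequality; so Poincaré's inequality is applied a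
  -- second time, to m, which explains the factor 2.
  set m : Torus n → ℝ := fun y => ∫ x, w y x with hm
  obtain ⟨C, _, hC⟩ := exists_bound_of_continuous hw
  have cm : Continuous m := by
    refine continuous_of_dominated (F := fun y x => w y x) (bound := fun _ => C)
      (fun y => (cy y).aestronglyMeasurable) (fun y => ?_) (integrable_const C) ?_
    · exact Eventually.of_forall fun x => hC (y, x)
    · exact Eventually.of_forall fun x => cx x
  have mm : ∀ y, (∫ x, w x y) ^ 2 = m y ^ 2 := fun y => by
    have : ∫ x, w x y = -m y := by
      rw [hm, ← integral_neg]
      exact integral_congr_ae (Eventually.of_forall fun x => hanti x y)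
    rw [this, neg_sq]
  have m0 : ∫ y, m y = 0 := by
    have hi : Integrable (Function.uncurry w) ((volume : Measure (Torus n)).prod volume) :=
      hw.integrable_torus
    have h1 : ∫ y, m y = ∫ y, ∫ x, w x y := integral_integral_swap hi
    have h2 : ∀ y, ∫ x, w x y = -m y := fun y => by
      rw [hm, ← integral_neg]
      exact integral_congr_ae (Eventually.of_forall fun x => hanti x y)
    simp only [h2, integral_neg] at h1
    linarith
  have hDI : 0 ≤ ∫ y, D y := integral_nonneg hD0
  have sm : ShiftBound m (∫ y, D y) := by
    intro i h hh
    have cc : Continuous (Function.uncurry fun y x => (w (y + axis i h) x - w y x) ^ 2) := by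
      have c1 : Continuous fun z : Torus n × Torus n => w (z.1 + axis i h) z.2 :=
        hw.comp (by fun_prop : Continuous fun z : Torus n × Torus n => (z.1 + axis i h, z.2))
      have c2 : Continuous fun z : Torus n × Torus n => w z.1 z.2 := hw
      exact (c1.sub c2).pow 2
    have hi : Integrable (Function.uncurry fun y x => (w (y + axis i h) x - w y x) ^ 2)
        ((volume : Measure (Torus n)).prod volume) := cc.integrable_torus
    calc ∫ y, (m (y + axis i h) - m y) ^ 2 ≤ ∫ y, ∫ x, (w (y + axis i h) x - w y x) ^ 2 := by
          refine integral_mono ?_ hi.integral_prod_left fun y => ?_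
          · exact Continuous.integrable_torus (by fun_prop)
          · simp only [hm]
            rw [← integral_sub (cy _).integrable_torus (cy _).integrable_torus]
            exact sq_integral_le ((cy _).sub (cy _))
      _ = ∫ x, ∫ y, (w (y + axis i h) x - w y x) ^ 2 := integral_integral_swap hi
      _ ≤ ∫ x, h ^ 2 * D x := by
          refine integral_mono hi.integral_prod_right (hDi.const_mul _) fun x => ?_
          exact hD x i h hh
      _ = h ^ 2 * ∫ x, D x := integral_const_mul _ _
  have pm := sm.poincare cm hDI
  rw [m0] at pm
  have cc : Continuous (Function.uncurry fun y x => w x y ^ 2) :=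
    (hw.comp continuous_swap).pow 2
  have hi : Integrable (Function.uncurry fun y x => w x y ^ 2)
      ((volume : Measure (Torus n)).prod volume) := cc.integrable_torus
  calc ∫ y, ∫ x, w x y ^ 2 ≤ ∫ y, (m y ^ 2 + n ^ 2 * D y) := by
        refine integral_mono hi.integral_prod_left
          (Integrable.add (cm.pow 2).integrable_torus (hDi.const_mul _)) fun y => ?_
        exact ((hD y).poincare (cx y) (hD0 y)).trans_eq (by rw [mm])
    _ = (∫ y, m y ^ 2) + n ^ 2 * ∫ y, D y := by
        rw [integral_add (Continuous.integrable_torus (by fun_prop)) (hDi.const_mul _),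
          integral_const_mul]
    _ ≤ _ := by linarith

/-! ### Nonlinearities on the half line and their odd extensions. -/

/-- The nonlinearity whose primitive behaves like `t ^ p` for `t ≤ k` and like `t ^ m` for
large `t`, on the half line. -/
def slope (p m k t : ℝ) : ℝ := t ^ (m - 1) * min t k ^ (p - m)

/-- The square root of `t * slope t`. -/
def halfPower (p m k t : ℝ) : ℝ := t ^ (m / 2) * min t k ^ ((p - m) / 2)

/-- The odd extension of a function on the half line. -/
def oddExt (φ : ℝ → ℝ) (s : ℝ) : ℝ := φ (max s 0) - φ (max (-s) 0)

/-- The auxiliary functions used to test the equation: the nonlinearity `F`, with primitive `β`,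
is the difference of a monotone function `Fc`, which dominates the increments of `G`, and of a
function with slope at most `ε`. -/
structure IsProfile (p κ ε L : ℝ) (F Fc G β : ℝ → ℝ) : Prop where
  contF : Continuous F
  contFc : Continuous Fc
  contG : Continuous G
  deriv : ∀ s, HasDerivAt β (F s) s
  oddF : ∀ s, F (-s) = -F s
  oddG : ∀ s, G (-s) = -G s
  bound : ∀ s, |F s| ≤ L
  sv : ∀ a b, κ * (G a - G b) ^ 2 ≤ (Fc a - Fc b) * (a - b)
  tail : ∀ a b, ((Fc a - F a) - (Fc b - F b)) * (a - b) ≤ ε * (a - b) ^ 2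
  le_sq : ∀ s, β s ≤ 2 * G s ^ 2
  sq_le : ∀ s, G s ^ 2 ≤ 2 ^ p * β s
  rpow_le : ∀ s, |F s| ^ (p / (p - 1)) ≤ 2 ^ p * β s

section oddExt

variable {φ ψ : ℝ → ℝ}

lemma oddExt_of_nonneg (h0 : φ 0 = 0) {s : ℝ} (hs : 0 ≤ s) : oddExt φ s = φ s := by
  simp [oddExt, hs, h0]

lemma oddExt_neg (s : ℝ) : oddExt φ (-s) = -oddExt φ s := by simp [oddExt]

lemma oddExt_of_nonpos (h0 : φ 0 = 0) {s : ℝ} (hs : s ≤ 0) : oddExt φ s = -φ (-s) := by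
  rw [← neg_neg s, oddExt_neg, neg_neg, oddExt_of_nonneg h0 (by linarith)]

lemma abs_oddExt (h0 : φ 0 = 0) (hφ : ∀ t, 0 ≤ t → 0 ≤ φ t) (s : ℝ) : |oddExt φ s| = φ |s| := by
  rcases le_total 0 s with h | h
  · rw [oddExt_of_nonneg h0 h, abs_of_nonneg h, abs_of_nonneg (hφ s h)]
  · rw [oddExt_of_nonpos h0 h, abs_of_nonpos h, abs_neg, abs_of_nonneg (hφ _ (by linarith))]

lemma continuous_oddExt (h : ContinuousOn φ (Ici 0)) : Continuous (oddExt φ) := by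
  unfold oddExt
  refine Continuous.sub ?_ ?_
  · exact h.comp_continuous (by fun_prop) fun s => mem_Ici.2 (le_max_right _ _)
  · exact h.comp_continuous (by fun_prop) fun s => mem_Ici.2 (le_max_right _ _)

/-- Cauchy–Schwarz: the Stroock–Varopoulos inequality on two adjacent intervals implies it on their
union. It serves to glue at 0 and at the level k. -/
lemma mul_sq_add_le {κ x₁ x₂ p₁ p₂ r₁ r₂ : ℝ} (hκ : 0 ≤ κ) (hp₁ : 0 ≤ p₁) (hp₂ : 0 ≤ p₂)
    (hr₁ : 0 ≤ r₁) (hr₂ : 0 ≤ r₂) (h₁ : κ * x₁ ^ 2 ≤ p₁ * r₁) (h₂ : κ * x₂ ^ 2 ≤ p₂ * r₂) :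
    κ * (x₁ + x₂) ^ 2 ≤ (p₁ + p₂) * (r₁ + r₂) := by
  have h3 : 2 * (κ * (x₁ * x₂)) ≤ p₁ * r₂ + p₂ * r₁ := by
    refine le_of_sq_le_sq ?_ (by positivity)
    have : (κ * x₁ ^ 2) * (κ * x₂ ^ 2) ≤ (p₁ * r₁) * (p₂ * r₂) :=
      mul_le_mul h₁ h₂ (by positivity) (by positivity)
    nlinarith [sq_nonneg (p₁ * r₂ - p₂ * r₁)]
  nlinarith

/-- Pairs of equal sign reduce to the half line by reflection; pairs of opposite signs are cut at 0
and glued with `mul_sq_add_le`. -/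
lemma oddExt_sv {κ : ℝ} (hκ : 0 ≤ κ) (hφ0 : φ 0 = 0) (hψ0 : ψ 0 = 0)
    (hφ : ∀ t, 0 ≤ t → 0 ≤ φ t)
    (h : ∀ a b, 0 ≤ b → b ≤ a → κ * (ψ a - ψ b) ^ 2 ≤ (φ a - φ b) * (a - b)) (a b : ℝ) :
    κ * (oddExt ψ a - oddExt ψ b) ^ 2 ≤ (oddExt φ a - oddExt φ b) * (a - b) := by
  wlog hab : b ≤ a generalizing a b
  · have := this b a (by linarith)
    nlinarith
  rcases le_total 0 b with hb | hb
  · simpa only [oddExt_of_nonneg hφ0 hb, oddExt_of_nonneg hψ0 hb, oddExt_of_nonneg hφ0 (hb.trans hab),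
      oddExt_of_nonneg hψ0 (hb.trans hab)] using h a b hb hab
  · rcases le_total 0 a with ha | ha
    · rw [oddExt_of_nonneg hφ0 ha, oddExt_of_nonneg hψ0 ha, oddExt_of_nonpos hφ0 hb,
        oddExt_of_nonpos hψ0 hb, sub_neg_eq_add, sub_neg_eq_add, sub_eq_add_neg]
      have h1 := h a 0 le_rfl ha
      have h2 := h (-b) 0 le_rfl (by linarith)
      simp only [hφ0, hψ0, sub_zero] at h1 h2
      exact mul_sq_add_le hκ (hφ a ha) (hφ _ (by linarith)) ha (by linarith) h1 h2
    · rw [oddExt_of_nonpos hφ0 ha, oddExt_of_nonpos hψ0 ha, oddExt_of_nonpos hφ0 hb,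
        oddExt_of_nonpos hψ0 hb]
      have := h (-b) (-a) (by linarith) (by linarith)
      nlinarith

lemma oddExt_lipschitz {ε : ℝ} (hφ0 : φ 0 = 0)
    (h : ∀ a b, 0 ≤ b → b ≤ a → φ a - φ b ≤ ε * (a - b)) (a b : ℝ) :
    (oddExt φ a - oddExt φ b) * (a - b) ≤ ε * (a - b) ^ 2 := by
  wlog hab : b ≤ a generalizing a b
  · have := this b a (by linarith)
    nlinarith
  have key : oddExt φ a - oddExt φ b ≤ ε * (a - b) := by
    rcases le_total 0 b with hb | hb
    · rw [oddExt_of_nonneg hφ0 hb, oddExt_of_nonneg hφ0 (hb.trans hab)]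
      exact h a b hb hab
    · rcases le_total 0 a with ha | ha
      · rw [oddExt_of_nonneg hφ0 ha, oddExt_of_nonpos hφ0 hb]
        have h1 := h a 0 le_rfl ha
        have h2 := h (-b) 0 le_rfl (by linarith)
        simp only [hφ0, sub_zero] at h1 h2
        linarith
      · rw [oddExt_of_nonpos hφ0 ha, oddExt_of_nonpos hφ0 hb]
        have := h (-b) (-a) (by linarith) (by linarith)
        linarith
  nlinarith

end oddExt

/-- The inequality of Stroock and Varopoulos for a pure power. -/
lemma power_sv {σ κ : ℝ} (hσ : 1 < σ) (hκ : κ ≤ 2 / σ) (hκ' : κ ≤ 2 - 2 / σ) (hκ0 : 0 < κ) {a b : ℝ}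
    (hb : 0 ≤ b) (hab : b ≤ a) :
    κ * (a ^ (σ / 2) - b ^ (σ / 2)) ^ 2 ≤ (a ^ (σ - 1) - b ^ (σ - 1)) * (a - b) := by
  have hσ0 : 0 < σ := by linarith
  rcases (hb.trans hab).eq_or_lt with rfl | ha
  · have : b = 0 := le_antisymm hab hb
    simp [this]
  -- To be used with e the smaller of 2/σ and 2 - 2/σ, whose sum is 2. Bernoulli's inequality gives
  -- 1 - u^e ≥ e(1 - u), and 2 - e ≥ 1 gives 1 - u^(2-e) ≥ 1 - u.
  have main : ∀ e : ℝ, κ ≤ e → e ≤ 1 → ∀ u : ℝ, 0 ≤ u → u ≤ 1 →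
      κ * (1 - u) ^ 2 ≤ (1 - u ^ e) * (1 - u ^ (2 - e)) := by
    intro e he he1 u hu hu1
    have he0 : 0 < e := by linarith
    have b1 : e * (1 - u) ≤ 1 - u ^ e := by
      have := rpow_one_add_le_one_add_mul_self (s := u - 1) (p := e) (by linarith) he0.le he1
      rw [add_sub_cancel] at this
      linarith
    have b2 : 1 - u ≤ 1 - u ^ (2 - e) := by
      have : u ^ (2 - e) ≤ u ^ (1 : ℝ) := by
        rcases hu.eq_or_lt with rfl | hu
        · rw [Real.zero_rpow (by linarith), Real.zero_rpow one_ne_zero]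
        · exact Real.rpow_le_rpow_of_exponent_ge hu hu1 (by linarith)
      rw [Real.rpow_one] at this
      linarith
    have h1u : 0 ≤ 1 - u := by linarith
    calc κ * (1 - u) ^ 2 ≤ (e * (1 - u)) * (1 - u) := by nlinarith
      _ ≤ (1 - u ^ e) * (1 - u ^ (2 - e)) := mul_le_mul b1 b2 h1u (le_trans (by positivity) b1)
  -- Both sides are homogeneous of degree σ, so only the ratio matters; u = t^(σ/2) makes the left
  -- side a square.
  set t := b / a with ht
  have ht0 : 0 ≤ t := by positivity
  have ht1 : t ≤ 1 := by rw [ht, div_le_one ha]; exact hab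
  have hbt : b = a * t := by rw [ht]; field_simp
  set u := t ^ (σ / 2) with hu
  have hu0 : 0 ≤ u := by positivity
  have hu1 : u ≤ 1 := Real.rpow_le_one ht0 ht1 (by positivity)
  have e1 : t = u ^ (2 / σ) := by
    rw [hu, ← Real.rpow_mul ht0, show σ / 2 * (2 / σ) = 1 by field_simp, Real.rpow_one]
  have e2 : t ^ (σ - 1) = u ^ (2 - 2 / σ) := by
    rw [hu, ← Real.rpow_mul ht0]; congr 1; field_simp
  have e3 : b ^ (σ / 2) = a ^ (σ / 2) * u := by rw [hbt, Real.mul_rpow ha.le ht0]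
  have e4 : b ^ (σ - 1) = a ^ (σ - 1) * u ^ (2 - 2 / σ) := by
    rw [hbt, Real.mul_rpow ha.le ht0, e2]
  have e5 : a ^ (σ / 2) ^ 1 * a ^ (σ / 2) = a ^ (σ - 1) * a := by
    rw [pow_one, ← Real.rpow_add ha, ← Real.rpow_add_one ha.ne']; congr 1; ring
  rw [pow_one] at e5
  have key : κ * (1 - u) ^ 2 ≤ (1 - u ^ (2 - 2 / σ)) * (1 - u ^ (2 / σ)) := by
    rcases le_total (2 / σ) 1 with h | h
    · rw [mul_comm (1 - u ^ (2 - 2 / σ))]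
      exact main (2 / σ) hκ h u hu0 hu1
    · have := main (2 - 2 / σ) hκ' (by linarith) u hu0 hu1
      rwa [show 2 - (2 - 2 / σ) = 2 / σ by ring] at this
  rw [e3, e4, hbt]
  rw [← e1] at key
  have hA : 0 ≤ a ^ (σ - 1) * a := by positivity
  calc _ = (a ^ (σ / 2) * a ^ (σ / 2)) * (κ * (1 - u) ^ 2) := by ring
    _ = (a ^ (σ - 1) * a) * (κ * (1 - u) ^ 2) := by rw [e5]
    _ ≤ (a ^ (σ - 1) * a) * ((1 - u ^ (2 - 2 / σ)) * (1 - t)) := by gcongr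
    _ = _ := by ring

section slope

variable {p m k : ℝ}

lemma slope_zero (hm : 1 < m) : slope p m k 0 = 0 := by
  rw [slope, Real.zero_rpow (by linarith), zero_mul]

lemma halfPower_zero (hm : 1 < m) : halfPower p m k 0 = 0 := by
  rw [halfPower, Real.zero_rpow (by linarith), zero_mul]

lemma slope_nonneg (hk : 0 < k) {t : ℝ} (ht : 0 ≤ t) : 0 ≤ slope p m k t :=
  mul_nonneg (Real.rpow_nonneg ht _) (Real.rpow_nonneg (le_min ht hk.le) _)

lemma halfPower_nonneg (hk : 0 < k) {t : ℝ} (ht : 0 ≤ t) : 0 ≤ halfPower p m k t :=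
  mul_nonneg (Real.rpow_nonneg ht _) (Real.rpow_nonneg (le_min ht hk.le) _)

lemma slope_mono (hm : 1 < m) (hmp : m ≤ p) (hk : 0 < k) {s t : ℝ} (hs : 0 ≤ s) (hst : s ≤ t) :
    slope p m k s ≤ slope p m k t := by
  have := le_min hs hk.le
  exact mul_le_mul (Real.rpow_le_rpow hs hst (by linarith))
    (Real.rpow_le_rpow this (min_le_min_right k hst) (by linarith)) (by positivity)
    (Real.rpow_nonneg (hs.trans hst) _)

lemma halfPower_sq (hm : 1 < m) (hk : 0 < k) {t : ℝ} (ht : 0 ≤ t) :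
    halfPower p m k t ^ 2 = t * slope p m k t := by
  have := le_min ht hk.le
  have e1 : (t ^ (m / 2)) ^ 2 = t * t ^ (m - 1) := by
    rw [← Real.rpow_mul_natCast ht]
    rcases ht.eq_or_lt with rfl | ht
    · rw [Real.zero_rpow (by push_cast; linarith), zero_mul]
    · nth_rw 2 [← Real.rpow_one t]
      rw [← Real.rpow_add ht]; congr 1; push_cast; ring
  have e2 : (min t k ^ ((p - m) / 2)) ^ 2 = min t k ^ (p - m) := by
    rw [← Real.rpow_mul_natCast this]; congr 1; push_cast; ring
  rw [halfPower, mul_pow, e1, e2, slope]; ring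

lemma slope_of_le (hm : 1 < m) (hp : 1 < p) {t : ℝ} (ht : 0 ≤ t) (htk : t ≤ k) :
    slope p m k t = t ^ (p - 1) := by
  rw [slope, min_eq_left htk]
  rcases ht.eq_or_lt with rfl | ht
  · rw [Real.zero_rpow (by linarith), zero_mul, Real.zero_rpow (by linarith)]
  · rw [← Real.rpow_add ht]; congr 1; ring

lemma halfPower_of_le (hm : 1 < m) (hp : 1 < p) {t : ℝ} (ht : 0 ≤ t) (htk : t ≤ k) :
    halfPower p m k t = t ^ (p / 2) := by
  rw [halfPower, min_eq_left htk]
  rcases ht.eq_or_lt with rfl | ht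
  · rw [Real.zero_rpow (by linarith), zero_mul, Real.zero_rpow (by linarith)]
  · rw [← Real.rpow_add ht]; congr 1; ring

lemma slope_le_rpow (hmp : m ≤ p) (hm : 1 < m) (hk : 0 < k) {t : ℝ} (ht : 0 ≤ t) :
    slope p m k t ≤ t ^ (p - 1) := by
  rw [← slope_of_le (k := t) hm (hm.trans_le hmp) ht le_rfl, slope, slope, min_self]
  exact mul_le_mul_of_nonneg_left
    (Real.rpow_le_rpow (le_min ht hk.le) (min_le_left _ _) (by linarith)) (Real.rpow_nonneg ht _)

/-- The function is homogeneous of degree p - 1 in t and k jointly, and nondecreasing in k; hence a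
doubling constant independent of k. -/
lemma slope_half (hmp : m ≤ p) (hk : 0 < k) {t : ℝ} (ht : 0 ≤ t) :
    2 ^ (1 - p) * slope p m k t ≤ slope p m k (t / 2) := by
  have h0 := le_min ht hk.le
  have h1 : min t k / 2 ≤ min (t / 2) k := le_min (by linarith [min_le_left t k])
    (by linarith [min_le_right t k])
  have e : (2 : ℝ) ^ (1 - p) * slope p m k t = (t / 2) ^ (m - 1) * (min t k / 2) ^ (p - m) := by
    rw [Real.div_rpow ht (by norm_num), Real.div_rpow h0 (by norm_num), slope,
      show 1 - p = -(m - 1) + -(p - m) by ring, Real.rpow_add (by norm_num),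
      Real.rpow_neg (by norm_num), Real.rpow_neg (by norm_num)]
    field_simp
  rw [e, slope]
  gcongr

/-- One factor is kept and the remaining power 1/(p-1) is bounded by t, since the nonlinearity lies
below t^(p-1). The dual exponent is the one required by Hölder's inequality for the source. -/
lemma slope_rpow_le (hmp : m ≤ p) (hm : 1 < m) (hk : 0 < k) {t : ℝ} (ht : 0 ≤ t) :
    slope p m k t ^ (p / (p - 1)) ≤ t * slope p m k t := by
  have hp : 0 < p - 1 := by linarith
  have h0 := slope_nonneg (p := p) (m := m) hk ht
  rcases h0.eq_or_lt with h | h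
  · rw [← h, Real.zero_rpow (div_pos (by linarith) hp).ne']; simp
  · have hp0 : p - 1 ≠ 0 := hp.ne'
    have e : p / (p - 1) = 1 / (p - 1) + 1 := by field_simp; ring
    rw [e, Real.rpow_add_one h.ne']
    gcongr
    calc slope p m k t ^ (1 / (p - 1)) ≤ (t ^ (p - 1)) ^ (1 / (p - 1)) :=
          Real.rpow_le_rpow h0 (slope_le_rpow hmp hm hk ht) (by positivity)
      _ = t := by rw [← Real.rpow_mul ht, mul_one_div_cancel hp.ne', Real.rpow_one]

/-- Below k the functions are powers with exponent p, above k constant multiples of powers with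
exponent m; an interval containing k is cut there and glued with `mul_sq_add_le`. -/
lemma slope_sv {κ : ℝ} (hmp : m ≤ p) (hm : 1 < m) (hk : 0 < k) (hκ0 : 0 < κ) (h1 : κ ≤ 2 / p)
    (h2 : κ ≤ 2 - 2 / p) (h3 : κ ≤ 2 / m) (h4 : κ ≤ 2 - 2 / m) {a b : ℝ} (hb : 0 ≤ b) (hab : b ≤ a) :
    κ * (halfPower p m k a - halfPower p m k b) ^ 2 ≤
      (slope p m k a - slope p m k b) * (a - b) := by
  have hp : 1 < p := hm.trans_le hmp
  have low : ∀ a b, 0 ≤ b → b ≤ a → a ≤ k → κ * (halfPower p m k a - halfPower p m k b) ^ 2 ≤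
      (slope p m k a - slope p m k b) * (a - b) := by
    intro a b hb hab hak
    rw [halfPower_of_le hm hp hb (hab.trans hak), halfPower_of_le hm hp (hb.trans hab) hak,
      slope_of_le hm hp hb (hab.trans hak), slope_of_le hm hp (hb.trans hab) hak]
    exact power_sv hp h1 h2 hκ0 hb hab
  have high : ∀ a b, k ≤ b → b ≤ a → κ * (halfPower p m k a - halfPower p m k b) ^ 2 ≤
      (slope p m k a - slope p m k b) * (a - b) := by
    intro a b hkb hab
    have hb : 0 ≤ b := hk.le.trans hkb
    simp only [slope, halfPower, min_eq_right hkb, min_eq_right (hkb.trans hab)]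
    have := power_sv hm h3 h4 hκ0 hb hab
    have e : k ^ ((p - m) / 2) * k ^ ((p - m) / 2) = k ^ (p - m) := by
      rw [← Real.rpow_add hk]; congr 1; ring
    calc _ = (k ^ ((p - m) / 2) * k ^ ((p - m) / 2)) * (κ * (a ^ (m / 2) - b ^ (m / 2)) ^ 2) := by ring
      _ ≤ k ^ (p - m) * ((a ^ (m - 1) - b ^ (m - 1)) * (a - b)) := by rw [e]; gcongr
      _ = _ := by ring
  rcases le_total a k with h | h
  · exact low a b hb hab h
  rcases le_total k b with h' | h'
  · exact high a b h' hab
  have := mul_sq_add_le hκ0.le (sub_nonneg.2 (slope_mono (p := p) (m := m) hm hmp hk hk.le h))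
    (sub_nonneg.2 (slope_mono (p := p) (m := m) hm hmp hk hb h')) (sub_nonneg.2 h) (sub_nonneg.2 h')
    (high a k le_rfl h) (low k b hb h' le_rfl)
  simpa only [sub_add_sub_cancel] using this

lemma continuousOn_slope (hmp : m ≤ p) (hm : 1 < m) : Continuous (slope p m k) := by
  unfold slope
  refine Continuous.mul ?_ ?_
  · exact Real.continuous_rpow_const (by linarith)
  · exact (Real.continuous_rpow_const (by linarith)).comp (continuous_id.min continuous_const)

lemma continuousOn_halfPower (hmp : m ≤ p) (hm : 1 < m) : Continuous (halfPower p m k) := by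
  unfold halfPower
  refine Continuous.mul ?_ ?_
  · exact Real.continuous_rpow_const (by linarith)
  · exact (Real.continuous_rpow_const (by linarith)).comp (continuous_id.min continuous_const)

end slope

/-! ### The truncated nonlinearity and its primitive. -/

section profile

variable {p m k l : ℝ}

/-- The part which is subtracted from the nonlinearity in order to make its support compact. -/
def cutoffTail (p m k l t : ℝ) : ℝ := slope p m k l / l * (min t (2 * l) - min t l)

/-- The nonlinearity with compact support, on the half line. -/
def cutSlope (p m k l t : ℝ) : ℝ := slope p m k (min t l) - cutoffTail p m k l t

/-- The compactly supported test nonlinearity. -/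
def profF (p m k l : ℝ) : ℝ → ℝ := oddExt (cutSlope p m k l)

/-- The monotone part of the nonlinearity. -/
def profFc (p m k l : ℝ) : ℝ → ℝ := oddExt fun t => slope p m k (min t l)

/-- The function whose increments are controlled by the dissipation. -/
def profG (p m k l : ℝ) : ℝ → ℝ := oddExt fun t => halfPower p m k (min t l)

/-- The primitive of the nonlinearity. -/
def profB (p m k l s : ℝ) : ℝ := ∫ t in (0 : ℝ)..s, profF p m k l t

/-- The function `|s| ^ m * min |s| k ^ (p - m)`. -/
def growth (p m k s : ℝ) : ℝ := |s| * slope p m k |s|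

lemma cutoffTail_zero (hl : 0 < l) : cutoffTail p m k l 0 = 0 := by
  simp [cutoffTail, hl.le]

lemma cutSlope_zero (hm : 1 < m) (hl : 0 < l) : cutSlope p m k l 0 = 0 := by
  rw [cutSlope, cutoffTail_zero hl, min_eq_left hl.le, slope_zero hm, sub_zero]

lemma cutSlope_of_le (hl : 0 < l) {t : ℝ} (htl : t ≤ l) : cutSlope p m k l t = slope p m k t := by
  rw [cutSlope, cutoffTail, min_eq_left htl, min_eq_left (by linarith : t ≤ 2 * l)]; simp

/-- The subtracted ramp rises between l and 2l by exactly the saturated value of the nonlinearity.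
-/
lemma cutSlope_of_ge (hl : 0 < l) {t : ℝ} (htl : 2 * l ≤ t) : cutSlope p m k l t = 0 := by
  rw [cutSlope, cutoffTail, min_eq_right (by linarith : l ≤ t), min_eq_right htl]
  field_simp; ring

lemma cutoffTail_nonneg (hk : 0 < k) (hl : 0 < l) (t : ℝ) : 0 ≤ cutoffTail p m k l t := by
  have := slope_nonneg (p := p) (m := m) hk hl.le
  exact mul_nonneg (by positivity) (sub_nonneg.2 (min_le_min_left _ (by linarith)))

lemma cutSlope_le (hk : 0 < k) (hl : 0 < l) (t : ℝ) :
    cutSlope p m k l t ≤ slope p m k (min t l) := by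
  rw [cutSlope]; linarith [cutoffTail_nonneg (p := p) (m := m) hk hl t]

lemma cutSlope_nonneg (hk : 0 < k) (hl : 0 < l) {t : ℝ} (ht : 0 ≤ t) : 0 ≤ cutSlope p m k l t := by
  rcases le_total t l with h | h
  · rw [cutSlope_of_le hl h]; exact slope_nonneg hk ht
  · have hs := slope_nonneg (p := p) (m := m) hk hl.le
    rw [cutSlope, cutoffTail, min_eq_right h]
    have h1 : min t (2 * l) - l ≤ l := by linarith [min_le_right t (2 * l)]
    have h2 : slope p m k l / l * (min t (2 * l) - l) ≤ slope p m k l / l * l := by gcongr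
    rw [div_mul_cancel₀ _ hl.ne'] at h2
    linarith

lemma continuous_cutoffTail : Continuous (cutoffTail p m k l) := by
  unfold cutoffTail; fun_prop

lemma continuous_cutSlope (hmp : m ≤ p) (hm : 1 < m) : Continuous (cutSlope p m k l) :=
  ((continuousOn_slope hmp hm).comp (continuous_id.min continuous_const)).sub continuous_cutoffTail

lemma continuous_profF (hmp : m ≤ p) (hm : 1 < m) : Continuous (profF p m k l) :=
  continuous_oddExt (continuous_cutSlope hmp hm).continuousOn

lemma hasDerivAt_profB (hmp : m ≤ p) (hm : 1 < m) (s : ℝ) :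
    HasDerivAt (profB p m k l) (profF p m k l s) s :=
  intervalIntegral.integral_hasDerivAt_right
    ((continuous_profF hmp hm).intervalIntegrable _ _)
    ((continuous_profF hmp hm).stronglyMeasurableAtFilter _ _) (continuous_profF hmp hm).continuousAt

lemma profB_neg (s : ℝ) : profB p m k l (-s) = profB p m k l s := by
  unfold profB
  have h := intervalIntegral.integral_comp_neg (a := 0) (b := s) (profF p m k l)
  simp only [neg_zero] at h
  rw [intervalIntegral.integral_symm, ← h, ← intervalIntegral.integral_neg]
  refine intervalIntegral.integral_congr fun t _ => ?_
  simp only [profF, oddExt_neg, neg_neg]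

lemma profB_eq (hm : 1 < m) (hl : 0 < l) {s : ℝ} (hs : 0 ≤ s) :
    profB p m k l s = ∫ t in (0 : ℝ)..s, cutSlope p m k l t := by
  refine intervalIntegral.integral_congr fun t ht => ?_
  rw [uIcc_of_le hs] at ht
  exact oddExt_of_nonneg (cutSlope_zero hm hl) ht.1

lemma profB_abs (s : ℝ) : profB p m k l |s| = profB p m k l s := by
  rcases abs_choice s with h | h <;> rw [h]
  exact profB_neg s

lemma intervalIntegral_le_const {φ : ℝ → ℝ} (hφ : Continuous φ) {a b M : ℝ} (hab : a ≤ b)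
    (h : ∀ t, a ≤ t → t ≤ b → φ t ≤ M) : ∫ t in a..b, φ t ≤ (b - a) * M := by
  have := intervalIntegral.integral_mono_on hab (hφ.intervalIntegrable a b)
    (continuous_const.intervalIntegrable a b : IntervalIntegrable (fun _ => M) volume a b) fun t ht => h t ht.1 ht.2
  simpa using this

lemma growth_nonneg (hk : 0 < k) (s : ℝ) : 0 ≤ growth p m k s :=
  mul_nonneg (abs_nonneg _) (slope_nonneg hk (abs_nonneg _))

lemma growth_mono (hmp : m ≤ p) (hm : 1 < m) (hk : 0 < k) {s t : ℝ} (h : |s| ≤ |t|) :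
    growth p m k s ≤ growth p m k t :=
  mul_le_mul h (slope_mono hm hmp hk (abs_nonneg _) h) (slope_nonneg hk (abs_nonneg _)) (abs_nonneg _)

lemma profG_sq (hm : 1 < m) (hk : 0 < k) (hl : 0 < l) (s : ℝ) :
    profG p m k l s ^ 2 = growth p m k (min |s| l) := by
  have h0 : (fun t => halfPower p m k (min t l)) 0 = 0 := by
    simp only [min_eq_left hl.le, halfPower_zero hm]
  have h1 := abs_oddExt h0 (fun t ht => halfPower_nonneg hk (le_min ht hl.le)) s
  have h2 := le_min (abs_nonneg s) hl.le
  rw [← sq_abs, profG, h1, growth, abs_of_nonneg h2, halfPower_sq hm hk h2]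

lemma profB_le_growth (hmp : m ≤ p) (hm : 1 < m) (hk : 0 < k) (hl : 0 < l) (s : ℝ) :
    profB p m k l s ≤ growth p m k s := by
  rw [← profB_abs, profB_eq hm hl (abs_nonneg s), growth]
  have := intervalIntegral_le_const (continuous_cutSlope (p := p) (m := m) (k := k) (l := l) hmp hm)
    (abs_nonneg s) (M := slope p m k |s|) fun t h0 h1 => (cutSlope_le hk hl t).trans
      (slope_mono hm hmp hk (le_min h0 hl.le) ((min_le_left _ _).trans h1))
  rwa [sub_zero] at this

/-- G is constant beyond l, so its square can dominate the primitive only if the latter stops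
growing: this is the purpose of the descent to zero. The intervals [0, l] and [l, 2l] contribute at
most l times the saturated value each, whence the factor 2. -/
lemma profB_le (hmp : m ≤ p) (hm : 1 < m) (hk : 0 < k) (hl : 0 < l) (s : ℝ) :
    profB p m k l s ≤ 2 * profG p m k l s ^ 2 := by
  rw [profG_sq hm hk hl]
  have hc := continuous_cutSlope (p := p) (m := m) (k := k) (l := l) hmp hm
  rcases le_total |s| l with h | h
  · rw [min_eq_left h, ← profB_abs]
    have h1 := profB_le_growth (p := p) hmp hm hk hl |s|
    linarith [growth_nonneg (p := p) (m := m) hk |s|]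
  · rw [min_eq_right h, ← profB_abs, profB_eq hm hl (abs_nonneg s),
      ← intervalIntegral.integral_add_adjacent_intervals (hc.intervalIntegrable 0 l)
        (hc.intervalIntegrable l |s|), growth, abs_of_pos hl]
    have a1 := intervalIntegral_le_const hc hl.le (M := slope p m k l) fun t h0 h1 =>
      (cutSlope_le hk hl t).trans (slope_mono hm hmp hk (le_min h0 hl.le) (min_le_right _ _))
    have hb : ∀ t, l ≤ t → cutSlope p m k l t ≤ slope p m k l := fun t ht =>
      (cutSlope_le hk hl t).trans_eq (by rw [min_eq_right ht])
    have hs0 := slope_nonneg (p := p) (m := m) hk hl.le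
    have a2 : ∫ t in l..|s|, cutSlope p m k l t ≤ l * slope p m k l := by
      rcases le_total |s| (2 * l) with h' | h'
      · refine (intervalIntegral_le_const hc h fun t h0 h1 => hb t h0).trans ?_
        gcongr; linarith
      · rw [← intervalIntegral.integral_add_adjacent_intervals (hc.intervalIntegrable l (2 * l))
          (hc.intervalIntegrable (2 * l) |s|)]
        have b1 := intervalIntegral_le_const hc (by linarith : l ≤ 2 * l) fun t h0 h1 => hb t h0
        have b2 := intervalIntegral_le_const hc h' (M := 0) fun t h0 h1 =>
          (cutSlope_of_ge hl h0).le
        linarith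
    linarith

/-- With u = min |s| l, the interval [u/2, u] alone suffices: there the nonlinearity is monotone
and, by `slope_half`, comparable to its value at u. -/
lemma le_profB (hmp : m ≤ p) (hm : 1 < m) (hk : 0 < k) (hl : 0 < l) (s : ℝ) :
    profG p m k l s ^ 2 ≤ 2 ^ p * profB p m k l s := by
  rw [profG_sq hm hk hl, ← profB_abs, profB_eq hm hl (abs_nonneg s)]
  set u := min |s| l with hu
  have hu0 : 0 ≤ u := le_min (abs_nonneg _) hl.le
  have hc := continuous_cutSlope (p := p) (m := m) (k := k) (l := l) hmp hm
  have h1 : (u / 2) * slope p m k (u / 2) ≤ ∫ t in (u / 2)..u, cutSlope p m k l t := by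
    have := intervalIntegral_le_const hc.neg (by linarith : u / 2 ≤ u) (M := -slope p m k (u / 2))
      fun t h0 h1 => by
        rw [Pi.neg_apply, cutSlope_of_le hl (h1.trans (min_le_right _ _))]
        exact neg_le_neg (slope_mono hm hmp hk (by linarith) h0)
    simp only [Pi.neg_apply, intervalIntegral.integral_neg] at this
    linarith
  have h2 : ∫ t in (u / 2)..u, cutSlope p m k l t ≤ ∫ t in (0 : ℝ)..|s|, cutSlope p m k l t := by
    refine intervalIntegral.integral_mono_interval (by positivity) (by linarith) (min_le_left _ _) ?_
      (hc.intervalIntegrable _ _)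
    filter_upwards [ae_restrict_mem measurableSet_Ioc] with t ht using cutSlope_nonneg hk hl ht.1.le
  have h3 := slope_half (k := k) hmp hk hu0
  have e : (2 : ℝ) ^ (1 - p) = 2 / 2 ^ p := by
    rw [Real.rpow_sub (by norm_num), Real.rpow_one]
  have h2p : (0 : ℝ) < 2 ^ p := by positivity
  rw [growth, abs_of_nonneg hu0]
  calc u * slope p m k u = 2 ^ p * ((u / 2) * (2 ^ (1 - p) * slope p m k u)) := by
        rw [e]; field_simp
    _ ≤ 2 ^ p * ((u / 2) * slope p m k (u / 2)) := by gcongr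
    _ ≤ _ := by gcongr; exact h1.trans h2

/-- The parameter ε is the slope of the descending ramp and L the saturated value. The constant κ
must serve the powers p and m, each with its two conditions. -/
lemma isProfile {κ : ℝ} (hmp : m ≤ p) (hm : 1 < m) (hk : 0 < k) (hl : 0 < l) (hκ0 : 0 < κ)
    (h1 : κ ≤ 2 / p) (h2 : κ ≤ 2 - 2 / p) (h3 : κ ≤ 2 / m) (h4 : κ ≤ 2 - 2 / m) :
    IsProfile p κ (slope p m k l / l) (slope p m k l) (profF p m k l) (profFc p m k l)
      (profG p m k l) (profB p m k l) := by
  have hs0 := slope_nonneg (p := p) (m := m) hk hl.le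
  have z0 := cutSlope_zero (p := p) (k := k) hm hl
  have z1 : (fun t => slope p m k (min t l)) 0 = 0 := by simp only [min_eq_left hl.le, slope_zero hm]
  have z2 : (fun t => halfPower p m k (min t l)) 0 = 0 := by
    simp only [min_eq_left hl.le, halfPower_zero hm]
  have habs : ∀ s, |profF p m k l s| = cutSlope p m k l |s| :=
    abs_oddExt z0 fun t ht => cutSlope_nonneg hk hl ht
  refine ⟨continuous_profF hmp hm, ?_, ?_, hasDerivAt_profB hmp hm, oddExt_neg, oddExt_neg,
    ?_, ?_, ?_, profB_le hmp hm hk hl, le_profB hmp hm hk hl, ?_⟩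
  · exact continuous_oddExt ((continuousOn_slope hmp hm).comp
      (continuous_id.min continuous_const)).continuousOn
  · exact continuous_oddExt ((continuousOn_halfPower hmp hm).comp
      (continuous_id.min continuous_const)).continuousOn
  · intro s
    rw [habs]
    exact (cutSlope_le hk hl _).trans
      (slope_mono hm hmp hk (le_min (abs_nonneg _) hl.le) (min_le_right _ _))
  · refine oddExt_sv hκ0.le z1 z2 (fun t ht => slope_nonneg hk (le_min ht hl.le)) ?_
    intro a b hb hab
    have hmin : min b l ≤ min a l := min_le_min_right _ hab
    refine (slope_sv hmp hm hk hκ0 h1 h2 h3 h4 (le_min hb hl.le) hmin).trans ?_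
    refine mul_le_mul_of_nonneg_left ?_ (sub_nonneg.2 (slope_mono hm hmp hk (le_min hb hl.le) hmin))
    rcases le_total b l with h | h
    · rw [min_eq_left h]; linarith [min_le_left a l]
    · rw [min_eq_right h, min_eq_right (h.trans hab)]; linarith
  · intro a b
    have e : ∀ s, profFc p m k l s - profF p m k l s = oddExt (cutoffTail p m k l) s := by
      intro s; simp only [profFc, profF, oddExt, cutSlope]; ring
    rw [e, e]
    refine oddExt_lipschitz (cutoffTail_zero hl) (fun a b hb hab => ?_) a b
    rw [cutoffTail, cutoffTail, ← mul_sub]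
    refine mul_le_mul_of_nonneg_left ?_ (by positivity)
    rcases le_total a l with h | h
    · rw [min_eq_left h, min_eq_left (hab.trans h), min_eq_left (by linarith : a ≤ 2 * l),
        min_eq_left (by linarith : b ≤ 2 * l)]; linarith
    · rw [min_eq_right h]
      rcases le_total b l with h' | h'
      · rw [min_eq_left h', min_eq_left (by linarith : b ≤ 2 * l)]
        linarith [min_le_left a (2 * l)]
      · rw [min_eq_right h']
        rcases le_total b (2 * l) with h'' | h''
        · rw [min_eq_left h'']; linarith [min_le_left a (2 * l)]
        · rw [min_eq_right h'', min_eq_right (h''.trans hab)]; linarith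
  · intro s
    refine le_trans ?_ (le_profB hmp hm hk hl s)
    have hu0 : 0 ≤ min |s| l := le_min (abs_nonneg _) hl.le
    rw [habs, profG_sq hm hk hl, growth, abs_of_nonneg hu0]
    refine le_trans ?_ (slope_rpow_le hmp hm hk hu0)
    have hp : 0 < p - 1 := by linarith
    exact Real.rpow_le_rpow (cutSlope_nonneg hk hl (abs_nonneg s)) (cutSlope_le hk hl _)
      (div_nonneg (by linarith) hp.le)

lemma growth_le_rpow (hmp : m ≤ p) (hm : 1 < m) (hk : 0 < k) (s : ℝ) :
    growth p m k s ≤ |s| ^ p := by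
  rw [growth]
  refine (mul_le_mul_of_nonneg_left (slope_le_rpow hmp hm hk (abs_nonneg s)) (abs_nonneg s)).trans_eq ?_
  rcases (abs_nonneg s).eq_or_lt with h | h
  · rw [← h, zero_mul, Real.zero_rpow (by linarith)]
  · nth_rw 1 [← Real.rpow_one |s|]
    rw [← Real.rpow_add h]; congr 1; ring

lemma growth_of_le (hmp : m ≤ p) (hm : 1 < m) {s : ℝ} (hs : |s| ≤ k) :
    growth p m k s = |s| ^ p := by
  rw [growth, slope_of_le hm (hm.trans_le hmp) (abs_nonneg s) hs]
  rcases (abs_nonneg s).eq_or_lt with h | h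
  · rw [← h, zero_mul, Real.zero_rpow (by linarith)]
  · nth_rw 1 [← Real.rpow_one |s|]
    rw [← Real.rpow_add h]; congr 1; ring

/-- At the price of a power of k, only integrability of exponent m is needed, which the solution has
at every time. -/
lemma growth_le_mul_rpow (hmp : m ≤ p) (hm : 1 < m) (hk : 0 < k) (s : ℝ) :
    growth p m k s ≤ k ^ (p - m) * |s| ^ m := by
  have h0 := abs_nonneg s
  have e : |s| * |s| ^ (m - 1) = |s| ^ m := by
    rcases h0.eq_or_lt with h | h
    · rw [← h, Real.zero_rpow (by linarith), Real.zero_rpow (by linarith), zero_mul]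
    · nth_rw 1 [← Real.rpow_one |s|]
      rw [← Real.rpow_add h]; congr 1; ring
  rw [growth, slope, ← mul_assoc, e, mul_comm]
  exact mul_le_mul_of_nonneg_right (Real.rpow_le_rpow (le_min h0 hk.le) (min_le_right _ _)
    (by linarith)) (Real.rpow_nonneg h0 _)

/-- A quasi-triangle inequality. -/
lemma growth_add_le (hmp : m ≤ p) (hm : 1 < m) (hk : 0 < k) (s t : ℝ) :
    growth p m k (s + t) ≤ 2 ^ p * (growth p m k s + growth p m k t) := by
  have key : ∀ u, growth p m k (2 * u) ≤ 2 ^ p * growth p m k u := by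
    intro u
    have h := slope_half (k := k) hmp hk (t := 2 * |u|) (by positivity)
    rw [mul_div_cancel_left₀ _ (two_ne_zero : (2 : ℝ) ≠ 0), Real.rpow_sub (by norm_num),
      Real.rpow_one] at h
    rw [growth, growth, abs_mul, abs_two]
    have h2p : (0 : ℝ) < 2 ^ p := by positivity
    calc 2 * |u| * slope p m k (2 * |u|) = 2 ^ p * (|u| * (2 / 2 ^ p * slope p m k (2 * |u|))) := by
          field_simp
      _ ≤ _ := by gcongr
  have g1 := growth_nonneg (p := p) (m := m) hk s
  have g2 := growth_nonneg (p := p) (m := m) hk t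
  have h2p : (0 : ℝ) < 2 ^ p := by positivity
  rcases le_total |s| |t| with h | h
  · refine (growth_mono hmp hm hk (t := 2 * t) ?_).trans ((key t).trans ?_)
    · rw [abs_mul, abs_two]; linarith [abs_add_le s t]
    · gcongr; linarith
  · refine (growth_mono hmp hm hk (t := 2 * s) ?_).trans ((key s).trans ?_)
    · rw [abs_mul, abs_two]; linarith [abs_add_le s t]
    · gcongr; linarith

/-- For l ≥ k the quotient is k^(p-m) l^(m-2). This is where m < 2 is used: the error caused by the
loss of monotonicity disappears as l → ∞. -/
lemma tendsto_slope_div (hm' : m < 2) :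
    Tendsto (fun l : ℕ => slope p m k ((l : ℝ) + 1) / ((l : ℝ) + 1)) atTop (𝓝 0) := by
  have h1 : Tendsto (fun l : ℕ => k ^ (p - m) * ((l : ℝ) + 1) ^ (-(2 - m))) atTop (𝓝 0) := by
    have h2 := (tendsto_rpow_neg_atTop (y := 2 - m) (by linarith)).comp
      (tendsto_atTop_add_const_right atTop (1 : ℝ) tendsto_natCast_atTop_atTop)
    simpa using h2.const_mul (k ^ (p - m))
  refine h1.congr' ?_
  filter_upwards [eventually_ge_atTop ⌈k⌉₊] with l hl
  have h3 : k ≤ (l : ℝ) + 1 := by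
    have := Nat.le_of_ceil_le hl
    linarith
  have h4 : (0 : ℝ) < (l : ℝ) + 1 := by positivity
  rw [slope, min_eq_right h3, show -(2 - m) = (m - 1) - 1 by ring, Real.rpow_sub_one h4.ne']
  ring

end profile

/-! ### The regularised equation at a fixed time. -/

/-- The partial derivatives of the smoothing kernel. -/
def dkernel (n j : ℕ) (i : Fin n) (x : Torus n) : ℝ := grad (kernel n j) x i

lemma tsmooth_dkernel (j : ℕ) (i : Fin n) : TSmooth (dkernel n j i) := (tsmooth_kernel j).grad i

lemma continuous_dkernel (j : ℕ) (i : Fin n) : Continuous (dkernel n j i) :=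
  (tsmooth_dkernel j i).continuous

lemma hasPD_kernel (j : ℕ) (i : Fin n) : HasPD i (kernel n j) (dkernel n j i) :=
  (tsmooth_kernel j).hasPD i

lemma HasPD.translate {i : Fin n} {φ φ' : Torus n → ℝ} (h : HasPD i φ φ') (y : Torus n) :
    HasPD i (fun x => φ (x - y)) (fun x => φ' (x - y)) := by
  intro x
  simpa only [add_sub_right_comm] using h (x - y)

/-- The data of the equation at a fixed time: a function `g` with weak gradient `G`, and a field `b`
with weak divergence `d`, after regularisation with the smoothing kernels. -/
structure IsSlice (g : Torus n → ℝ) (G b : Fin n → Torus n → ℝ) (d : Torus n → ℝ) : Prop where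
  integrable : Integrable g volume
  memG : ∀ i, MemLp (G i) 2 volume
  memB : ∀ i, MemLp (b i) 2 volume
  integrable_div : Integrable d volume
  grad : ∀ j i x, conv (dkernel n j i) g x = conv (kernel n j) (G i) x
  div : ∀ j x, ∑ i, conv (dkernel n j i) (b i) x = conv (kernel n j) d x

lemma integral_mul_conv {k g ψ : Torus n → ℝ} (hk : Continuous k) (hg : Integrable g volume)
    (hψ : Continuous ψ) :
    ∫ x, ψ x * conv k g x = ∫ y, g y * ∫ x, k (x - y) * ψ x := by
  obtain ⟨C, _, hC⟩ := exists_bound_of_continuous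
    (show Continuous fun z : Torus n × Torus n => ψ z.1 * k (z.1 - z.2) by fun_prop)
  have hi : Integrable (Function.uncurry fun x y => ψ x * (k (x - y) * g y))
      ((volume : Measure (Torus n)).prod volume) := by
    have h1 : Integrable (fun z : Torus n × Torus n => g z.2)
        ((volume : Measure (Torus n)).prod volume) := hg.comp_snd volume
    refine (h1.bdd_mul (c := C) (f := fun z : Torus n × Torus n => ψ z.1 * k (z.1 - z.2))
      (by fun_prop) (Eventually.of_forall hC)).congr (Eventually.of_forall fun z => ?_)
    simp only [Function.uncurry]; ring
  calc ∫ x, ψ x * conv k g x = ∫ x, ∫ y, ψ x * (k (x - y) * g y) := by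
        simp only [conv, integral_const_mul]
    _ = ∫ y, ∫ x, ψ x * (k (x - y) * g y) := integral_integral_swap hi
    _ = _ := by
        refine integral_congr_ae (Eventually.of_forall fun y => ?_)
        simp only
        rw [← integral_const_mul]
        exact integral_congr_ae (Eventually.of_forall fun x => by simp only; ring)

lemma integral_mul_conv_kernel (j : ℕ) {g ψ : Torus n → ℝ} (hg : Integrable g volume)
    (hψ : Continuous ψ) :
    ∫ x, ψ x * conv (kernel n j) g x = ∫ y, g y * conv (kernel n j) ψ y := by
  rw [integral_mul_conv (continuous_kernel j) hg hψ]
  refine integral_congr_ae (Eventually.of_forall fun y => ?_)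
  simp only [conv, kernel_sub_comm j y]

/-- Fubini followed by an integration by parts in x for fixed y, which moves the derivative from the
kernel to ψ. -/
lemma integral_mul_conv_dkernel (j : ℕ) {i : Fin n} {g ψ ψ' : Torus n → ℝ} (hg : Integrable g volume)
    (h : HasPD i ψ ψ') (hψ : Continuous ψ) (hψ' : Continuous ψ') :
    ∫ x, ψ x * conv (dkernel n j i) g x = -∫ y, g y * conv (kernel n j) ψ' y := by
  rw [integral_mul_conv (continuous_dkernel j i) hg hψ, ← integral_neg]
  refine integral_congr_ae (Eventually.of_forall fun y => ?_)
  have := continuous_kernel (n := n) j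
  have := continuous_dkernel j i
  simp only
  rw [integral_mul_pd ((hasPD_kernel j i).translate y) h (by fun_prop) (by fun_prop) hψ hψ', conv]
  simp only [kernel_sub_comm j y, mul_neg]

lemma tendsto_integral_mul_conv_kernel {g ψ : Torus n → ℝ} (hg : Integrable g volume)
    (hψ : Continuous ψ) :
    Tendsto (fun j => ∫ x, g x * conv (kernel n j) ψ x) atTop (𝓝 (∫ x, g x * ψ x)) := by
  obtain ⟨C, _, hC⟩ := exists_bound_of_continuous hψ
  have hb : ∀ j x, |conv (kernel n j) ψ x| ≤ C := fun j x => by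
    rw [conv_eq]
    refine (abs_integral_le_of_abs_le ((continuous_kernel j).integrable_torus.const_mul C)
      fun z => ?_).trans_eq (by rw [integral_const_mul, integral_kernel, mul_one])
    rw [abs_mul, abs_of_nonneg (kernel_nonneg j z)]
    exact mul_le_mul_of_nonneg_right (hC _) (kernel_nonneg j z)
  refine tendsto_integral_of_dominated_convergence
    (F := fun j x => g x * conv (kernel n j) ψ x) (fun x => |g x| * C) (fun j => ?_)
    (hg.abs.mul_const C) (fun j => ?_) ?_
  · exact hg.aestronglyMeasurable.mul
      (continuous_conv (continuous_kernel j) hψ.integrable_torus).aestronglyMeasurable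
  · refine Eventually.of_forall fun x => ?_
    rw [norm_mul]
    exact mul_le_mul_of_nonneg_left (hb j x) (norm_nonneg _)
  · refine Eventually.of_forall fun x => Tendsto.const_mul _ ?_
    rw [Metric.tendsto_nhds]
    intro ε hε
    filter_upwards [eventually_conv_kernel_sub_le hψ (half_pos hε)] with j hj
    rw [Real.dist_eq]
    exact (hj x).trans_lt (half_lt_self hε)

/-- The divergence of the drift can be tested with functions of class `C¹`. -/
lemma IsSlice.sum_integral_mul_pd {g d : Torus n → ℝ} {G b : Fin n → Torus n → ℝ}
    (hs : IsSlice g G b d) {ψ : Torus n → ℝ} {ψ' : Fin n → Torus n → ℝ}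
    (h : ∀ i, HasPD i ψ (ψ' i)) (hψ : Continuous ψ) (hψ' : ∀ i, Continuous (ψ' i)) :
    ∑ i, ∫ x, b i x * ψ' i x = -∫ x, d x * ψ x := by
  have hb : ∀ i, Integrable (b i) volume := fun i => (hs.memB i).integrable (by norm_num)
  -- The regularised divergence identity is paired with ψ and the kernel is moved over to ψ. Then j
  -- → ∞, by uniform convergence on the continuous functions ψ and ψ'.
  have h1 : ∀ j, ∑ i, ∫ x, b i x * conv (kernel n j) (ψ' i) x =
      -∫ x, d x * conv (kernel n j) ψ x := by
    intro j
    rw [← integral_mul_conv_kernel j hs.integrable_div hψ]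
    simp only [← hs.div, Finset.mul_sum]
    rw [integral_finsetSum _ fun i _ => ?_, ← Finset.sum_neg_distrib]
    · refine Finset.sum_congr rfl fun i _ => ?_
      rw [integral_mul_conv_dkernel j (hb i) (h i) hψ (hψ' i), neg_neg]
    · have := continuous_conv (continuous_dkernel j i) (hb i)
      exact Continuous.integrable_torus (by fun_prop)
  have l1 : Tendsto (fun j => ∑ i, ∫ x, b i x * conv (kernel n j) (ψ' i) x) atTop
      (𝓝 (∑ i, ∫ x, b i x * ψ' i x)) :=
    tendsto_finsetSum _ fun i _ => tendsto_integral_mul_conv_kernel (hb i) (hψ' i)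
  have l2 := (tendsto_integral_mul_conv_kernel hs.integrable_div hψ).neg
  simp only [← h1] at l2
  exact tendsto_nhds_unique l1 l2

lemma integral_abs_rpow {X : Type*} [MeasurableSpace X] {μ : Measure X} {g : X → ℝ} {p : ℝ}
    (hp : 0 < p) (hg : MemLp g (ENNReal.ofReal p) μ) :
    ∫ x, |g x| ^ p ∂μ = (eLpNorm g (ENNReal.ofReal p) μ).toReal ^ p := by
  have h0 : 0 ≤ ∫ x, |g x| ^ p ∂μ := integral_nonneg fun x => by positivity
  rw [MemLp.eLpNorm_eq_integral_rpow_norm (by simpa using hp) ENNReal.ofReal_ne_top hg,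
    ENNReal.toReal_ofReal hp.le]
  simp only [Real.norm_eq_abs]
  rw [ENNReal.toReal_ofReal (by positivity), ← Real.rpow_mul h0, inv_mul_cancel₀ hp.ne',
    Real.rpow_one]

lemma integral_sq_eq {X : Type*} [MeasurableSpace X] {μ : Measure X} {g : X → ℝ}
    (hg : MemLp g 2 μ) : ∫ x, g x ^ 2 ∂μ = (eLpNorm g 2 μ).toReal ^ 2 := by
  have e : (2 : ℝ≥0∞) = ENNReal.ofReal 2 := by simp
  rw [e] at hg ⊢
  have := integral_abs_rpow two_pos hg
  simpa only [Real.rpow_two, sq_abs] using this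

lemma integral_conv_kernel_sq_le {g : Torus n → ℝ} (hg : MemLp g 2 volume) (j : ℕ) :
    ∫ x, conv (kernel n j) g x ^ 2 ≤ ∫ x, g x ^ 2 := by
  rw [integral_sq_eq hg, integral_sq_eq (memLp_conv_kernel hg (by norm_num) (by norm_num) j)]
  refine pow_le_pow_left₀ ENNReal.toReal_nonneg ?_ 2
  exact ENNReal.toReal_mono hg.2.ne (eLpNorm_conv_kernel_le j hg.1 (by norm_num) (by norm_num))

/-- The transport term `b · G`. -/
def transport (b G : Fin n → Torus n → ℝ) (x : Torus n) : ℝ := ∑ i, b i x * G i x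

/-- The commutator of the regularisation with the transport term. -/
def commutator (j : ℕ) (b G : Fin n → Torus n → ℝ) (x : Torus n) : ℝ :=
  conv (kernel n j) (transport b G) x - ∑ i, b i x * conv (kernel n j) (G i) x

/-- The Laplacian of the regularised solution. -/
def laplacian (j : ℕ) (G : Fin n → Torus n → ℝ) (x : Torus n) : ℝ :=
  ∑ i, conv (dkernel n j i) (G i) x

/-- The opposite of the time derivative of the regularised solution. -/
def velocity (j : ℕ) (b G : Fin n → Torus n → ℝ) (f : Torus n → ℝ) (x : Torus n) : ℝ :=
  laplacian j G x + conv (kernel n j) (transport b G) x + conv (kernel n j) f x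

lemma IsSlice.integrable_transport {g d : Torus n → ℝ} {G b : Fin n → Torus n → ℝ}
    (hs : IsSlice g G b d) : Integrable (transport b G) volume :=
  integrable_finsetSum _ fun i _ => (hs.memB i).integrable_mul (hs.memG i)

/-- The dissipation of the regularised solution. -/
def dissipation (j : ℕ) (κ : ℝ) (Fc : ℝ → ℝ) (g : Torus n → ℝ) (G : Fin n → Torus n → ℝ) (c : ℝ) : ℝ :=
  κ⁻¹ * -∫ x, Fc (conv (kernel n j) g x - c) * laplacian j G x

section energy

variable {g d f : Torus n → ℝ} {G b : Fin n → Torus n → ℝ} {p κ ε L : ℝ} {F Fc Gp β : ℝ → ℝ}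

lemma IsSlice.hasPD_conv (hs : IsSlice g G b d) (j : ℕ) (i : Fin n) (c : ℝ) :
    HasPD i (fun x => conv (kernel n j) g x - c) (conv (kernel n j) (G i)) := by
  have h := (DriftDiffusion.hasPD_conv (hasPD_kernel j i) (continuous_kernel j) (continuous_dkernel j i)
    hs.integrable).sub_const c
  rwa [show conv (dkernel n j i) g = conv (kernel n j) (G i) from funext (hs.grad j i)] at h

lemma IsSlice.hasPD_conv_grad (hs : IsSlice g G b d) (j : ℕ) (i : Fin n) :
    HasPD i (conv (kernel n j) (G i)) (conv (dkernel n j i) (G i)) :=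
  DriftDiffusion.hasPD_conv (hasPD_kernel j i) (continuous_kernel j) (continuous_dkernel j i)
    ((hs.memG i).integrable (by norm_num))

lemma IsSlice.continuous_conv (hs : IsSlice g G b d) (j : ℕ) : Continuous (conv (kernel n j) g) :=
  DriftDiffusion.continuous_conv (continuous_kernel j) hs.integrable

lemma IsSlice.continuous_conv_grad (hs : IsSlice g G b d) (j : ℕ) (i : Fin n) :
    Continuous (conv (kernel n j) (G i)) :=
  DriftDiffusion.continuous_conv (continuous_kernel j) ((hs.memG i).integrable (by norm_num))

lemma IsSlice.continuous_conv_hess (hs : IsSlice g G b d) (j : ℕ) (i : Fin n) :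
    Continuous (conv (dkernel n j i) (G i)) :=
  DriftDiffusion.continuous_conv (continuous_dkernel j i) ((hs.memG i).integrable (by norm_num))

lemma IsSlice.continuous_laplacian (hs : IsSlice g G b d) (j : ℕ) : Continuous (laplacian j G) :=
  continuous_finsetSum _ fun i _ => hs.continuous_conv_hess j i

lemma IsSlice.integral_mul_laplacian (hs : IsSlice g G b d) (j : ℕ) {φ : Torus n → ℝ}
    (hφ : Continuous φ) : ∫ x, φ x * laplacian j G x = ∑ i, ∫ x, φ x * conv (dkernel n j i) (G i) x := by
  simp only [laplacian, Finset.mul_sum]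
  exact integral_finsetSum _ fun i _ => (hφ.mul (hs.continuous_conv_hess j i)).integrable_torus

lemma IsProfile.mono (hP : IsProfile p κ ε L F Fc Gp β) (hκ : 0 < κ) (a b : ℝ) :
    0 ≤ (Fc a - Fc b) * (a - b) :=
  le_trans (by positivity) (hP.sv a b)

lemma IsSlice.hess_nonneg (hs : IsSlice g G b d) (hP : IsProfile p κ ε L F Fc Gp β) (hκ : 0 < κ)
    (j : ℕ) (c : ℝ) (i : Fin n) :
    0 ≤ -∫ x, Fc (conv (kernel n j) g x - c) * conv (dkernel n j i) (G i) x :=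
  integral_mul_pd_pd_nonpos (hs.hasPD_conv j i c) (hs.hasPD_conv_grad j i)
    ((hs.continuous_conv j).sub continuous_const) (hs.continuous_conv_grad j i)
    (hs.continuous_conv_hess j i) hP.contFc (hP.mono hκ)

lemma IsSlice.dissipation_eq (hs : IsSlice g G b d) (hP : IsProfile p κ ε L F Fc Gp β)
    (j : ℕ) (c : ℝ) : dissipation j κ Fc g G c =
      κ⁻¹ * ∑ i, -∫ x, Fc (conv (kernel n j) g x - c) * conv (dkernel n j i) (G i) x := by
  have := hs.continuous_conv j
  have := hP.contFc
  rw [dissipation, hs.integral_mul_laplacian j (by fun_prop), Finset.sum_neg_distrib]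

lemma IsSlice.dissipation_nonneg (hs : IsSlice g G b d) (hP : IsProfile p κ ε L F Fc Gp β) (hκ : 0 < κ)
    (j : ℕ) (c : ℝ) : 0 ≤ dissipation j κ Fc g G c := by
  rw [hs.dissipation_eq hP]
  exact mul_nonneg (by positivity) (Finset.sum_nonneg fun i _ => hs.hess_nonneg hP hκ j c i)

/-- `translation_bound_of_monotone` for κ⁻¹ Fc; the contribution of one direction is at most the
sum, because all of them are nonnegative. -/
lemma IsSlice.shiftBound (hs : IsSlice g G b d) (hP : IsProfile p κ ε L F Fc Gp β) (hκ : 0 < κ)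
    (j : ℕ) (c : ℝ) :
    ShiftBound (fun x => Gp (conv (kernel n j) g x - c)) (dissipation j κ Fc g G c) := by
  intro i h hh
  have h1 := translation_bound_of_monotone (hs.hasPD_conv j i c) (hs.hasPD_conv_grad j i)
    ((hs.continuous_conv j).sub continuous_const) (hs.continuous_conv_grad j i)
    (hs.continuous_conv_hess j i) (F := fun a => κ⁻¹ * Fc a) (continuous_const.mul hP.contFc)
    hP.contG (fun a b => ?_) hh
  · refine h1.trans (mul_le_mul_of_nonneg_left ?_ (by positivity))
    rw [hs.dissipation_eq hP]
    simp only [mul_assoc, integral_const_mul]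
    rw [← mul_neg]
    refine mul_le_mul_of_nonneg_left ?_ (by positivity)
    exact Finset.single_le_sum (f := fun i => -∫ x, Fc (conv (kernel n j) g x - c) *
      conv (dkernel n j i) (G i) x) (fun i _ => hs.hess_nonneg hP hκ j c i) (Finset.mem_univ i)
  · rw [← mul_sub, mul_assoc, ← div_eq_inv_mul, le_div_iff₀ hκ, mul_comm]
    exact hP.sv a b

/-- The diffusion term in the energy inequality. -/
lemma IsSlice.diffusion_le (hs : IsSlice g G b d) (hP : IsProfile p κ ε L F Fc Gp β) (hκ : 0 < κ)
    (hε : 0 ≤ ε) (j : ℕ) (c : ℝ) :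
    ∫ x, F (conv (kernel n j) g x - c) * laplacian j G x ≤
      -κ * dissipation j κ Fc g G c + ε * ∑ i, ∫ x, G i x ^ 2 := by
  have c1 : Continuous fun x => conv (kernel n j) g x - c := (hs.continuous_conv j).sub continuous_const
  have cF : Continuous fun x => F (conv (kernel n j) g x - c) := hP.contF.comp c1
  have cFc : Continuous fun x => Fc (conv (kernel n j) g x - c) := hP.contFc.comp c1
  rw [hs.integral_mul_laplacian j cF, hs.dissipation_eq hP, ← mul_assoc, neg_mul,
    mul_inv_cancel₀ hκ.ne', Finset.mul_sum, Finset.mul_sum, ← Finset.sum_add_distrib]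
  refine Finset.sum_le_sum fun i _ => ?_
  have c2 := hs.continuous_conv_hess j i
  have c3 := hs.continuous_conv_grad j i
  -- F itself is not monotone, but ε a - (Fc a - F a) is, by `tail`. Replacing F by Fc therefore
  -- costs ε times the Dirichlet integral, and convolution does not increase the latter.
  have h1 := integral_mul_pd_pd_nonpos (hs.hasPD_conv j i c) (hs.hasPD_conv_grad j i)
    c1 c3 c2 (F := fun a => ε * a - (Fc a - F a))
    ((continuous_const.mul continuous_id).sub (hP.contFc.sub hP.contF))
    (fun a b => by nlinarith [hP.tail a b])
  have i1 : Integrable (fun x => ε * ((conv (kernel n j) g x - c) * conv (dkernel n j i) (G i) x))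
    volume := Continuous.integrable_torus (by fun_prop)
  have i2 : Integrable (fun x => Fc (conv (kernel n j) g x - c) * conv (dkernel n j i) (G i) x)
    volume := (cFc.mul c2).integrable_torus
  have i3 : Integrable (fun x => F (conv (kernel n j) g x - c) * conv (dkernel n j i) (G i) x)
    volume := (cF.mul c2).integrable_torus
  have e : ∫ x, (ε * (conv (kernel n j) g x - c) - (Fc (conv (kernel n j) g x - c) -
      F (conv (kernel n j) g x - c))) * conv (dkernel n j i) (G i) x =
      ε * (∫ x, (conv (kernel n j) g x - c) * conv (dkernel n j i) (G i) x) -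
      ((∫ x, Fc (conv (kernel n j) g x - c) * conv (dkernel n j i) (G i) x) -
        ∫ x, F (conv (kernel n j) g x - c) * conv (dkernel n j i) (G i) x) := by
    rw [← integral_sub i2 i3, ← integral_const_mul, ← integral_sub i1 (i2.fsub i3)]
    exact integral_congr_ae (Eventually.of_forall fun x => by simp only; ring)
  have h2 := integral_mul_pd (hs.hasPD_conv j i c) (hs.hasPD_conv_grad j i) c1 c3 c3 c2
  have h3 := integral_conv_kernel_sq_le (hs.memG i) j
  simp only [← pow_two] at h2
  rw [e] at h1
  have h4 : ε * ∫ x, conv (kernel n j) (G i) x ^ 2 ≤ ε * ∫ x, G i x ^ 2 :=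
    mul_le_mul_of_nonneg_left h3 hε
  rw [h2] at h4
  linarith

lemma IsProfile.nonneg (hP : IsProfile p κ ε L F Fc Gp β) (s : ℝ) : 0 ≤ β s := by
  have h1 := hP.sq_le s
  have h2 : (0 : ℝ) < 2 ^ p := by positivity
  exact nonneg_of_mul_nonneg_right (le_trans (sq_nonneg _) h1) h2

lemma IsProfile.continuous_primitive (hP : IsProfile p κ ε L F Fc Gp β) : Continuous β :=
  continuous_iff_continuousAt.2 fun s => (hP.deriv s).continuousAt

/-- The transport term in the energy inequality, up to the commutator. -/
lemma IsSlice.transport_le {q : ℝ≥0∞} (hs : IsSlice g G b d) (hP : IsProfile p κ ε L F Fc Gp β)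
    (hq : 1 ≤ q) (hd : MemLp d q volume) (j : ℕ) (c : ℝ) :
    ∫ x, F (conv (kernel n j) g x - c) * ∑ i, b i x * conv (kernel n j) (G i) x ≤
      2 * ∫ x, |d x| * Gp (conv (kernel n j) g x - c) ^ 2 := by
  have c1 : Continuous fun x => conv (kernel n j) g x - c := (hs.continuous_conv j).sub continuous_const
  have cF : Continuous fun x => F (conv (kernel n j) g x - c) := hP.contF.comp c1
  have cG : Continuous fun x => Gp (conv (kernel n j) g x - c) := hP.contG.comp c1
  -- The chain rule makes F(u - c) Du the gradient of β(u - c), so the drift acts through its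
  -- divergence alone.
  have h := hs.sum_integral_mul_pd (ψ := fun x => β (conv (kernel n j) g x - c))
    (fun i => (hs.hasPD_conv j i c).comp_real hP.deriv) (hP.continuous_primitive.comp c1)
    (fun i => cF.mul (hs.continuous_conv_grad j i))
  have e : ∫ x, F (conv (kernel n j) g x - c) * ∑ i, b i x * conv (kernel n j) (G i) x =
      ∑ i, ∫ x, b i x * (F (conv (kernel n j) g x - c) * conv (kernel n j) (G i) x) := by
    rw [← integral_finsetSum]
    · refine integral_congr_ae (Eventually.of_forall fun x => ?_)
      simp only [Finset.mul_sum]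
      exact Finset.sum_congr rfl fun i _ => by ring
    · intro i _
      obtain ⟨C, _, hC⟩ := exists_bound_of_continuous (cF.mul (hs.continuous_conv_grad j i))
      exact ((hs.memB i).integrable (by norm_num)).mul_bdd (c := C)
        (cF.mul (hs.continuous_conv_grad j i)).aestronglyMeasurable (Eventually.of_forall hC)
  rw [e, h, ← integral_const_mul]
  refine (neg_le_abs _).trans (abs_integral_le_of_abs_le
    ((integrable_abs_mul_sq hq hd cG).const_mul 2) fun x => ?_)
  rw [abs_mul, abs_of_nonneg (hP.nonneg _), mul_left_comm]
  exact mul_le_mul_of_nonneg_left (hP.le_sq _) (abs_nonneg _)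

/-- The source term in the energy inequality. -/
lemma IsSlice.source_le (hs : IsSlice g G b d) (hP : IsProfile p κ ε L F Fc Gp β) (hp : 1 < p)
    (hf : MemLp f (ENNReal.ofReal p) volume) (j : ℕ) (c : ℝ) :
    ∫ x, F (conv (kernel n j) g x - c) * conv (kernel n j) f x ≤
      (eLpNorm f (ENNReal.ofReal p) volume).toReal *
        (2 ^ p * ∫ x, β (conv (kernel n j) g x - c)) ^ (1 - 1 / p) := by
  have c1 : Continuous fun x => conv (kernel n j) g x - c := (hs.continuous_conv j).sub continuous_const
  have cF : Continuous fun x => F (conv (kernel n j) g x - c) := hP.contF.comp c1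
  have cβ : Continuous fun x => β (conv (kernel n j) g x - c) := hP.continuous_primitive.comp c1
  have hp1 : (1 : ℝ≥0∞) ≤ ENNReal.ofReal p := by
    rw [← ENNReal.ofReal_one]; exact ENNReal.ofReal_le_ofReal hp.le
  have hpq : p.HolderConjugate (p / (p - 1)) := Real.HolderConjugate.conjExponent hp
  have m1 := memLp_conv_kernel hf hp1 ENNReal.ofReal_ne_top j
  have hcf := DriftDiffusion.continuous_conv (continuous_kernel j) (hf.integrable hp1)
  have m2 : MemLp (fun x => F (conv (kernel n j) g x - c)) (ENNReal.ofReal (p / (p - 1))) volume :=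
    MemLp.of_bound cF.aestronglyMeasurable L (Eventually.of_forall fun x => hP.bound _)
  have h := integral_mul_norm_le_Lp_mul_Lq hpq m1 m2
  simp only [Real.norm_eq_abs] at h
  have hX : (∫ x, |conv (kernel n j) f x| ^ p) ^ (1 / p) ≤
      (eLpNorm f (ENNReal.ofReal p) volume).toReal := by
    rw [integral_abs_rpow (by linarith) m1, ← Real.rpow_mul ENNReal.toReal_nonneg,
      mul_one_div_cancel (by linarith), Real.rpow_one]
    exact ENNReal.toReal_mono hf.2.ne (eLpNorm_conv_kernel_le j hf.1 hp1 ENNReal.ofReal_ne_top)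
  -- The dual norm of F(u - c) is measured by ∫ β itself; this produces the power 1 - 1/p for which
  -- Grönwall's inequality closes.
  have hY : ∫ x, |F (conv (kernel n j) g x - c)| ^ (p / (p - 1)) ≤
      2 ^ p * ∫ x, β (conv (kernel n j) g x - c) := by
    rw [← integral_const_mul]
    refine integral_mono ?_ (cβ.integrable_torus.const_mul _) fun x => hP.rpow_le _
    exact ((cF.abs).rpow_const fun x => Or.inr hpq.symm.nonneg).integrable_torus
  have e : 1 / (p / (p - 1)) = 1 - 1 / p := by
    have : p ≠ 0 := by linarith
    have : p - 1 ≠ 0 := by linarith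
    field_simp
  have i1 : Integrable (fun x => |conv (kernel n j) f x| * |F (conv (kernel n j) g x - c)|) volume :=
    (hcf.abs.mul cF.abs).integrable_torus
  refine (le_abs_self _).trans ((abs_integral_le_of_abs_le i1 fun x => ?_).trans (h.trans ?_))
  · rw [abs_mul, mul_comm]
  · rw [e]
    have h0 : 0 ≤ 1 - 1 / p := by rw [← e]; exact (one_div_pos.2 hpq.symm.pos).le
    have h1 : 0 ≤ ∫ x, |F (conv (kernel n j) g x - c)| ^ (p / (p - 1)) :=
      integral_nonneg fun x => by positivity
    exact mul_le_mul hX (Real.rpow_le_rpow h1 hY h0) (by positivity) ENNReal.toReal_nonneg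

lemma IsSlice.integrable_sum_mul_conv (hs : IsSlice g G b d) (j : ℕ) :
    Integrable (fun x => ∑ i, b i x * conv (kernel n j) (G i) x) volume := by
  refine integrable_finsetSum _ fun i _ => ?_
  obtain ⟨C, _, hC⟩ := exists_bound_of_continuous (hs.continuous_conv_grad j i)
  exact ((hs.memB i).integrable (by norm_num)).mul_bdd (c := C)
    (hs.continuous_conv_grad j i).aestronglyMeasurable (Eventually.of_forall hC)

lemma IsSlice.integrable_commutator (hs : IsSlice g G b d) (j : ℕ) :
    Integrable (commutator j b G) volume :=
  (DriftDiffusion.continuous_conv (continuous_kernel j) hs.integrable_transport).integrable_torus.sub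
    (hs.integrable_sum_mul_conv j)

lemma IsSlice.continuous_velocity (hs : IsSlice g G b d) (hf : Integrable f volume) (j : ℕ) :
    Continuous (velocity j b G f) :=
  ((hs.continuous_laplacian j).add
    (DriftDiffusion.continuous_conv (continuous_kernel j) hs.integrable_transport)).add
    (DriftDiffusion.continuous_conv (continuous_kernel j) hf)

/-- The energy inequality at a fixed time. -/
theorem IsSlice.energy_le {q : ℝ≥0∞} (hs : IsSlice g G b d) (hP : IsProfile p κ ε L F Fc Gp β)
    (hp : 1 < p) (hκ : 0 < κ) (hε : 0 ≤ ε) (hq : 1 ≤ q) (hd : MemLp d q volume)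
    (hf : MemLp f (ENNReal.ofReal p) volume) {A : ℝ}
    (hA : ∀ (w : Torus n → ℝ) (D : ℝ), Continuous w → 0 ≤ D → ShiftBound w D →
      ∫ x, |d x| * w x ^ 2 ≤ κ / 4 * D + A * ∫ x, w x ^ 2) (j : ℕ) (c : ℝ) :
    ∫ x, F (conv (kernel n j) g x - c) * velocity j b G f x ≤
      -(κ / 2) * dissipation j κ Fc g G c + 2 * A * (∫ x, Gp (conv (kernel n j) g x - c) ^ 2) +
      (eLpNorm f (ENNReal.ofReal p) volume).toReal *
        (2 ^ p * ∫ x, β (conv (kernel n j) g x - c)) ^ (1 - 1 / p) +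
      (ε * (∑ i, ∫ x, G i x ^ 2) + L * ∫ x, |commutator j b G x|) := by
  have c1 : Continuous fun x => conv (kernel n j) g x - c := (hs.continuous_conv j).sub continuous_const
  have cF : Continuous fun x => F (conv (kernel n j) g x - c) := hP.contF.comp c1
  have cG : Continuous fun x => Gp (conv (kernel n j) g x - c) := hP.contG.comp c1
  have hp1 : (1 : ℝ≥0∞) ≤ ENNReal.ofReal p := by
    rw [← ENNReal.ofReal_one]; exact ENNReal.ofReal_le_ofReal hp.le
  have hcf := DriftDiffusion.continuous_conv (continuous_kernel j) (hf.integrable hp1)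
  have bF : ∀ᵐ x ∂(volume : Measure (Torus n)), ‖F (conv (kernel n j) g x - c)‖ ≤ L :=
    Eventually.of_forall fun x => hP.bound _
  have i1 : Integrable (fun x => F (conv (kernel n j) g x - c) * laplacian j G x) volume :=
    (cF.mul (hs.continuous_laplacian j)).integrable_torus
  have i2 : Integrable (fun x => F (conv (kernel n j) g x - c) *
      ∑ i, b i x * conv (kernel n j) (G i) x) volume :=
    (hs.integrable_sum_mul_conv j).bdd_mul (c := L) cF.aestronglyMeasurable bF
  have i3 : Integrable (fun x => F (conv (kernel n j) g x - c) * commutator j b G x) volume :=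
    (hs.integrable_commutator j).bdd_mul (c := L) cF.aestronglyMeasurable bF
  have i4 : Integrable (fun x => F (conv (kernel n j) g x - c) * conv (kernel n j) f x) volume :=
    (cF.mul hcf).integrable_torus
  have e : ∫ x, F (conv (kernel n j) g x - c) * velocity j b G f x =
      (∫ x, F (conv (kernel n j) g x - c) * laplacian j G x) +
      (∫ x, F (conv (kernel n j) g x - c) * ∑ i, b i x * conv (kernel n j) (G i) x) +
      (∫ x, F (conv (kernel n j) g x - c) * commutator j b G x) +
      ∫ x, F (conv (kernel n j) g x - c) * conv (kernel n j) f x := by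
    rw [← integral_add i1 i2, ← integral_add (i1.fadd i2) i3, ← integral_add ((i1.fadd i2).fadd i3) i4]
    refine integral_congr_ae (Eventually.of_forall fun x => ?_)
    simp only [velocity, commutator]; ring
  have h1 := hs.diffusion_le hP hκ hε j c
  have h2 := hs.transport_le hP hq hd j c
  -- The transport term carries a factor 2, so it uses 2 · κ/4 of the dissipation and κ/2 remains.
  have h3 := hA _ _ cG (hs.dissipation_nonneg hP hκ j c) (hs.shiftBound hP hκ j c)
  have h4 := hs.source_le hP hp hf j c
  have h5 : ∫ x, F (conv (kernel n j) g x - c) * commutator j b G x ≤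
      L * ∫ x, |commutator j b G x| := by
    rw [← integral_const_mul]
    refine (le_abs_self _).trans (abs_integral_le_of_abs_le
      ((hs.integrable_commutator j).abs.const_mul L) fun x => ?_)
    rw [abs_mul]
    exact mul_le_mul_of_nonneg_right (hP.bound _) (abs_nonneg _)
  rw [e]
  linarith

end energy

/-! ### Absolutely continuous functions and a nonlinear Grönwall inequality. -/

/-- `Z` is absolutely continuous on `[a, b]` and `h` is the opposite of its derivative. -/
structure IsBackward (Z h : ℝ → ℝ) (a b : ℝ) : Prop where
  integrable : IntervalIntegrable h volume a b
  eq : ∀ t ∈ Icc a b, Z t = Z b + ∫ s in t..b, h s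

lemma _root_.AbsolutelyContinuousOnInterval.comp_lipschitzOnWith {f Φ : ℝ → ℝ} {a b : ℝ} {K : ℝ≥0}
    (hf : AbsolutelyContinuousOnInterval f a b) (hΦ : LipschitzOnWith K Φ (f '' uIcc a b)) :
    AbsolutelyContinuousOnInterval (fun t => Φ (f t)) a b := by
  rw [absolutelyContinuousOnInterval_iff] at hf ⊢
  intro ε hε
  obtain ⟨δ, hδ, h⟩ := hf (ε / (K + 1)) (by positivity)
  refine ⟨δ, hδ, fun E hE hEδ => ?_⟩
  have h1 := h E hE hEδ
  rw [lt_div_iff₀ (by positivity)] at h1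
  refine lt_of_le_of_lt ?_ h1
  rw [Finset.sum_mul]
  refine Finset.sum_le_sum fun i hi => ?_
  have h2 := hΦ.dist_le_mul _ (mem_image_of_mem f (hE.1 i hi).1) _ (mem_image_of_mem f (hE.1 i hi).2)
  have h3 := dist_nonneg (x := f (E.2 i).1) (y := f (E.2 i).2)
  nlinarith

namespace IsBackward

variable {Z Z' h h' : ℝ → ℝ} {a b : ℝ}

lemma mono_left (hZ : IsBackward Z h a b) {t : ℝ} (ht : t ∈ Icc a b) : IsBackward Z h t b := by
  refine ⟨hZ.integrable.mono_set ?_, fun s hs => hZ.eq s ⟨ht.1.trans hs.1, hs.2⟩⟩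
  rw [uIcc_of_le ht.2, uIcc_of_le (ht.1.trans ht.2)]
  exact Icc_subset_Icc_left ht.1

lemma intervalIntegrable_of_mem (hZ : IsBackward Z h a b) {t : ℝ} (ht : t ∈ Icc a b) :
    IntervalIntegrable h volume t b := (hZ.mono_left ht).integrable

lemma add (hZ : IsBackward Z h a b) (hZ' : IsBackward Z' h' a b) :
    IsBackward (fun t => Z t + Z' t) (fun t => h t + h' t) a b := by
  refine ⟨hZ.integrable.add hZ'.integrable, fun t ht => ?_⟩
  rw [intervalIntegral.integral_add (hZ.intervalIntegrable_of_mem ht)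
    (hZ'.intervalIntegrable_of_mem ht), hZ.eq t ht, hZ'.eq t ht]
  ring

lemma const_mul (hZ : IsBackward Z h a b) (c : ℝ) :
    IsBackward (fun t => c * Z t) (fun t => c * h t) a b := by
  refine ⟨hZ.integrable.const_mul c, fun t ht => ?_⟩
  rw [intervalIntegral.integral_const_mul, hZ.eq t ht]
  ring

lemma sub (hZ : IsBackward Z h a b) (hZ' : IsBackward Z' h' a b) :
    IsBackward (fun t => Z t - Z' t) (fun t => h t - h' t) a b := by
  simpa [← sub_eq_add_neg] using hZ.add (hZ'.const_mul (-1))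

lemma add_const (hZ : IsBackward Z h a b) (c : ℝ) : IsBackward (fun t => Z t + c) h a b :=
  ⟨hZ.integrable, fun t ht => by rw [hZ.eq t ht]; ring⟩

lemma of_primitive (hh : IntervalIntegrable h volume a b) :
    IsBackward (fun t => ∫ s in a..t, h s) (fun t => -h t) a b := by
  refine ⟨hh.neg, fun t ht => ?_⟩
  have h1 : IntervalIntegrable h volume a t := hh.mono_set (by
    rw [uIcc_of_le ht.1, uIcc_of_le (ht.1.trans ht.2)]; exact Icc_subset_Icc_right ht.2)
  have h2 : IntervalIntegrable h volume t b := hh.mono_set (by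
    rw [uIcc_of_le ht.2, uIcc_of_le (ht.1.trans ht.2)]; exact Icc_subset_Icc_left ht.1)
  rw [intervalIntegral.integral_neg, ← intervalIntegral.integral_add_adjacent_intervals h1 h2]
  ring

/-- A globally defined absolutely continuous function which agrees with `Z`. -/
lemma exists_extension (hZ : IsBackward Z h a b) :
    ∃ x : ℝ → ℝ, AbsolutelyContinuousOnInterval x a b ∧ (∀ t ∈ Icc a b, x t = Z t) ∧
      ∀ᵐ t, t ∈ uIcc a b → HasDerivAt x (-h t) t := by
  have hb : b ∈ uIcc a b := right_mem_uIcc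
  refine ⟨fun t => Z b - ∫ s in b..t, h s, ?_, fun t ht => ?_, ?_⟩
  · have h1 : AbsolutelyContinuousOnInterval (fun _ : ℝ => Z b) a b :=
      LipschitzOnWith.absolutelyContinuousOnInterval (K := 0) (LipschitzWith.const (Z b)).lipschitzOnWith
    exact h1.sub (hZ.integrable.absolutelyContinuousOnInterval_intervalIntegral hb)
  · rw [hZ.eq t ht, intervalIntegral.integral_symm, ← sub_eq_add_neg]
  · filter_upwards [hZ.integrable.ae_hasDerivAt_integral] with t ht htm
    exact (ht htm b hb).const_sub (Z b)

lemma continuousOn (hZ : IsBackward Z h a b) (hab : a ≤ b) : ContinuousOn Z (Icc a b) := by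
  obtain ⟨x, hx, hxZ, _⟩ := hZ.exists_extension
  have := hx.continuousOn
  rw [uIcc_of_le hab] at this
  exact this.congr fun t ht => (hxZ t ht).symm

lemma intervalIntegrable_mul (hZ : IsBackward Z h a b) (hab : a ≤ b) {φ : ℝ → ℝ}
    (hφ : ContinuousOn φ (Icc a b)) : IntervalIntegrable (fun t => φ t * h t) volume a b :=
  hZ.integrable.continuousOn_mul (by rwa [uIcc_of_le hab])

/-- The chain rule. -/
lemma comp (hZ : IsBackward Z h a b) (hab : a ≤ b) {Φ Φ' : ℝ → ℝ} {s : Set ℝ}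
    (hZs : ∀ t ∈ Icc a b, Z t ∈ s) (hΦ : ∀ z ∈ s, HasDerivAt Φ (Φ' z) z) (hΦ' : ContinuousOn Φ' s) :
    IsBackward (fun t => Φ (Z t)) (fun t => Φ' (Z t) * h t) a b := by
  have hint := hZ.intervalIntegrable_mul hab (hΦ'.comp (hZ.continuousOn hab) hZs)
  refine ⟨hint, fun t ht => ?_⟩
  have hZt := hZ.mono_left ht
  have hsub : Icc t b ⊆ Icc a b := Icc_subset_Icc_left ht.1
  obtain ⟨x, hx, hxZ, hxd⟩ := hZt.exists_extension
  have hu : uIcc t b = Icc t b := uIcc_of_le ht.2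
  have hxs : ∀ r ∈ Icc t b, x r ∈ s := fun r hr => by rw [hxZ r hr]; exact hZs r (hsub hr)
  have hxc : ContinuousOn x (Icc t b) := hu ▸ hx.continuousOn
  have hK : IsCompact (x '' Icc t b) := isCompact_Icc.image_of_continuousOn hxc
  have hKs : x '' Icc t b ⊆ s := by rintro _ ⟨r, hr, rfl⟩; exact hxs r hr
  -- The range of x is an interval, so a bound for Φ' on it makes Φ Lipschitz there, and the
  -- composition remains absolutely continuous.
  have hconv : Convex ℝ (x '' Icc t b) :=
    (isPreconnected_Icc.image x hxc).ordConnected.convex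
  obtain ⟨M, hM⟩ := hK.exists_bound_of_continuousOn (hΦ'.mono hKs)
  have hlip : LipschitzOnWith (Real.toNNReal M) Φ (x '' uIcc t b) := by
    rw [hu]
    refine hconv.lipschitzOnWith_of_nnnorm_hasDerivWithin_le
      (fun z hz => (hΦ z (hKs hz)).hasDerivWithinAt) fun z hz => ?_
    rw [← NNReal.coe_le_coe, coe_nnnorm]
    exact (hM z hz).trans (Real.le_coe_toNNReal M)
  have h1 := (hx.comp_lipschitzOnWith hlip).integral_deriv_eq_sub
  have h2 : ∫ r in t..b, deriv (fun t => Φ (x t)) r = ∫ r in t..b, -(Φ' (Z r) * h r) := by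
    refine intervalIntegral.integral_congr_ae ?_
    filter_upwards [hxd] with r hr hrm
    have hrm' := uIoc_subset_uIcc hrm
    have hrm'' : r ∈ Icc t b := hu ▸ hrm'
    have h3 := ((hΦ (x r) (hxs r hrm'')).comp r (hr hrm')).deriv
    rw [← hxZ r hrm'']
    simpa [Function.comp_def] using h3
  rw [h2, intervalIntegral.integral_neg, hxZ b ⟨ht.2, le_rfl⟩, hxZ t ⟨le_rfl, ht.2⟩] at h1
  linarith

/-- A nonlinear version of Grönwall's inequality, for functions which satisfy
`-Z' ≤ (α + g) Z + φ Z ^ (1 - 1 / p) + e`. -/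
lemma gronwall (hZ : IsBackward Z h a b) (hab : a ≤ b) {p α δ : ℝ} (hp : 1 < p) (hδ : 0 < δ)
    {g φ e : ℝ → ℝ} (hZ0 : ∀ t ∈ Icc a b, 0 ≤ Z t)
    (hg : IntervalIntegrable g volume a b) (hφ : IntervalIntegrable φ volume a b)
    (he : IntervalIntegrable e volume a b) (hg0 : ∀ s, 0 ≤ g s) (hφ0 : ∀ s, 0 ≤ φ s) (he0 : ∀ s, 0 ≤ e s)
    (hle : ∀ᵐ s, s ∈ Ioc a b → h s ≤ (α + g s) * Z s + φ s * Z s ^ (1 - 1 / p) + e s) :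
    (Z a + δ) ^ (1 / p) ≤ Real.exp (∫ s in a..b, g s) *
      (Real.exp (α / p * (b - a)) * (Z b + δ) ^ (1 / p) +
        (∫ s in a..b, Real.exp (α / p * (s - a)) * φ s) +
        Real.exp (|α| * (b - a)) * (δ ^ (1 / p - 1) * ((∫ s in a..b, e s) + |α| * δ * (b - a)))) := by
  have hp0 : 0 < p := by linarith
  have hW : IsBackward (fun t => Z t + δ) h a b := hZ.add_const δ
  have hWpos : ∀ t ∈ Icc a b, 0 < Z t + δ := fun t ht => by linarith [hZ0 t ht]
  have hlog : IsBackward (fun t => Real.log (Z t + δ)) (fun t => (Z t + δ)⁻¹ * h t) a b :=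
    hW.comp hab (s := Ioi 0) hWpos (fun z hz => Real.hasDerivAt_log (ne_of_gt hz))
      (continuousOn_inv₀.mono fun z hz => ne_of_gt hz)
  have hαg : IntervalIntegrable (fun s => 1 / p * (α + g s)) volume a b :=
    ((intervalIntegrable_const : IntervalIntegrable (fun _ => α) volume a b).add hg).const_mul _
  have hA := of_primitive hαg
  set A : ℝ → ℝ := fun t => ∫ s in a..t, 1 / p * (α + g s) with hAdef
  -- The quantity followed is (Z + δ)^(1/p) exp(A), with integrating factor A(t) = ∫ₐᵗ (α + g)/p,
  -- written as one exponential. Adding δ > 0 keeps the logarithm finite where Z vanishes.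
  have hQ := ((hlog.const_mul (1 / p)).add hA).comp hab (s := univ) (fun _ _ => mem_univ _)
    (fun z _ => Real.hasDerivAt_exp z) Real.continuous_exp.continuousOn
  have hsub : ∀ t ∈ Icc a b, IntervalIntegrable g volume a t := fun t ht =>
    hg.mono_set (by rw [uIcc_of_le ht.1, uIcc_of_le hab]; exact Icc_subset_Icc_right ht.2)
  have hAeq : ∀ t ∈ Icc a b, A t = α / p * (t - a) + 1 / p * ∫ s in a..t, g s := by
    intro t ht
    rw [hAdef]
    simp only
    rw [intervalIntegral.integral_const_mul, intervalIntegral.integral_add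
      intervalIntegrable_const (hsub t ht), intervalIntegral.integral_const, smul_eq_mul]
    ring
  set I := ∫ s in a..b, g s with hI
  have hgt : ∀ t ∈ Icc a b, 1 / p * (∫ s in a..t, g s) ≤ I := by
    intro t ht
    have h1 : 0 ≤ ∫ s in a..t, g s := intervalIntegral.integral_nonneg ht.1 fun s _ => hg0 s
    have h2 : ∫ s in a..t, g s ≤ I := intervalIntegral.integral_mono_interval le_rfl ht.1 ht.2
      (Eventually.of_forall hg0) hg
    have h3 : 1 / p ≤ 1 := by rw [div_le_one hp0]; exact hp.le
    nlinarith
  -- The sign of α is kept, for it will be negative in the estimate of the oscillation; only g is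
  -- bounded by its full integral.
  have hEA : ∀ t ∈ Icc a b, Real.exp (A t) ≤ Real.exp I * Real.exp (α / p * (t - a)) := by
    intro t ht
    rw [← Real.exp_add, Real.exp_le_exp, hAeq t ht]
    linarith [hgt t ht]
  have hEα : ∀ t ∈ Icc a b, Real.exp (α / p * (t - a)) ≤ Real.exp (|α| * (b - a)) := by
    intro t ht
    rw [Real.exp_le_exp]
    have h1 : α / p ≤ |α| := by
      refine (le_abs_self _).trans ?_
      rw [abs_div, abs_of_pos hp0]
      exact div_le_self (abs_nonneg _) hp.le
    calc α / p * (t - a) ≤ |α| * (t - a) := mul_le_mul_of_nonneg_right h1 (by linarith [ht.1])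
      _ ≤ |α| * (b - a) := mul_le_mul_of_nonneg_left (by linarith [ht.2]) (abs_nonneg _)
  have hQeq : ∀ t ∈ Icc a b, Real.exp (1 / p * Real.log (Z t + δ) + A t) =
      Real.exp (A t) * (Z t + δ) ^ (1 / p) := by
    intro t ht
    rw [Real.exp_add, mul_comm, Real.rpow_def_of_pos (hWpos t ht), mul_comm (1 / p)]
  set ψ : ℝ → ℝ := fun s => Real.exp I * (Real.exp (α / p * (s - a)) * φ s +
    Real.exp (|α| * (b - a)) * (δ ^ (1 / p - 1) * (e s + |α| * δ))) with hψ
  have iφ : IntervalIntegrable (fun s => Real.exp (α / p * (s - a)) * φ s) volume a b :=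
    hφ.continuousOn_mul (by fun_prop)
  have ie : IntervalIntegrable (fun s => e s + |α| * δ) volume a b := he.add intervalIntegrable_const
  have iψ : IntervalIntegrable ψ volume a b :=
    (iφ.add ((ie.const_mul _).const_mul _)).const_mul _
  have key : ∀ᵐ s, s ∈ Ioc a b → Real.exp (1 / p * Real.log (Z s + δ) + A s) *
      (1 / p * ((Z s + δ)⁻¹ * h s) + -(1 / p * (α + g s))) ≤ ψ s := by
    filter_upwards [hle] with s hs hsm
    have hsm' : s ∈ Icc a b := Ioc_subset_Icc_self hsm
    have hw := hWpos s hsm'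
    have hz := hZ0 s hsm'
    set w := Z s + δ with hwdef
    rw [hQeq s hsm']
    have b1 : h s ≤ (α + g s) * w + φ s * w ^ (1 - 1 / p) + (e s + |α| * δ) := by
      have h1 := hs hsm
      have h2 : Z s ^ (1 - 1 / p) ≤ w ^ (1 - 1 / p) := Real.rpow_le_rpow hz (by linarith) (by
        rw [sub_nonneg, div_le_one hp0]; exact hp.le)
      have h3 := mul_le_mul_of_nonneg_left h2 (hφ0 s)
      -- Replacing Z by Z + δ is harmless for g ≥ 0, but costs |α| δ when α is negative.
      have h4 : (α + g s) * Z s ≤ (α + g s) * w + |α| * δ := by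
        have e1 : (α + g s) * Z s = (α + g s) * w - α * δ - g s * δ := by rw [hwdef]; ring
        have h5 := neg_abs_le α
        have h6 := mul_nonneg (hg0 s) hδ.le
        nlinarith
      linarith
    have b2 : w⁻¹ * h s - (α + g s) ≤ w⁻¹ * (φ s * w ^ (1 - 1 / p) + (e s + |α| * δ)) := by
      have h1 := mul_le_mul_of_nonneg_left b1 (inv_nonneg.2 hw.le)
      have e1 : w⁻¹ * ((α + g s) * w + φ s * w ^ (1 - 1 / p) + (e s + |α| * δ)) =
          (α + g s) + w⁻¹ * (φ s * w ^ (1 - 1 / p) + (e s + |α| * δ)) := by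
        field_simp; ring
      linarith
    have e2 : w ^ (1 / p) * (w⁻¹ * (φ s * w ^ (1 - 1 / p) + (e s + |α| * δ))) =
        φ s + w ^ (1 / p - 1) * (e s + |α| * δ) := by
      rw [mul_add, mul_add, Real.rpow_sub hw, Real.rpow_sub hw, Real.rpow_one]
      have := (Real.rpow_pos_of_pos hw (1 / p)).ne'
      field_simp
    have hes : 0 ≤ e s + |α| * δ := add_nonneg (he0 s) (by positivity)
    -- The exponent is negative: the error e is divided by a power of Z that may vanish, and δ
    -- bounds this factor.
    have b3 : w ^ (1 / p - 1) ≤ δ ^ (1 / p - 1) :=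
      Real.rpow_le_rpow_of_nonpos hδ (by linarith) (by
        rw [sub_nonpos, div_le_one hp0]; exact hp.le)
    have hw1 : 0 ≤ w ^ (1 / p) := by positivity
    have b4 : w ^ (1 / p) * (w⁻¹ * h s - (α + g s)) ≤ φ s + δ ^ (1 / p - 1) * (e s + |α| * δ) := by
      refine (mul_le_mul_of_nonneg_left b2 hw1).trans ?_
      rw [e2]
      gcongr
    have hr0 : 0 ≤ φ s + δ ^ (1 / p - 1) * (e s + |α| * δ) :=
      add_nonneg (hφ0 s) (mul_nonneg (by positivity) hes)
    have hp1 : 1 / p ≤ 1 := by rw [div_le_one hp0]; exact hp.le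
    have hp1' : 0 ≤ 1 / p := by positivity
    calc Real.exp (A s) * w ^ (1 / p) * (1 / p * (w⁻¹ * h s) + -(1 / p * (α + g s)))
        = 1 / p * (Real.exp (A s) * (w ^ (1 / p) * (w⁻¹ * h s - (α + g s)))) := by ring
      _ ≤ 1 / p * (Real.exp (A s) * (φ s + δ ^ (1 / p - 1) * (e s + |α| * δ))) := by gcongr
      _ ≤ 1 * (Real.exp (A s) * (φ s + δ ^ (1 / p - 1) * (e s + |α| * δ))) := by
          gcongr
      _ ≤ 1 * (Real.exp I * Real.exp (α / p * (s - a)) *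
          (φ s + δ ^ (1 / p - 1) * (e s + |α| * δ))) := by
          gcongr
          exact hEA s hsm'
      _ = Real.exp I * (Real.exp (α / p * (s - a)) * φ s + Real.exp (α / p * (s - a)) *
          (δ ^ (1 / p - 1) * (e s + |α| * δ))) := by ring
      _ ≤ ψ s := by
          have := hEα s hsm'
          have h7 : 0 ≤ δ ^ (1 / p - 1) * (e s + |α| * δ) := mul_nonneg (by positivity) hes
          exact mul_le_mul_of_nonneg_left (add_le_add_right (mul_le_mul_of_nonneg_right this h7) _)
            (Real.exp_pos I).le
  have hfin := hQ.eq a ⟨le_rfl, hab⟩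
  have hint := intervalIntegral.integral_mono_ae_restrict hab hQ.integrable iψ (by
    rw [EventuallyLE, ae_restrict_iff' measurableSet_Icc]
    filter_upwards [key, Measure.ae_ne volume a] with s hs hne hsm
    exact hs ⟨lt_of_le_of_ne hsm.1 (Ne.symm hne), hsm.2⟩)
  rw [hQeq a ⟨le_rfl, hab⟩, hQeq b ⟨hab, le_rfl⟩] at hfin
  have hAa : A a = 0 := by rw [hAdef]; simp
  rw [hAa, Real.exp_zero, one_mul] at hfin
  have eψ : ∫ s in a..b, ψ s = Real.exp I * ((∫ s in a..b, Real.exp (α / p * (s - a)) * φ s) +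
      Real.exp (|α| * (b - a)) * (δ ^ (1 / p - 1) * ((∫ s in a..b, e s) + |α| * δ * (b - a)))) := by
    rw [hψ, intervalIntegral.integral_const_mul, intervalIntegral.integral_add iφ
      ((ie.const_mul _).const_mul _), intervalIntegral.integral_const_mul,
      intervalIntegral.integral_const_mul, intervalIntegral.integral_add he intervalIntegrable_const,
      intervalIntegral.integral_const, smul_eq_mul]
    ring
  have hb1 : Real.exp (A b) * (Z b + δ) ^ (1 / p) ≤
      Real.exp I * Real.exp (α / p * (b - a)) * (Z b + δ) ^ (1 / p) := by
    have := hWpos b ⟨hab, le_rfl⟩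
    have := hEA b ⟨hab, le_rfl⟩
    gcongr
  rw [eψ] at hint
  rw [hfin]
  refine (add_le_add hb1 hint).trans_eq ?_
  ring

end IsBackward

section parametric

variable {μ : Measure ℝ} [SFinite μ]

lemma continuous_integral_param {X : Type*} [TopologicalSpace X] [FirstCountableTopology X]
    [LocallyCompactSpace X] {Φ : X → Torus n → ℝ} (h : Continuous (Function.uncurry Φ)) :
    Continuous fun y => ∫ x, Φ y x := by
  simpa using continuous_parametric_integral_of_continuous (μ := (volume : Measure (Torus n))) h isCompact_univ

lemma integrable_conv_prod {k : Torus n → ℝ} (hk : Continuous k) {g : ℝ → Torus n → ℝ}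
    (hg : Integrable (Function.uncurry g) (μ.prod volume)) :
    Integrable (fun z : ℝ × Torus n => conv k (g z.1) z.2) (μ.prod volume) := by
  have mp : MeasurePreserving (Prod.map (Prod.fst : ℝ × Torus n → ℝ) (id : Torus n → Torus n))
      ((μ.prod volume).prod volume) (μ.prod volume) :=
    measurePreserving_fst.prod (MeasurePreserving.id _)
  have h1 := (mp.integrable_comp hg.aestronglyMeasurable).2 hg
  obtain ⟨C, _, hC⟩ := exists_bound_of_continuous hk
  have h2 := h1.bdd_mul (c := C) (f := fun z : (ℝ × Torus n) × Torus n => k (z.1.2 - z.2))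
    (by fun_prop) (Eventually.of_forall fun z => hC _)
  exact h2.integral_prod_left

lemma aestronglyMeasurable_conv_prod {k : Torus n → ℝ} (hk : Continuous k) {g : ℝ → Torus n → ℝ}
    (hg : Integrable (Function.uncurry g) (μ.prod volume)) :
    AEStronglyMeasurable (fun z : ℝ × Torus n => conv k (g z.1) z.2) (μ.prod volume) :=
  (integrable_conv_prod hk hg).aestronglyMeasurable

end parametric

/-- Differentiation in time of `∫ β (V)`. -/
lemma IsBackward.integral_comp {Ω : Type*} [TopologicalSpace Ω] [CompactSpace Ω]
    [SecondCountableTopology Ω] [MeasurableSpace Ω] [OpensMeasurableSpace Ω] {ν : Measure Ω}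
    [IsFiniteMeasure ν] {V H : ℝ → Ω → ℝ} {a b : ℝ} (hab : a ≤ b)
    (hV : ∀ ω, IsBackward (fun t => V t ω) (fun s => H s ω) a b)
    (hVc : ∀ t ∈ Icc a b, Continuous (V t))
    (hVm : AEStronglyMeasurable (Function.uncurry V) ((volume.restrict (Ioo a b)).prod ν))
    (hH : Integrable (Function.uncurry H) ((volume.restrict (Ioo a b)).prod ν))
    {F β : ℝ → ℝ} {L : ℝ} (hF : Continuous F) (hL : ∀ s, |F s| ≤ L) (hβ : ∀ s, HasDerivAt β (F s) s) :
    IsBackward (fun t => ∫ ω, β (V t ω) ∂ν) (fun s => ∫ ω, F (V s ω) * H s ω ∂ν) a b := by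
  have cβ : Continuous β := continuous_iff_continuousAt.2 fun s => (hβ s).continuousAt
  have hI : Integrable (fun z : ℝ × Ω => F (V z.1 z.2) * H z.1 z.2)
      ((volume.restrict (Ioo a b)).prod ν) :=
    hH.bdd_mul (c := L) (hF.comp_aestronglyMeasurable hVm) (Eventually.of_forall fun z => hL _)
  refine ⟨(intervalIntegrable_iff_integrableOn_Ioo_of_le hab).2 hI.integral_prod_left, fun t ht => ?_⟩
  have hle : (volume.restrict (Ioo t b)).prod ν ≤ (volume.restrict (Ioo a b)).prod ν :=
    Measure.prod_mono (Measure.restrict_mono (Ioo_subset_Ioo_left ht.1) le_rfl) le_rfl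
  have hI' := hI.mono_measure hle
  have h1 : ∀ ω, β (V t ω) - β (V b ω) = ∫ s in Ioo t b, F (V s ω) * H s ω := by
    intro ω
    have := (((hV ω).mono_left ht).comp ht.2 (s := univ) (fun _ _ => mem_univ _) (fun z _ => hβ z)
      hF.continuousOn).eq t ⟨le_rfl, ht.2⟩
    rw [intervalIntegral.integral_of_le ht.2, integral_Ioc_eq_integral_Ioo] at this
    linarith
  have i1 : Integrable (fun ω => β (V t ω)) ν := (cβ.comp (hVc t ht)).integrable_torus
  have i2 : Integrable (fun ω => β (V b ω)) ν :=
    (cβ.comp (hVc b ⟨ht.1.trans ht.2, le_rfl⟩)).integrable_torus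
  rw [intervalIntegral.integral_of_le ht.2, integral_Ioc_eq_integral_Ioo,
    integral_integral_swap (f := fun s ω => F (V s ω) * H s ω) hI']
  simp only [← h1]
  rw [integral_sub i1 i2]
  ring

/-! ### Energy inequalities for the distance to a constant and for the oscillation. -/

/-- Control of a singular potential by the dissipation. -/
def Absorbs (n : ℕ) (q : ℝ≥0∞) (r κ μ C : ℝ) : Prop :=
  ∀ (w : Torus n → ℝ) (D : ℝ), Continuous w → 0 ≤ D → ShiftBound w D →
    ∀ d : Torus n → ℝ, MemLp d q volume → ∫ x, |d x| * w x ^ 2 ≤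
      κ * D + (μ + C * (eLpNorm d q volume).toReal ^ r) * ∫ x, w x ^ 2

section energy

variable {g d f : Torus n → ℝ} {G b : Fin n → Torus n → ℝ} {p κ ε L : ℝ} {F Fc Gp β : ℝ → ℝ}
  {q : ℝ≥0∞} {r μ C : ℝ}

lemma IsProfile.le_integral {Ω : Type*} [TopologicalSpace Ω] [CompactSpace Ω]
    [SecondCountableTopology Ω] [MeasurableSpace Ω] [OpensMeasurableSpace Ω] {ν : Measure Ω}
    [IsFiniteMeasure ν] (hP : IsProfile p κ ε L F Fc Gp β) {u : Ω → ℝ} (hu : Continuous u) :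
    ∫ ω, Gp (u ω) ^ 2 ∂ν ≤ 2 ^ p * ∫ ω, β (u ω) ∂ν := by
  rw [← integral_const_mul]
  exact integral_mono ((hP.contG.comp hu).pow 2).integrable_torus
    ((hP.continuous_primitive.comp hu).integrable_torus.const_mul _) fun ω => hP.sq_le _

lemma IsProfile.integral_le {Ω : Type*} [TopologicalSpace Ω] [CompactSpace Ω]
    [SecondCountableTopology Ω] [MeasurableSpace Ω] [OpensMeasurableSpace Ω] {ν : Measure Ω}
    [IsFiniteMeasure ν] (hP : IsProfile p κ ε L F Fc Gp β) {u : Ω → ℝ} (hu : Continuous u) :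
    ∫ ω, β (u ω) ∂ν ≤ 2 * ∫ ω, Gp (u ω) ^ 2 ∂ν := by
  rw [← integral_const_mul]
  exact integral_mono (hP.continuous_primitive.comp hu).integrable_torus
    (((hP.contG.comp hu).pow 2).integrable_torus.const_mul _) fun ω => hP.le_sq _

lemma two_rpow_mul_rpow {Z : ℝ} (hZ : 0 ≤ Z) (hp : 1 < p) :
    (2 ^ p * Z) ^ (1 - 1 / p) = 2 ^ (p - 1) * Z ^ (1 - 1 / p) := by
  rw [Real.mul_rpow (by positivity) hZ, ← Real.rpow_mul (by norm_num)]
  congr 2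
  have : p ≠ 0 := by linarith
  field_simp

lemma two_mul_two_rpow (p : ℝ) : 2 * (2 : ℝ) ^ (p - 1) = 2 ^ p := by
  rw [Real.rpow_sub (by norm_num), Real.rpow_one]; ring

/-- The energy inequality for the distance to a constant. -/
lemma IsSlice.energy_const_le (hs : IsSlice g G b d) (hP : IsProfile p κ ε L F Fc Gp β)
    (hp : 1 < p) (hκ : 0 < κ) (hε : 0 ≤ ε) (hL : 0 ≤ L) (hq : 1 ≤ q) (hd : MemLp d q volume)
    (hf : MemLp f (ENNReal.ofReal p) volume) (hA : Absorbs n q r (κ / 4) μ C)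
    (hμ : 0 ≤ μ) (hC : 0 ≤ C) (j : ℕ) (c : ℝ) :
    ∫ x, F (conv (kernel n j) g x - c) * velocity j b G f x ≤
      (2 * μ * 2 ^ p + 4 * C * 2 ^ p * (eLpNorm d q volume).toReal ^ r) *
        (∫ x, β (conv (kernel n j) g x - c)) +
      2 ^ p * (eLpNorm f (ENNReal.ofReal p) volume).toReal *
        (∫ x, β (conv (kernel n j) g x - c)) ^ (1 - 1 / p) +
      2 * (ε * (∑ i, ∫ x, G i x ^ 2) + L * ∫ x, |commutator j b G x|) := by
  have h := hs.energy_le hP hp hκ hε hq hd hf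
    (fun w D cw hD hwD => hA w D cw hD hwD d hd) j c
  have hD := hs.dissipation_nonneg hP hκ j c
  have hZ0 : 0 ≤ ∫ x, β (conv (kernel n j) g x - c) := integral_nonneg fun x => hP.nonneg _
  have hQ := hP.le_integral (ν := volume) ((hs.continuous_conv j).sub (continuous_const (y := c)))
  have hX : 0 ≤ (eLpNorm d q volume).toReal ^ r := by positivity
  have hY : 0 ≤ (eLpNorm f (ENNReal.ofReal p) volume).toReal := ENNReal.toReal_nonneg
  rw [two_rpow_mul_rpow hZ0 hp] at h
  set Q := ∫ x, Gp (conv (kernel n j) g x - c) ^ 2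
  set Z := ∫ x, β (conv (kernel n j) g x - c)
  set X := (eLpNorm d q volume).toReal ^ r
  set Y := (eLpNorm f (ENNReal.ofReal p) volume).toReal
  have h2p : (0 : ℝ) < 2 ^ p := by positivity
  have a1 : 2 * (μ + C * X) * Q ≤ 2 * (μ + C * X) * (2 ^ p * Z) :=
    mul_le_mul_of_nonneg_left hQ (by positivity)
  have a2 : 0 ≤ C * X * (2 ^ p * Z) := by positivity
  have a3 : Y * (2 ^ (p - 1) * Z ^ (1 - 1 / p)) ≤ 2 ^ p * Y * Z ^ (1 - 1 / p) := by
    rw [← two_mul_two_rpow p]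
    have : 0 ≤ 2 ^ (p - 1) * (Y * Z ^ (1 - 1 / p)) := by positivity
    linarith
  have a4 : 0 ≤ ε * (∑ i, ∫ x, G i x ^ 2) + L * ∫ x, |commutator j b G x| := by
    have : 0 ≤ ∑ i, ∫ x, G i x ^ 2 := Finset.sum_nonneg fun i _ => integral_nonneg fun x => sq_nonneg _
    have : 0 ≤ ∫ x, |commutator j b G x| := integral_nonneg fun x => abs_nonneg _
    positivity
  have a5 : 0 ≤ κ / 2 * dissipation j κ Fc g G c := by positivity
  linarith

lemma IsSlice.continuous_dissipation (hs : IsSlice g G b d) (hP : IsProfile p κ ε L F Fc Gp β) (j : ℕ) :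
    Continuous fun y => dissipation j κ Fc g G (conv (kernel n j) g y) := by
  unfold dissipation
  refine continuous_const.mul (continuous_integral_param
    (Φ := fun y x => Fc (conv (kernel n j) g x - conv (kernel n j) g y) * laplacian j G x) ?_).neg
  have := hs.continuous_conv j
  have := hs.continuous_laplacian j
  have := hP.contFc
  simp only [Function.uncurry_def]
  fun_prop

/-- The energy inequality for the oscillation. -/
lemma IsSlice.energy_osc_le (hn : 0 < n) (hs : IsSlice g G b d) (hP : IsProfile p κ ε L F Fc Gp β)
    (hp : 1 < p) (hκ : 0 < κ) (hε : 0 ≤ ε) (hq : 1 ≤ q) (hd : MemLp d q volume)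
    (hf : MemLp f (ENNReal.ofReal p) volume) (hA : Absorbs n q r (κ / 4) (κ / (16 * n ^ 2)) C)
    (hC : 0 ≤ C) (j : ℕ) :
    ∫ z : Torus n × Torus n, F (conv (kernel n j) g z.1 - conv (kernel n j) g z.2) *
        (velocity j b G f z.1 - velocity j b G f z.2) ∂(volume.prod volume) ≤
      (-(κ / (8 * n ^ 2)) + 4 * C * 2 ^ p * (eLpNorm d q volume).toReal ^ r) *
        (∫ z : Torus n × Torus n, β (conv (kernel n j) g z.1 - conv (kernel n j) g z.2)
          ∂(volume.prod volume)) +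
      2 ^ p * (eLpNorm f (ENNReal.ofReal p) volume).toReal *
        (∫ z : Torus n × Torus n, β (conv (kernel n j) g z.1 - conv (kernel n j) g z.2)
          ∂(volume.prod volume)) ^ (1 - 1 / p) +
      2 * (ε * (∑ i, ∫ x, G i x ^ 2) + L * ∫ x, |commutator j b G x|) := by
  set u := conv (kernel n j) g with hu
  set H := velocity j b G f with hH
  have cu : Continuous u := hs.continuous_conv j
  have hp1 : (1 : ℝ≥0∞) ≤ ENNReal.ofReal p := by
    rw [← ENNReal.ofReal_one]; exact ENNReal.ofReal_le_ofReal hp.le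
  have cH : Continuous H := hs.continuous_velocity (hf.integrable hp1) j
  have cF := hP.contF
  have cG := hP.contG
  have cβ := hP.continuous_primitive
  have iFH : Integrable (fun z : Torus n × Torus n => F (u z.1 - u z.2) * H z.1)
      ((volume : Measure (Torus n)).prod volume) := Continuous.integrable_torus (by fun_prop)
  have iFH' : Integrable (fun z : Torus n × Torus n => F (u z.1 - u z.2) * H z.2)
      ((volume : Measure (Torus n)).prod volume) := Continuous.integrable_torus (by fun_prop)
  have iβ : Integrable (fun z : Torus n × Torus n => β (u z.1 - u z.2))
      ((volume : Measure (Torus n)).prod volume) := Continuous.integrable_torus (by fun_prop)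
  have iG : Integrable (fun z : Torus n × Torus n => Gp (u z.1 - u z.2) ^ 2)
      ((volume : Measure (Torus n)).prod volume) := Continuous.integrable_torus (by fun_prop)
  -- F is odd, so exchanging the two points shows that both halves of the integrand contribute
  -- equally. For fixed y the inner integral is the one for the constant c = u(y).
  have e1 : ∫ z : Torus n × Torus n, F (u z.1 - u z.2) * (H z.1 - H z.2) ∂(volume.prod volume) =
      2 * ∫ y, ∫ x, F (u x - u y) * H x := by
    simp only [mul_sub]
    rw [integral_sub iFH iFH', integral_prod_symm _ iFH, integral_prod _ iFH']
    have : ∀ x y, F (u x - u y) * H y = -(F (u y - u x) * H y) := fun x y => by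
      rw [← neg_sub (u y), hP.oddF]; ring
    simp only [this, integral_neg]
    ring
  have eβ : ∫ z : Torus n × Torus n, β (u z.1 - u z.2) ∂(volume.prod volume) =
      ∫ y, ∫ x, β (u x - u y) := integral_prod_symm _ iβ
  set D : Torus n → ℝ := fun y => dissipation j κ Fc g G (u y) with hD
  set Q : Torus n → ℝ := fun y => ∫ x, Gp (u x - u y) ^ 2 with hQ
  set Z : Torus n → ℝ := fun y => ∫ x, β (u x - u y) with hZ
  set X := (eLpNorm d q volume).toReal ^ r with hX
  set Y := (eLpNorm f (ENNReal.ofReal p) volume).toReal with hY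
  set E := ε * (∑ i, ∫ x, G i x ^ 2) + L * ∫ x, |commutator j b G x| with hE
  have hX0 : 0 ≤ X := by positivity
  have hY0 : 0 ≤ Y := ENNReal.toReal_nonneg
  have cD : Continuous D := hs.continuous_dissipation hP j
  have cQ : Continuous Q := continuous_integral_param (Φ := fun y x => Gp (u x - u y) ^ 2)
    (by simp only [Function.uncurry_def]; fun_prop)
  have cZ : Continuous Z := continuous_integral_param (Φ := fun y x => β (u x - u y))
    (by simp only [Function.uncurry_def]; fun_prop)
  have cJ : Continuous fun y => ∫ x, F (u x - u y) * H x :=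
    continuous_integral_param (Φ := fun y x => F (u x - u y) * H x)
    (by simp only [Function.uncurry_def]; fun_prop)
  have hZ0 : ∀ y, 0 ≤ Z y := fun y => integral_nonneg fun x => hP.nonneg _
  have hθ : 0 ≤ 1 - 1 / p := by
    rw [sub_nonneg, div_le_one (by linarith)]; exact hp.le
  have cZp : Continuous fun y => (2 ^ p * Z y) ^ (1 - 1 / p) :=
    (continuous_const.mul cZ).rpow_const fun y => Or.inr hθ
  have key : ∫ y, ∫ x, F (u x - u y) * H x ≤
      ∫ y, (-(κ / 2) * D y + 2 * (κ / (16 * n ^ 2) + C * X) * Q y + Y * (2 ^ p * Z y) ^ (1 - 1 / p) + E) := by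
    refine integral_mono cJ.integrable_torus (Continuous.integrable_torus (by fun_prop)) fun y => ?_
    exact hs.energy_le hP hp hκ hε hq hd hf (fun w D cw hD hwD => hA w D cw hD hwD d hd) j (u y)
  have i1 : Integrable (fun y => -(κ / 2) * D y) volume := Continuous.integrable_torus (by fun_prop)
  have i2 : Integrable (fun y => 2 * (κ / (16 * n ^ 2) + C * X) * Q y) volume :=
    Continuous.integrable_torus (by fun_prop)
  have i3 : Integrable (fun y => Y * (2 ^ p * Z y) ^ (1 - 1 / p)) volume :=
    Continuous.integrable_torus (by fun_prop)
  rw [integral_add ((i1.fadd i2).fadd i3) (integrable_const _), integral_add (i1.fadd i2) i3,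
    integral_add i1 i2, integral_const_mul, integral_const_mul, integral_const_mul, integral_const,
    probReal_univ, one_smul] at key
  have hpo : ∫ y, Q y ≤ 2 * n ^ 2 * ∫ y, D y :=
    poincare_antisymm (w := fun x y => Gp (u x - u y)) (by simp only [Function.uncurry_def]; fun_prop)
      (fun x y => by rw [← hP.oddG, neg_sub]) (fun y => hs.shiftBound hP hκ j (u y))
      (fun y => hs.dissipation_nonneg hP hκ j (u y)) cD.integrable_torus
  have hQeq : ∫ y, Q y = ∫ z : Torus n × Torus n, Gp (u z.1 - u z.2) ^ 2 ∂(volume.prod volume) :=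
    (integral_prod_symm _ iG).symm
  have hQ1 := hP.le_integral (ν := (volume : Measure (Torus n)).prod volume)
    (u := fun z : Torus n × Torus n => u z.1 - u z.2) (by fun_prop)
  have hQ2 := hP.integral_le (ν := (volume : Measure (Torus n)).prod volume)
    (u := fun z : Torus n × Torus n => u z.1 - u z.2) (by fun_prop)
  rw [← hQeq, eβ] at hQ1 hQ2
  -- Jensen's inequality for a concave power turns the source terms for the individual y into a
  -- power of the full oscillation.
  have hjen : ∫ y, (2 ^ p * Z y) ^ (1 - 1 / p) ≤ (2 ^ p * ∫ y, Z y) ^ (1 - 1 / p) := by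
    rw [← integral_const_mul]
    refine ConcaveOn.le_map_integral (g := fun s : ℝ => s ^ (1 - 1 / p)) (s := Ici 0)
      (Real.concaveOn_rpow hθ (by linarith [one_div_pos.2 (show 0 < p by linarith)])) ?_ isClosed_Ici
      (Eventually.of_forall fun y => ?_) ?_ ?_
    · exact (Real.continuous_rpow_const hθ).continuousOn
    · exact mul_nonneg (by positivity) (hZ0 y)
    · exact (continuous_const.mul cZ).integrable_torus
    · exact cZp.integrable_torus
  have hU0 : 0 ≤ ∫ y, Z y := integral_nonneg hZ0
  rw [two_rpow_mul_rpow hU0 hp] at hjen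
  rw [e1, eβ]
  have hn2 : (0 : ℝ) < n ^ 2 := by positivity
  set DD := ∫ y, D y
  set QQ := ∫ y, Q y
  set U := ∫ y, Z y
  -- The doubled inequality contains -κ DD, at most -κ/(2n²) QQ by Poincaré, and the absorption term
  -- 4 · κ/(16n²) QQ. Their sum is -κ/(4n²) QQ, and U ≤ 2 QQ turns it into the decay rate κ/(8n²).
  have b1 : κ / (2 * n ^ 2) * QQ ≤ κ * DD := by
    calc κ / (2 * n ^ 2) * QQ ≤ κ / (2 * n ^ 2) * (2 * n ^ 2 * DD) := by gcongr
      _ = κ * DD := by field_simp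
  have b2 : κ / (4 * n ^ 2) * U ≤ κ / (4 * n ^ 2) * (2 * QQ) := by gcongr
  have b3 : 4 * (C * X) * QQ ≤ 4 * (C * X) * (2 ^ p * U) := by gcongr
  have b4 : Y * (∫ y, (2 ^ p * Z y) ^ (1 - 1 / p)) ≤ Y * (2 ^ (p - 1) * U ^ (1 - 1 / p)) := by gcongr
  have b5 : κ / (2 * n ^ 2) = 2 * (κ / (4 * n ^ 2)) := by field_simp; norm_num
  have b6 : κ / (16 * n ^ 2) = (κ / (4 * n ^ 2)) / 4 := by field_simp; norm_num
  have b7 : κ / (8 * n ^ 2) = (κ / (4 * n ^ 2)) / 2 := by field_simp; norm_num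
  rw [b6] at key
  rw [b5] at b1
  rw [b7, ← two_mul_two_rpow p] at *
  nlinarith

end energy

/-! ### The commutator. -/

lemma integral_abs_eq {X : Type*} [MeasurableSpace X] {μ : Measure X} {g : X → ℝ}
    (hg : AEStronglyMeasurable g μ) : ∫ x, |g x| ∂μ = (eLpNorm g 1 μ).toReal := by
  rw [eLpNorm_one_eq_lintegral_enorm]
  exact integral_norm_eq_lintegral_enorm hg

lemma tendsto_integral_abs_conv_kernel_sub {g : Torus n → ℝ} (hg : Integrable g volume) :
    Tendsto (fun j => ∫ x, |conv (kernel n j) g x - g x|) atTop (𝓝 0) := by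
  have h := tendsto_eLpNorm_conv_kernel_sub (memLp_one_iff_integrable.2 hg) le_rfl ENNReal.one_ne_top
  have h' := (ENNReal.tendsto_toReal ENNReal.zero_ne_top).comp h
  simp only [ENNReal.toReal_zero] at h'
  refine h'.congr fun j => ?_
  exact (integral_abs_eq ((continuous_conv (continuous_kernel j) hg).aestronglyMeasurable.sub hg.1)).symm

lemma integral_abs_conv_kernel_le {g : Torus n → ℝ} (hg : Integrable g volume) (j : ℕ) :
    ∫ x, |conv (kernel n j) g x| ≤ ∫ x, |g x| := by
  rw [integral_abs_eq (continuous_conv (continuous_kernel j) hg).aestronglyMeasurable,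
    integral_abs_eq hg.1]
  exact ENNReal.toReal_mono (memLp_one_iff_integrable.2 hg).2.ne
    (eLpNorm_conv_kernel_le j hg.1 le_rfl ENNReal.one_ne_top)

lemma integral_abs_mul_le {X : Type*} [MeasurableSpace X] {μ : Measure X} {f g : X → ℝ}
    (hf : MemLp f 2 μ) (hg : MemLp g 2 μ) :
    ∫ x, |f x * g x| ∂μ ≤ (∫ x, f x ^ 2 ∂μ + ∫ x, g x ^ 2 ∂μ) / 2 := by
  rw [← integral_add hf.integrable_sq hg.integrable_sq, ← integral_div]
  refine integral_mono (hf.integrable_mul hg).abs ((hf.integrable_sq.add hg.integrable_sq).div_const 2)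
    fun x => ?_
  simp only [abs_mul]
  nlinarith [sq_nonneg (|f x| - |g x|), sq_abs (f x), sq_abs (g x)]

lemma integral_abs_mul_le_sqrt {X : Type*} [MeasurableSpace X] {μ : Measure X} {f g : X → ℝ}
    (hf : MemLp f 2 μ) (hg : MemLp g 2 μ) :
    ∫ x, |f x * g x| ∂μ ≤ (eLpNorm f 2 μ).toReal * (eLpNorm g 2 μ).toReal := by
  have e : (2 : ℝ≥0∞) = ENNReal.ofReal 2 := by simp
  have h := integral_mul_norm_le_Lp_mul_Lq (f := f) (g := g) (μ := μ) Real.HolderConjugate.two_two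
    (e ▸ hf) (e ▸ hg)
  simp only [Real.norm_eq_abs] at h
  rw [integral_abs_rpow two_pos (e ▸ hf), integral_abs_rpow two_pos (e ▸ hg), ← e,
    ← Real.rpow_mul ENNReal.toReal_nonneg, ← Real.rpow_mul ENNReal.toReal_nonneg,
    mul_one_div_cancel two_ne_zero, Real.rpow_one, Real.rpow_one] at h
  simpa only [abs_mul] using h

section slice

variable {g d f : Torus n → ℝ} {G b : Fin n → Torus n → ℝ}

lemma IsSlice.memLp_conv_grad (hs : IsSlice g G b d) (j : ℕ) (i : Fin n) :
    MemLp (conv (kernel n j) (G i)) 2 volume :=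
  memLp_conv_kernel (hs.memG i) (by norm_num) (by norm_num) j

/-- A bound that does not depend on j: it is the dominating function for the limit in time. -/
lemma IsSlice.integral_abs_commutator_le (hs : IsSlice g G b d) (j : ℕ) :
    ∫ x, |commutator j b G x| ≤ ∑ i, ((∫ x, b i x ^ 2) + ∫ x, G i x ^ 2) := by
  have i0 : ∀ i, Integrable (fun x => |b i x * G i x|) volume := fun i =>
    ((hs.memB i).integrable_mul (hs.memG i)).abs
  have i1 : ∀ i, Integrable (fun x => |b i x * conv (kernel n j) (G i) x|) volume := fun i =>
    ((hs.memB i).integrable_mul (hs.memLp_conv_grad j i)).abs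
  have it := hs.integrable_transport
  have h1 : ∫ x, |conv (kernel n j) (transport b G) x| ≤
      ∑ i, ((∫ x, b i x ^ 2) + ∫ x, G i x ^ 2) / 2 := by
    refine (integral_abs_conv_kernel_le it j).trans ?_
    calc ∫ x, |transport b G x| ≤ ∫ x, ∑ i, |b i x * G i x| :=
          integral_mono it.abs (integrable_finsetSum _ fun i _ => i0 i) fun x =>
            Finset.abs_sum_le_sum_abs _ _
      _ = ∑ i, ∫ x, |b i x * G i x| := integral_finsetSum _ fun i _ => i0 i
      _ ≤ _ := Finset.sum_le_sum fun i _ => integral_abs_mul_le (hs.memB i) (hs.memG i)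
  have h2 : ∑ i, ∫ x, |b i x * conv (kernel n j) (G i) x| ≤
      ∑ i, ((∫ x, b i x ^ 2) + ∫ x, G i x ^ 2) / 2 := by
    refine Finset.sum_le_sum fun i _ => (integral_abs_mul_le (hs.memB i) (hs.memLp_conv_grad j i)).trans ?_
    have := integral_conv_kernel_sq_le (hs.memG i) j
    linarith
  have ic : Integrable (fun x => |conv (kernel n j) (transport b G) x|) volume :=
    (DriftDiffusion.continuous_conv (continuous_kernel j) it).abs.integrable_torus
  have is : Integrable (fun x => ∑ i, |b i x * conv (kernel n j) (G i) x|) volume :=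
    integrable_finsetSum _ fun i _ => i1 i
  have h3 : ∫ x, |commutator j b G x| ≤ (∫ x, |conv (kernel n j) (transport b G) x|) +
      ∑ i, ∫ x, |b i x * conv (kernel n j) (G i) x| := by
    rw [← integral_finsetSum _ fun i _ => i1 i, ← integral_add ic is]
    refine integral_mono (hs.integrable_commutator j).abs (ic.add is) fun x => ?_
    exact (abs_sub _ _).trans (add_le_add_right (Finset.abs_sum_le_sum_abs _ _) _)
  have h4 : ∑ i, ((∫ x, b i x ^ 2) + ∫ x, G i x ^ 2) =
      ∑ i, ((∫ x, b i x ^ 2) + ∫ x, G i x ^ 2) / 2 + ∑ i, ((∫ x, b i x ^ 2) + ∫ x, G i x ^ 2) / 2 := by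
    rw [← Finset.sum_add_distrib]
    exact Finset.sum_congr rfl fun i _ => by ring
  linarith

/-- Adding and subtracting b · G leaves two convolution errors, that of b · G in L¹ and that of G in
L² multiplied by b. As G is square integrable, no derivative of b is involved. -/
lemma IsSlice.tendsto_commutator (hs : IsSlice g G b d) :
    Tendsto (fun j => ∫ x, |commutator j b G x|) atTop (𝓝 0) := by
  have it := hs.integrable_transport
  have m : ∀ j i, MemLp (fun x => conv (kernel n j) (G i) x - G i x) 2 volume := fun j i =>
    (hs.memLp_conv_grad j i).sub (hs.memG i)
  have l1 := tendsto_integral_abs_conv_kernel_sub it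
  have l2 : Tendsto (fun j => ∑ i, (eLpNorm (b i) 2 volume).toReal *
      (eLpNorm (fun x => conv (kernel n j) (G i) x - G i x) 2 volume).toReal) atTop (𝓝 0) := by
    have : ∀ i, Tendsto (fun j => (eLpNorm (b i) 2 volume).toReal *
        (eLpNorm (fun x => conv (kernel n j) (G i) x - G i x) 2 volume).toReal) atTop (𝓝 0) := by
      intro i
      have := ((ENNReal.tendsto_toReal ENNReal.zero_ne_top).comp
        (tendsto_eLpNorm_conv_kernel_sub (hs.memG i) (by norm_num) (by norm_num))).const_mul
        (eLpNorm (b i) 2 volume).toReal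
      simpa using this
    simpa using tendsto_finsetSum Finset.univ fun i _ => this i
  refine squeeze_zero (fun j => integral_nonneg fun x => abs_nonneg _) (fun j => ?_)
    (by simpa using l1.add l2)
  have i1 : ∀ i, Integrable (fun x => |b i x * (conv (kernel n j) (G i) x - G i x)|) volume := fun i =>
    ((hs.memB i).integrable_mul (m j i)).abs
  have ic : Integrable (fun x => |conv (kernel n j) (transport b G) x - transport b G x|) volume :=
    ((DriftDiffusion.continuous_conv (continuous_kernel j) it).integrable_torus.sub it).abs
  have is : Integrable (fun x => ∑ i, |b i x * (conv (kernel n j) (G i) x - G i x)|) volume :=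
    integrable_finsetSum _ fun i _ => i1 i
  refine le_trans ?_ (add_le_add_right (Finset.sum_le_sum fun i _ =>
    integral_abs_mul_le_sqrt (hs.memB i) (m j i)) _)
  rw [← integral_finsetSum _ fun i _ => i1 i, ← integral_add ic is]
  refine integral_mono (hs.integrable_commutator j).abs (ic.add is) fun x => ?_
  have e : commutator j b G x = (conv (kernel n j) (transport b G) x - transport b G x) -
      ∑ i, b i x * (conv (kernel n j) (G i) x - G i x) := by
    simp only [commutator, transport, mul_sub, Finset.sum_sub_distrib]
    ring
  simp only
  rw [e]
  exact (abs_sub _ _).trans (add_le_add_right (Finset.abs_sum_le_sum_abs _ _) _)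

end slice

/-! ### The evolution on a compact time interval. -/

/-- The solution on a compact time interval, in the form in which it is used. -/
structure IsEvolution (a b : ℝ) (v : ℝ → Torus n → ℝ) (G B : ℝ → Fin n → Torus n → ℝ)
    (d f : ℝ → Torus n → ℝ) : Prop where
  le : a ≤ b
  integrable : Integrable (Function.uncurry v) ((volume.restrict (Ioo a b)).prod volume)
  memG : ∀ i, MemLp (fun z : ℝ × Torus n => G z.1 i z.2) 2 ((volume.restrict (Ioo a b)).prod volume)
  memB : ∀ i, MemLp (fun z : ℝ × Torus n => B z.1 i z.2) 2 ((volume.restrict (Ioo a b)).prod volume)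
  integrable_source : Integrable (Function.uncurry f) ((volume.restrict (Ioo a b)).prod volume)
  slice : ∀ᵐ s ∂(volume.restrict (Ioo a b)), IsSlice (v s) (G s) (B s) (d s)
  integrable_at : ∀ t ∈ Icc a b, Integrable (v t) volume
  equation : ∀ j x, IsBackward (fun t => conv (kernel n j) (v t) x)
    (fun s => velocity j (B s) (G s) (f s) x) a b

lemma ae_Ioc_of_ae_restrict {P : ℝ → Prop} {a b : ℝ} (h : ∀ᵐ s ∂(volume.restrict (Ioo a b)), P s) :
    ∀ᵐ s, s ∈ Ioc a b → P s := by
  rw [← ae_restrict_iff' measurableSet_Ioc, ← Measure.restrict_congr_set Ioo_ae_eq_Ioc]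
  exact h

lemma integrable_prod_fst {μ : Measure ℝ} [SFinite μ] {w : ℝ × Torus n → ℝ}
    (hw : Integrable w (μ.prod volume)) :
    Integrable (fun z : ℝ × (Torus n × Torus n) => w (z.1, z.2.1)) (μ.prod (volume.prod volume)) := by
  have mp : MeasurePreserving (Prod.map (id : ℝ → ℝ) (Prod.fst : Torus n × Torus n → Torus n))
      (μ.prod (volume.prod volume)) (μ.prod volume) :=
    (MeasurePreserving.id _).prod measurePreserving_fst
  exact (mp.integrable_comp hw.aestronglyMeasurable).2 hw

lemma integrable_prod_snd {μ : Measure ℝ} [SFinite μ] {w : ℝ × Torus n → ℝ}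
    (hw : Integrable w (μ.prod volume)) :
    Integrable (fun z : ℝ × (Torus n × Torus n) => w (z.1, z.2.2)) (μ.prod (volume.prod volume)) := by
  have mp : MeasurePreserving (Prod.map (id : ℝ → ℝ) (Prod.snd : Torus n × Torus n → Torus n))
      (μ.prod (volume.prod volume)) (μ.prod volume) :=
    (MeasurePreserving.id _).prod measurePreserving_snd
  exact (mp.integrable_comp hw.aestronglyMeasurable).2 hw

namespace IsEvolution

variable {a b : ℝ} {v d f : ℝ → Torus n → ℝ} {G B : ℝ → Fin n → Torus n → ℝ}

lemma integrable_transport (h : IsEvolution a b v G B d f) :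
    Integrable (Function.uncurry fun s => transport (B s) (G s))
      ((volume.restrict (Ioo a b)).prod volume) :=
  integrable_finsetSum (f := fun i (z : ℝ × Torus n) => B z.1 i z.2 * G z.1 i z.2) Finset.univ
    fun i _ => (h.memB i).integrable_mul (h.memG i)

lemma integrable_velocity (h : IsEvolution a b v G B d f) (j : ℕ) :
    Integrable (fun z : ℝ × Torus n => velocity j (B z.1) (G z.1) (f z.1) z.2)
      ((volume.restrict (Ioo a b)).prod volume) := by
  refine Integrable.add (Integrable.add ?_ ?_) ?_
  · exact integrable_finsetSum _ fun i _ => integrable_conv_prod (continuous_dkernel j i)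
      (g := fun s => G s i) ((h.memG i).integrable (by norm_num))
  · exact integrable_conv_prod (continuous_kernel j) h.integrable_transport
  · exact integrable_conv_prod (continuous_kernel j) h.integrable_source

lemma aestronglyMeasurable_commutator (h : IsEvolution a b v G B d f) (j : ℕ) :
    AEStronglyMeasurable (fun z : ℝ × Torus n => commutator j (B z.1) (G z.1) z.2)
      ((volume.restrict (Ioo a b)).prod volume) := by
  refine AEStronglyMeasurable.sub
    (aestronglyMeasurable_conv_prod (continuous_kernel j) h.integrable_transport) ?_
  refine Finset.aestronglyMeasurable_fun_sum _ fun i _ => (h.memB i).1.mul ?_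
  exact aestronglyMeasurable_conv_prod (continuous_kernel j) (g := fun s => G s i)
    ((h.memG i).integrable (by norm_num))

lemma integrable_sum_sq_aux {K : ℝ → Fin n → Torus n → ℝ}
    (hK : ∀ i, MemLp (fun z : ℝ × Torus n => K z.1 i z.2) 2 ((volume.restrict (Ioo a b)).prod volume)) :
    Integrable (fun s => ∑ i, ∫ x, K s i x ^ 2) (volume.restrict (Ioo a b)) :=
  integrable_finsetSum _ fun i _ => (hK i).integrable_sq.integral_prod_left

lemma integrable_commutator (h : IsEvolution a b v G B d f) (j : ℕ) :
    Integrable (fun s => ∫ x, |commutator j (B s) (G s) x|) (volume.restrict (Ioo a b)) := by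
  refine ((integrable_sum_sq_aux h.memB).add (integrable_sum_sq_aux h.memG)).mono'
    (h.aestronglyMeasurable_commutator j).norm.integral_prod_right' ?_
  filter_upwards [h.slice] with s hs
  rw [Real.norm_of_nonneg (integral_nonneg fun x => abs_nonneg _)]
  refine (hs.integral_abs_commutator_le j).trans_eq ?_
  rw [Finset.sum_add_distrib]; rfl

lemma tendsto_integral_commutator (h : IsEvolution a b v G B d f) :
    Tendsto (fun j => ∫ s in Ioo a b, ∫ x, |commutator j (B s) (G s) x|) atTop (𝓝 0) := by
  have := tendsto_integral_of_dominated_convergence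
    (F := fun j s => ∫ x, |commutator j (B s) (G s) x|) (f := fun _ => (0 : ℝ))
    (μ := volume.restrict (Ioo a b))
    (fun s => (∑ i, ∫ x, B s i x ^ 2) + ∑ i, ∫ x, G s i x ^ 2)
    (fun j => (h.integrable_commutator j).aestronglyMeasurable)
    ((integrable_sum_sq_aux h.memB).add (integrable_sum_sq_aux h.memG)) (fun j => ?_) ?_
  · simpa using this
  · filter_upwards [h.slice] with s hs
    rw [Real.norm_of_nonneg (integral_nonneg fun x => abs_nonneg _)]
    refine (hs.integral_abs_commutator_le j).trans_eq ?_
    rw [Finset.sum_add_distrib]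
  · filter_upwards [h.slice] with s hs using hs.tendsto_commutator

variable {p κ ε L : ℝ} {F Fc Gp β : ℝ → ℝ}

lemma isBackward_const (h : IsEvolution a b v G B d f) (hP : IsProfile p κ ε L F Fc Gp β) (j : ℕ) (c : ℝ) :
    IsBackward (fun t => ∫ x, β (conv (kernel n j) (v t) x - c))
      (fun s => ∫ x, F (conv (kernel n j) (v s) x - c) * velocity j (B s) (G s) (f s) x) a b := by
  refine IsBackward.integral_comp (V := fun t x => conv (kernel n j) (v t) x - c)
    (H := fun s x => velocity j (B s) (G s) (f s) x) h.le (fun x => ?_) (fun t ht => ?_) ?_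
    (h.integrable_velocity j) hP.contF hP.bound hP.deriv
  · simpa [sub_eq_add_neg] using (h.equation j x).add_const (-c)
  · exact (continuous_conv (continuous_kernel j) (h.integrable_at t ht)).sub continuous_const
  · exact (aestronglyMeasurable_conv_prod (continuous_kernel j) h.integrable).sub
      aestronglyMeasurable_const

lemma isBackward_osc (h : IsEvolution a b v G B d f) (hP : IsProfile p κ ε L F Fc Gp β) (j : ℕ) :
    IsBackward (fun t => ∫ z : Torus n × Torus n,
        β (conv (kernel n j) (v t) z.1 - conv (kernel n j) (v t) z.2) ∂(volume.prod volume))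
      (fun s => ∫ z : Torus n × Torus n, F (conv (kernel n j) (v s) z.1 - conv (kernel n j) (v s) z.2) *
        (velocity j (B s) (G s) (f s) z.1 - velocity j (B s) (G s) (f s) z.2) ∂(volume.prod volume))
      a b := by
  have hu := integrable_conv_prod (continuous_kernel j) h.integrable
  have hH := h.integrable_velocity j
  refine IsBackward.integral_comp
    (V := fun t (z : Torus n × Torus n) => conv (kernel n j) (v t) z.1 - conv (kernel n j) (v t) z.2)
    (H := fun s (z : Torus n × Torus n) =>
      velocity j (B s) (G s) (f s) z.1 - velocity j (B s) (G s) (f s) z.2)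
    h.le (fun z => (h.equation j z.1).sub (h.equation j z.2)) (fun t ht => ?_) ?_ ?_
    hP.contF hP.bound hP.deriv
  · have := continuous_conv (continuous_kernel (n := n) j) (h.integrable_at t ht)
    fun_prop
  · exact (integrable_prod_fst hu).1.sub (integrable_prod_snd hu).1
  · exact (integrable_prod_fst hH).sub (integrable_prod_snd hH)

end IsEvolution

section limits

variable {p κ ε L : ℝ} {F Fc Gp β : ℝ → ℝ}

/-- Since F is bounded, its primitive is Lipschitz, and L¹ convergence suffices to pass to the limit
in ∫ β. -/
lemma IsProfile.abs_sub_le (hP : IsProfile p κ ε L F Fc Gp β) (s t : ℝ) : |β s - β t| ≤ L * |s - t| := by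
  have := convex_univ.norm_image_sub_le_of_norm_hasDerivWithin_le (f := β) (f' := F) (C := L)
    (fun z _ => (hP.deriv z).hasDerivWithinAt) (fun z _ => hP.bound z) (mem_univ t) (mem_univ s)
  simpa using this

lemma IsProfile.integrable_comp {Ω : Type*} [MeasurableSpace Ω] {ν : Measure Ω} [IsFiniteMeasure ν]
    (hP : IsProfile p κ ε L F Fc Gp β) {g : Ω → ℝ} (hg : Integrable g ν) :
    Integrable (fun x => β (g x)) ν := by
  refine ((integrable_const |β 0|).add (hg.abs.const_mul L)).mono'
    (hP.continuous_primitive.comp_aestronglyMeasurable hg.1) (Eventually.of_forall fun x => ?_)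
  have h1 := hP.abs_sub_le (g x) 0
  rw [sub_zero] at h1
  have h2 := abs_sub_abs_le_abs_sub (β (g x)) (β 0)
  simp only [Pi.add_apply, Real.norm_eq_abs]
  linarith

lemma IsProfile.tendsto_integral {Ω : Type*} [MeasurableSpace Ω] {ν : Measure Ω} [IsFiniteMeasure ν]
    (hP : IsProfile p κ ε L F Fc Gp β) {g : Ω → ℝ} {u : ℕ → Ω → ℝ} (hg : Integrable g ν)
    (hu : ∀ j, Integrable (u j) ν) (h : Tendsto (fun j => ∫ x, |u j x - g x| ∂ν) atTop (𝓝 0)) :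
    Tendsto (fun j => ∫ x, β (u j x) ∂ν) atTop (𝓝 (∫ x, β (g x) ∂ν)) := by
  rw [tendsto_iff_norm_sub_tendsto_zero]
  refine squeeze_zero (fun j => norm_nonneg _) (fun j => ?_) (by simpa using h.const_mul L)
  rw [← integral_sub (hP.integrable_comp (hu j)) (hP.integrable_comp hg), ← integral_const_mul]
  exact abs_integral_le_of_abs_le (((hu j).sub hg).abs.const_mul L) fun x => hP.abs_sub_le _ _

lemma IsProfile.tendsto_integral_const (hP : IsProfile p κ ε L F Fc Gp β) {g : Torus n → ℝ}
    (hg : Integrable g volume) (c : ℝ) :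
    Tendsto (fun j => ∫ x, β (conv (kernel n j) g x - c)) atTop (𝓝 (∫ x, β (g x - c))) := by
  refine hP.tendsto_integral (u := fun j x => conv (kernel n j) g x - c) (hg.sub (integrable_const c))
    (fun j => (continuous_conv (continuous_kernel j) hg).integrable_torus.sub (integrable_const c)) ?_
  simpa using tendsto_integral_abs_conv_kernel_sub hg

lemma IsProfile.tendsto_integral_osc (hP : IsProfile p κ ε L F Fc Gp β) {g : Torus n → ℝ}
    (hg : Integrable g volume) :
    Tendsto (fun j => ∫ z : Torus n × Torus n,
      β (conv (kernel n j) g z.1 - conv (kernel n j) g z.2) ∂(volume.prod volume)) atTop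
      (𝓝 (∫ z : Torus n × Torus n, β (g z.1 - g z.2) ∂(volume.prod volume))) := by
  have hi : ∀ {w : Torus n → ℝ}, Integrable w volume → Integrable
      (fun z : Torus n × Torus n => w z.1) ((volume : Measure (Torus n)).prod volume) :=
    fun hw => hw.comp_fst _
  have hi' : ∀ {w : Torus n → ℝ}, Integrable w volume → Integrable
      (fun z : Torus n × Torus n => w z.2) ((volume : Measure (Torus n)).prod volume) :=
    fun hw => hw.comp_snd _
  have hc : ∀ j, Integrable (conv (kernel n j) g) volume := fun j =>
    (continuous_conv (continuous_kernel j) hg).integrable_torus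
  refine hP.tendsto_integral
    (u := fun j (z : Torus n × Torus n) => conv (kernel n j) g z.1 - conv (kernel n j) g z.2)
    ((hi hg).sub (hi' hg)) (fun j => (hi (hc j)).sub (hi' (hc j))) ?_
  have l := tendsto_integral_abs_conv_kernel_sub hg
  refine squeeze_zero (fun j => integral_nonneg fun z => abs_nonneg _) (fun j => ?_)
    (by simpa using l.add l)
  have e : ∀ j, Integrable (fun x => |conv (kernel n j) g x - g x|) volume := fun j =>
    ((hc j).sub hg).abs
  have e1 : ∫ z : Torus n × Torus n, |conv (kernel n j) g z.1 - g z.1| ∂(volume.prod volume) =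
      ∫ x, |conv (kernel n j) g x - g x| := by
    rw [integral_prod _ (hi (e j))]; simp
  have e2 : ∫ z : Torus n × Torus n, |conv (kernel n j) g z.2 - g z.2| ∂(volume.prod volume) =
      ∫ x, |conv (kernel n j) g x - g x| := by
    rw [integral_prod _ (hi' (e j))]; simp
  nth_rw 1 [← e1]
  rw [← e2, ← integral_add (hi (e j)) (hi' (e j))]
  refine integral_mono (((hi (hc j)).sub (hi' (hc j))).sub ((hi hg).sub (hi' hg))).abs
    ((hi (e j)).add (hi' (e j))) fun z => ?_
  simp only
  rw [show conv (kernel n j) g z.1 - conv (kernel n j) g z.2 - (g z.1 - g z.2) =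
    (conv (kernel n j) g z.1 - g z.1) - (conv (kernel n j) g z.2 - g z.2) by ring]
  exact abs_sub _ _

end limits

/-- The Grönwall bound involves Z only at the two ends and the error only through its integral, so
nothing more has to converge. -/
lemma IsBackward.gronwall_limit {Z h e : ℕ → ℝ → ℝ} {a b za zb η : ℝ}
    (hZ : ∀ j, IsBackward (Z j) (h j) a b) (hab : a ≤ b) {p α δ : ℝ} (hp : 1 < p) (hδ : 0 < δ)
    {g φ : ℝ → ℝ} (hZ0 : ∀ j, ∀ t ∈ Icc a b, 0 ≤ Z j t)
    (hg : IntervalIntegrable g volume a b) (hφ : IntervalIntegrable φ volume a b)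
    (he : ∀ j, IntervalIntegrable (e j) volume a b) (hg0 : ∀ s, 0 ≤ g s) (hφ0 : ∀ s, 0 ≤ φ s)
    (he0 : ∀ j s, 0 ≤ e j s)
    (hle : ∀ j, ∀ᵐ s, s ∈ Ioc a b → h j s ≤ (α + g s) * Z j s + φ s * Z j s ^ (1 - 1 / p) + e j s)
    (la : Tendsto (fun j => Z j a) atTop (𝓝 za)) (lb : Tendsto (fun j => Z j b) atTop (𝓝 zb))
    (le : Tendsto (fun j => ∫ s in a..b, e j s) atTop (𝓝 η)) :
    (za + δ) ^ (1 / p) ≤ Real.exp (∫ s in a..b, g s) *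
      (Real.exp (α / p * (b - a)) * (zb + δ) ^ (1 / p) +
        (∫ s in a..b, Real.exp (α / p * (s - a)) * φ s) +
        Real.exp (|α| * (b - a)) * (δ ^ (1 / p - 1) * (η + |α| * δ * (b - a)))) := by
  have h0 : 0 ≤ 1 / p := by have : 0 < p := by linarith
                            positivity
  refine le_of_tendsto_of_tendsto' ((la.add_const δ).rpow_const (Or.inr h0)) ?_ fun j =>
    (hZ j).gronwall hab hp hδ (hZ0 j) hg hφ (he j) hg0 hφ0 (he0 j) (hle j)
  refine Tendsto.const_mul _ (Tendsto.add (Tendsto.add ?_ tendsto_const_nhds) ?_)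
  · exact ((lb.add_const δ).rpow_const (Or.inr h0)).const_mul _
  · exact ((le.add_const _).const_mul _).const_mul _

/-- The integrability in time of the norms of the divergence and of the source. -/
structure HasMixedNorms (a b : ℝ) (q : ℝ≥0∞) (r p : ℝ) (d f : ℝ → Torus n → ℝ) : Prop where
  memLp_div : ∀ᵐ s ∂(volume.restrict (Ioo a b)), MemLp (d s) q volume
  memLp_source : ∀ᵐ s ∂(volume.restrict (Ioo a b)), MemLp (f s) (ENNReal.ofReal p) volume
  integrable_div : IntegrableOn (fun s => (eLpNorm (d s) q volume).toReal ^ r) (Ioo a b)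
  integrable_source : IntegrableOn (fun s => (eLpNorm (f s) (ENNReal.ofReal p) volume).toReal) (Ioo a b)

namespace IsEvolution

variable {a b : ℝ} {v d f : ℝ → Torus n → ℝ} {G B : ℝ → Fin n → Torus n → ℝ}
  {p κ ε L : ℝ} {F Fc Gp β : ℝ → ℝ} {q : ℝ≥0∞} {r C : ℝ}

/-- The error in the energy inequalities. -/
def defect (ε L : ℝ) (G B : ℝ → Fin n → Torus n → ℝ) (j : ℕ) (s : ℝ) : ℝ :=
  2 * (ε * (∑ i, ∫ x, G s i x ^ 2) + L * ∫ x, |commutator j (B s) (G s) x|)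

lemma defect_nonneg (hε : 0 ≤ ε) (hL : 0 ≤ L) (j : ℕ) (s : ℝ) : 0 ≤ defect ε L G B j s := by
  have : 0 ≤ ∑ i, ∫ x, G s i x ^ 2 := Finset.sum_nonneg fun i _ => integral_nonneg fun x => sq_nonneg _
  have : 0 ≤ ∫ x, |commutator j (B s) (G s) x| := integral_nonneg fun x => abs_nonneg _
  unfold defect
  positivity

lemma integrable_defect (h : IsEvolution a b v G B d f) (j : ℕ) :
    IntervalIntegrable (defect ε L G B j) volume a b :=
  (intervalIntegrable_iff_integrableOn_Ioo_of_le h.le).2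
    ((((integrable_sum_sq_aux h.memG).const_mul ε).add
      ((h.integrable_commutator j).const_mul L)).const_mul 2)

/-- The commutator part vanishes with the kernel; the ε part survives until the level l tends to
infinity. -/
lemma tendsto_integral_defect (h : IsEvolution a b v G B d f) :
    Tendsto (fun j => ∫ s in a..b, defect ε L G B j s) atTop
      (𝓝 (2 * (ε * ∫ s in Ioo a b, ∑ i, ∫ x, G s i x ^ 2))) := by
  have e : ∀ j, ∫ s in a..b, defect ε L G B j s = 2 * (ε * (∫ s in Ioo a b, ∑ i, ∫ x, G s i x ^ 2) +
      L * ∫ s in Ioo a b, ∫ x, |commutator j (B s) (G s) x|) := by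
    intro j
    rw [intervalIntegral.integral_of_le h.le, integral_Ioc_eq_integral_Ioo]
    unfold defect
    rw [integral_const_mul, integral_add ((integrable_sum_sq_aux h.memG).const_mul ε)
      ((h.integrable_commutator j).const_mul L), integral_const_mul, integral_const_mul]
  simp only [e]
  simpa using ((h.tendsto_integral_commutator.const_mul L).const_add
    (ε * ∫ s in Ioo a b, ∑ i, ∫ x, G s i x ^ 2)).const_mul 2

/-- Here the rate α = 2μ 2^p is nonnegative: this bound is meant for bounded time intervals only. -/
theorem const_le (h : IsEvolution a b v G B d f) (hm : HasMixedNorms a b q r p d f)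
    (hP : IsProfile p κ ε L F Fc Gp β) (hp : 1 < p) (hκ : 0 < κ) (hε : 0 ≤ ε) (hL : 0 ≤ L)
    (hq : 1 ≤ q) {μ : ℝ} (hμ : 0 ≤ μ) (hA : Absorbs n q r (κ / 4) μ C) (hC : 0 ≤ C) (c : ℝ)
    {δ : ℝ} (hδ : 0 < δ) :
    ((∫ x, β (v a x - c)) + δ) ^ (1 / p) ≤
      Real.exp (∫ s in a..b, 4 * C * 2 ^ p * (eLpNorm (d s) q volume).toReal ^ r) *
      (Real.exp (2 * μ * 2 ^ p / p * (b - a)) * ((∫ x, β (v b x - c)) + δ) ^ (1 / p) +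
        (∫ s in a..b, Real.exp (2 * μ * 2 ^ p / p * (s - a)) *
          (2 ^ p * (eLpNorm (f s) (ENNReal.ofReal p) volume).toReal)) +
        Real.exp (|2 * μ * 2 ^ p| * (b - a)) * (δ ^ (1 / p - 1) *
          (2 * (ε * ∫ s in Ioo a b, ∑ i, ∫ x, G s i x ^ 2) + |2 * μ * 2 ^ p| * δ * (b - a)))) := by
  refine IsBackward.gronwall_limit (fun j => h.isBackward_const hP j c) h.le hp hδ
    (e := defect ε L G B) (fun j t _ => integral_nonneg fun x => hP.nonneg _)
    ((intervalIntegrable_iff_integrableOn_Ioo_of_le h.le).2 (hm.integrable_div.const_mul _))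
    ((intervalIntegrable_iff_integrableOn_Ioo_of_le h.le).2 (hm.integrable_source.const_mul _))
    h.integrable_defect (fun s => by positivity) (fun s => by positivity) (defect_nonneg hε hL)
    (fun j => ae_Ioc_of_ae_restrict ?_) (hP.tendsto_integral_const (h.integrable_at a ⟨le_rfl, h.le⟩) c)
    (hP.tendsto_integral_const (h.integrable_at b ⟨h.le, le_rfl⟩) c) h.tendsto_integral_defect
  filter_upwards [h.slice, hm.memLp_div, hm.memLp_source] with s hs hd hf
  exact hs.energy_const_le hP hp hκ hε hL hq hd hf hA hμ hC j c

/-- The rate is negative here, the gain of the Poincaré inequality. -/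
theorem osc_le (hn : 0 < n) (h : IsEvolution a b v G B d f) (hm : HasMixedNorms a b q r p d f)
    (hP : IsProfile p κ ε L F Fc Gp β) (hp : 1 < p) (hκ : 0 < κ) (hε : 0 ≤ ε) (hL : 0 ≤ L)
    (hq : 1 ≤ q) (hA : Absorbs n q r (κ / 4) (κ / (16 * n ^ 2)) C) (hC : 0 ≤ C)
    {δ : ℝ} (hδ : 0 < δ) :
    ((∫ z : Torus n × Torus n, β (v a z.1 - v a z.2) ∂(volume.prod volume)) + δ) ^ (1 / p) ≤
      Real.exp (∫ s in a..b, 4 * C * 2 ^ p * (eLpNorm (d s) q volume).toReal ^ r) *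
      (Real.exp (-(κ / (8 * n ^ 2)) / p * (b - a)) *
          ((∫ z : Torus n × Torus n, β (v b z.1 - v b z.2) ∂(volume.prod volume)) + δ) ^ (1 / p) +
        (∫ s in a..b, Real.exp (-(κ / (8 * n ^ 2)) / p * (s - a)) *
          (2 ^ p * (eLpNorm (f s) (ENNReal.ofReal p) volume).toReal)) +
        Real.exp (|-(κ / (8 * n ^ 2))| * (b - a)) * (δ ^ (1 / p - 1) *
          (2 * (ε * ∫ s in Ioo a b, ∑ i, ∫ x, G s i x ^ 2) + |-(κ / (8 * n ^ 2))| * δ * (b - a)))) := by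
  refine IsBackward.gronwall_limit (fun j => h.isBackward_osc hP j) h.le hp hδ
    (e := defect ε L G B) (fun j t _ => integral_nonneg fun x => hP.nonneg _)
    ((intervalIntegrable_iff_integrableOn_Ioo_of_le h.le).2 (hm.integrable_div.const_mul _))
    ((intervalIntegrable_iff_integrableOn_Ioo_of_le h.le).2 (hm.integrable_source.const_mul _))
    h.integrable_defect (fun s => by positivity) (fun s => by positivity) (defect_nonneg hε hL)
    (fun j => ae_Ioc_of_ae_restrict ?_) (hP.tendsto_integral_osc (h.integrable_at a ⟨le_rfl, h.le⟩))
    (hP.tendsto_integral_osc (h.integrable_at b ⟨h.le, le_rfl⟩)) h.tendsto_integral_defect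
  filter_upwards [h.slice, hm.memLp_div, hm.memLp_source] with s hs hd hf
  exact hs.energy_osc_le hn hP hp hκ hε hq hd hf hA hC j

end IsEvolution

/-! ### Removal of the truncation at l and of the parameter δ. -/

lemma continuous_growth {p m k : ℝ} (hmp : m ≤ p) (hm : 1 < m) : Continuous (growth p m k) :=
  continuous_abs.mul ((continuousOn_slope hmp hm).comp continuous_abs)

lemma integrable_growth {Ω : Type*} [MeasurableSpace Ω] {ν : Measure Ω} {p m k : ℝ} (hmp : m ≤ p) (hm : 1 < m) (hk : 0 < k)
    {w : Ω → ℝ} (hw : MemLp w (ENNReal.ofReal m) ν) : Integrable (fun x => growth p m k (w x)) ν := by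
  have h1 : Integrable (fun x => ‖w x‖ ^ (ENNReal.ofReal m).toReal) ν :=
    hw.integrable_norm_rpow (by simp; linarith) ENNReal.ofReal_ne_top
  rw [ENNReal.toReal_ofReal (by linarith)] at h1
  refine (h1.const_mul (k ^ (p - m))).mono' ((continuous_growth hmp hm).comp_aestronglyMeasurable hw.1)
    (Eventually.of_forall fun x => ?_)
  rw [Real.norm_of_nonneg (growth_nonneg hk _)]
  exact growth_le_mul_rpow hmp hm hk _

section removal

variable {Ω : Type*} [MeasurableSpace Ω] {ν : Measure Ω} [IsFiniteMeasure ν] {p m k : ℝ}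

lemma integrable_min_rpow (hp : 0 ≤ p) {R : ℝ} (hR : 0 ≤ R) {w : Ω → ℝ} (hw : AEStronglyMeasurable w ν) :
    Integrable (fun x => min |w x| R ^ p) ν := by
  have c : Continuous fun s : ℝ => min |s| R ^ p :=
    (continuous_abs.min continuous_const).rpow_const fun s => Or.inr hp
  refine (integrable_const (R ^ p)).mono' (c.comp_aestronglyMeasurable hw) (Eventually.of_forall fun x => ?_)
  have h0 : 0 ≤ min |w x| R := le_min (abs_nonneg _) hR
  rw [Real.norm_of_nonneg (by positivity)]
  exact Real.rpow_le_rpow h0 (min_le_right _ _) hp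

/-- Removal of the truncation and of the regularisation of the power. -/
lemma limit_profile (hp : 1 < p) (hmp : m ≤ p) (hm : 1 < m) (hm2 : m < 2) {R : ℝ} (hR : 0 < R) (hRk : R ≤ k)
    {wa wb : Ω → ℝ} (hwa : Integrable wa ν) (hwb : MemLp wb (ENNReal.ofReal m) ν) {κ : ℝ} (hκ0 : 0 < κ)
    (h1 : κ ≤ 2 / p) (h2 : κ ≤ 2 - 2 / p) (h3 : κ ≤ 2 / m) (h4 : κ ≤ 2 - 2 / m)
    {K S Φ A E D : ℝ} (hK : 0 ≤ K) (hS : 0 ≤ S)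
    (h : ∀ l : ℕ, ∀ δ : ℝ, 0 < δ → ((∫ x, profB p m k (l + 1) (wa x) ∂ν) + δ) ^ (1 / p) ≤
      K * (S * ((∫ x, profB p m k (l + 1) (wb x) ∂ν) + δ) ^ (1 / p) + Φ +
        A * (δ ^ (1 / p - 1) * (2 * (slope p m k ((l : ℝ) + 1) / ((l : ℝ) + 1) * E) + D * δ)))) :
    (∫ x, min |wa x| R ^ p ∂ν) ^ (1 / p) ≤
      2 * (K * (S * (∫ x, growth p m k (wb x) ∂ν) ^ (1 / p) + Φ)) := by
  have hk : 0 < k := hR.trans_le hRk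
  have hp0 : 0 < p := by linarith
  have hp1 : 0 < 1 / p := by positivity
  set J := ∫ x, min |wa x| R ^ p ∂ν with hJ
  set Y := ∫ x, growth p m k (wb x) ∂ν with hY
  have hJ0 : 0 ≤ J := integral_nonneg fun x => by
    have : 0 ≤ min |wa x| R := le_min (abs_nonneg _) hR.le
    positivity
  have hY0 : 0 ≤ Y := integral_nonneg fun x => growth_nonneg hk _
  have hprof : ∀ l : ℕ, IsProfile p κ (slope p m k ((l : ℝ) + 1) / ((l : ℝ) + 1)) (slope p m k ((l : ℝ) + 1))
      (profF p m k (l + 1)) (profFc p m k (l + 1)) (profG p m k (l + 1)) (profB p m k (l + 1)) := fun l =>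
    isProfile hmp hm hk (by positivity) hκ0 h1 h2 h3 h4
  have hwbi : Integrable wb ν := hwb.integrable (by
    rw [← ENNReal.ofReal_one]; exact ENNReal.ofReal_le_ofReal hm.le)
  have ub : ∀ l : ℕ, ∫ x, profB p m k (l + 1) (wb x) ∂ν ≤ Y := fun l =>
    integral_mono ((hprof l).integrable_comp hwbi) (integrable_growth hmp hm hk hwb) fun x =>
      profB_le_growth hmp hm hk (by positivity) _
  have lb : ∀ l : ℕ, R ≤ l + 1 → (2 ^ p)⁻¹ * J ≤ ∫ x, profB p m k (l + 1) (wa x) ∂ν := by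
    intro l hl
    rw [hJ, ← integral_const_mul]
    refine integral_mono ((integrable_min_rpow hp0.le hR.le hwa.1).const_mul _)
      ((hprof l).integrable_comp hwa) fun x => ?_
    rw [inv_mul_le_iff₀ (by positivity)]
    refine le_trans ?_ ((hprof l).sq_le (wa x))
    have a0 : 0 ≤ min |wa x| R := le_min (abs_nonneg _) hR.le
    have a1 : 0 ≤ min |wa x| ((l : ℝ) + 1) := le_min (abs_nonneg _) (by positivity)
    rw [profG_sq hm hk (by positivity)]
    have e : min |wa x| R ^ p = growth p m k (min |wa x| R) := by
      rw [growth_of_le hmp hm (by rw [abs_of_nonneg a0]; exact (min_le_right _ _).trans hRk),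
        abs_of_nonneg a0]
    rw [e]
    refine growth_mono hmp hm hk ?_
    rw [abs_of_nonneg a0, abs_of_nonneg a1]
    exact min_le_min_left _ hl
  -- First l → ∞ at fixed δ: the factor δ^(1/p - 1) in front of the error is unbounded as δ → 0, so
  -- the order matters.
  have step1 : ∀ δ : ℝ, 0 < δ → ((2 ^ p)⁻¹ * J) ^ (1 / p) ≤
      K * (S * (Y + δ) ^ (1 / p) + Φ + A * (δ ^ (1 / p - 1) * (2 * (0 * E) + D * δ))) := by
    intro δ hδ
    have lim : Tendsto (fun l : ℕ => K * (S * (Y + δ) ^ (1 / p) + Φ +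
        A * (δ ^ (1 / p - 1) * (2 * (slope p m k ((l : ℝ) + 1) / ((l : ℝ) + 1) * E) + D * δ)))) atTop
        (𝓝 (K * (S * (Y + δ) ^ (1 / p) + Φ + A * (δ ^ (1 / p - 1) * (2 * (0 * E) + D * δ))))) :=
      ((((((tendsto_slope_div hm2).mul_const E).const_mul 2).add_const _).const_mul _).const_mul A
        |>.const_add _).const_mul K
    refine ge_of_tendsto lim ?_
    filter_upwards [eventually_ge_atTop ⌈R⌉₊] with l hl
    have hl' : R ≤ (l : ℝ) + 1 := by linarith [Nat.le_of_ceil_le hl]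
    have hb0 : 0 ≤ ∫ x, profB p m k (l + 1) (wb x) ∂ν := integral_nonneg fun x => (hprof l).nonneg _
    refine (Real.rpow_le_rpow (by positivity) (by linarith [lb l hl']) hp1.le).trans
      ((h l δ hδ).trans ?_)
    have := ub l
    gcongr
  -- The remaining error is δ^(1/p - 1) · D δ = D δ^(1/p), which vanishes with δ. On the left, the
  -- power 1/p of 2^(-p) gives the final factor 2.
  have step2 : ((2 ^ p)⁻¹ * J) ^ (1 / p) ≤ K * (S * (Y + 0) ^ (1 / p) + Φ + A * (D * 0 ^ (1 / p))) := by
    have c : Continuous fun δ : ℝ => K * (S * (Y + δ) ^ (1 / p) + Φ + A * (D * δ ^ (1 / p))) := by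
      have c1 : Continuous fun δ : ℝ => (Y + δ) ^ (1 / p) :=
        (continuous_const.add continuous_id).rpow_const fun _ => Or.inr hp1.le
      have c2 : Continuous fun δ : ℝ => δ ^ (1 / p) := Real.continuous_rpow_const hp1.le
      fun_prop
    have lim := (c.tendsto 0).mono_left (nhdsWithin_le_nhds (s := Ioi 0))
    refine ge_of_tendsto lim ?_
    filter_upwards [self_mem_nhdsWithin] with δ (hδ : 0 < δ)
    refine (step1 δ hδ).trans_eq ?_
    rw [Real.rpow_sub_one hδ.ne']
    field_simp
    ring
  rw [add_zero, Real.zero_rpow hp1.ne', mul_zero, mul_zero, add_zero,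
    Real.mul_rpow (by positivity) hJ0, ← Real.rpow_neg (by norm_num), ← Real.rpow_mul (by norm_num),
    neg_mul, mul_one_div_cancel hp0.ne', Real.rpow_neg_one] at step2
  linarith

end removal

/-! ### From the distributional equation to the regularised one. -/

/-- A smooth approximation of the indicator function of `(c, ∞)`. -/
def stepUp (c : ℝ) (j : ℕ) (t : ℝ) : ℝ := Real.smoothTransition (((j : ℝ) + 1) * (t - c))

section stepUp

variable {c t : ℝ} {j : ℕ}

lemma stepUp_of_le (h : t ≤ c) : stepUp c j t = 0 :=
  Real.smoothTransition.zero_of_nonpos (mul_nonpos_of_nonneg_of_nonpos (by positivity) (by linarith))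

lemma stepUp_of_ge (h : c + 1 / ((j : ℝ) + 1) ≤ t) : stepUp c j t = 1 := by
  refine Real.smoothTransition.one_of_one_le ?_
  have hj : (0 : ℝ) < (j : ℝ) + 1 := by positivity
  have h1 : 1 / ((j : ℝ) + 1) ≤ t - c := by linarith
  rwa [div_le_iff₀ hj, mul_comm] at h1

lemma contDiff_stepUp : ContDiff ℝ ((⊤ : ℕ∞) : WithTop ℕ∞) (stepUp c j) :=
  Real.smoothTransition.contDiff.comp (contDiff_const.mul (contDiff_id.sub contDiff_const))

lemma differentiable_stepUp : Differentiable ℝ (stepUp c j) :=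
  contDiff_stepUp.differentiable (by simp)

lemma continuous_deriv_stepUp : Continuous (deriv (stepUp c j)) :=
  contDiff_stepUp.continuous_deriv (by simp)

lemma stepUp_mem : stepUp c j t ∈ Icc (0 : ℝ) 1 :=
  ⟨Real.smoothTransition.nonneg _, Real.smoothTransition.le_one _⟩

lemma deriv_stepUp_nonneg : 0 ≤ deriv (stepUp c j) t := by
  refine Monotone.deriv_nonneg fun x y hxy => Real.smoothTransition.monotone ?_
  gcongr

lemma deriv_stepUp_eq_zero (h : t < c ∨ c + 1 / ((j : ℝ) + 1) < t) : deriv (stepUp c j) t = 0 := by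
  rcases h with h | h
  · have : stepUp c j =ᶠ[𝓝 t] fun _ => 0 := by
      filter_upwards [eventually_lt_nhds h] with s hs using stepUp_of_le hs.le
    rw [this.deriv_eq, deriv_const]
  · have : stepUp c j =ᶠ[𝓝 t] fun _ => 1 := by
      filter_upwards [eventually_gt_nhds h] with s hs using stepUp_of_ge hs.le
    rw [this.deriv_eq, deriv_const]

lemma eventually_one_div_lt {δ : ℝ} (hδ : 0 < δ) : ∀ᶠ j : ℕ in atTop, 1 / ((j : ℝ) + 1) < δ :=
  (tendsto_order.1 tendsto_one_div_add_atTop_nhds_zero_nat).2 δ hδ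

/-- The derivatives of the steps are nonnegative, have integral one for large j, and concentrate at
c. -/
lemma tendsto_integral_deriv_stepUp {α ω : ℝ} (hc : c ∈ Ioo α ω) {V : ℝ → ℝ}
    (hV : IntegrableOn V (Ioo α ω)) (hVc : ContinuousAt V c) :
    Tendsto (fun j => ∫ t in Ioo α ω, deriv (stepUp c j) t * V t) atTop (𝓝 (V c)) := by
  refine tendsto_setIntegral_peak_smul_of_integrableOn_of_tendsto (φ := fun j => deriv (stepUp c j))
    measurableSet_Ioo measurableSet_Ioo subset_rfl self_mem_nhdsWithin (x₀ := c) (by simp) ?_ ?_ ?_ ?_ hV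
    (hVc.mono_left nhdsWithin_le_nhds)
  · exact Eventually.of_forall fun j t _ => deriv_stepUp_nonneg
  · intro u hu hcu
    obtain ⟨δ, hδ, hδu⟩ := Metric.isOpen_iff.1 hu c hcu
    rw [Metric.tendstoUniformlyOn_iff]
    intro ε hε
    filter_upwards [eventually_one_div_lt hδ] with j hj t ht
    have : t ∉ Metric.ball c δ := fun h => ht.2 (hδu h)
    rw [Metric.mem_ball, Real.dist_eq, not_lt] at this
    rw [deriv_stepUp_eq_zero, Pi.zero_apply, dist_self]
    · exact hε
    · rcases le_total t c with h | h
      · rw [abs_of_nonpos (by linarith)] at this; left; linarith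
      · rw [abs_of_nonneg (by linarith)] at this; right; linarith
  · refine tendsto_const_nhds.congr' ?_
    filter_upwards [eventually_one_div_lt (sub_pos.2 hc.2)] with j hj
    have hle : α ≤ ω := (hc.1.trans hc.2).le
    rw [← integral_Ioc_eq_integral_Ioo, ← intervalIntegral.integral_of_le hle,
      intervalIntegral.integral_deriv_eq_sub (fun t _ => differentiable_stepUp t)
        (continuous_deriv_stepUp.intervalIntegrable _ _), stepUp_of_ge (by linarith), stepUp_of_le hc.1.le,
      sub_zero]
  · exact Eventually.of_forall fun j => continuous_deriv_stepUp.aestronglyMeasurable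

lemma tendsto_stepUp (c t : ℝ) :
    Tendsto (fun j => stepUp c j t) atTop (𝓝 (if c < t then 1 else 0)) := by
  split_ifs with h
  · refine tendsto_const_nhds.congr' ?_
    filter_upwards [eventually_one_div_lt (sub_pos.2 h)] with j hj
    rw [stepUp_of_ge (by linarith)]
  · simp only [stepUp_of_le (not_lt.1 h)]
    exact tendsto_const_nhds

end stepUp

/-- A distributional derivative in time, tested with smooth functions, gives increments. -/
lemma isBackward_of_integral_deriv {α ω a b : ℝ} (ha : α < a) (hab : a ≤ b) (hb : b < ω) {V H : ℝ → ℝ}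
    (hV : IntegrableOn V (Ioo α ω)) (hVc : ∀ t ∈ Ioo α ω, ContinuousAt V t)
    (hH : IntegrableOn H (Ioo α ω))
    (h : ∀ η : ℝ → ℝ, ContDiff ℝ ((⊤ : ℕ∞) : WithTop ℕ∞) η → (∀ t, t ∉ Ioo α ω → η t = 0) →
      ∫ t in Ioo α ω, deriv η t * V t = ∫ t in Ioo α ω, η t * H t) :
    IsBackward V H a b := by
  have hsub : ∀ t, a ≤ t → Ioo t b ⊆ Ioo α ω := fun t ht => Ioo_subset_Ioo (by linarith) hb.le
  refine ⟨(intervalIntegrable_iff_integrableOn_Ioo_of_le hab).2 (hH.mono_set (hsub a le_rfl)),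
    fun t ht => ?_⟩
  have htm : t ∈ Ioo α ω := ⟨by linarith [ht.1], by linarith [ht.2]⟩
  have hbm : b ∈ Ioo α ω := ⟨by linarith, hb⟩
  -- The test function is a smooth indicator of (t, b]. It vanishes outside the interval once b +
  -- 1/(j+1) < ω, hence the need for room to the right of b.
  have hE : ∀ᶠ j : ℕ in atTop, (∫ s in Ioo α ω, deriv (stepUp t j) s * V s) -
      ∫ s in Ioo α ω, deriv (stepUp b j) s * V s =
      ∫ s in Ioo α ω, (stepUp t j s - stepUp b j s) * H s := by
    filter_upwards [eventually_one_div_lt (sub_pos.2 hb)] with j hj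
    have hj0 : 0 < 1 / ((j : ℝ) + 1) := by positivity
    rw [← h (fun s => stepUp t j s - stepUp b j s) (contDiff_stepUp.sub contDiff_stepUp) fun s hs => ?_]
    · have i1 : ∀ c, Integrable (fun s => deriv (stepUp c j) s * V s) (volume.restrict (Ioo α ω)) := by
        intro c
        obtain ⟨C, hC⟩ := (isCompact_Icc (a := α) (b := ω)).exists_bound_of_continuousOn
          (continuous_deriv_stepUp (c := c) (j := j)).continuousOn
        refine hV.bdd_mul (c := C) continuous_deriv_stepUp.aestronglyMeasurable ?_
        filter_upwards [ae_restrict_mem measurableSet_Ioo] with s hs using hC s (Ioo_subset_Icc_self hs)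
      rw [← integral_sub (i1 t) (i1 b)]
      refine integral_congr_ae (Eventually.of_forall fun s => ?_)
      simp only
      rw [deriv_fun_sub (differentiable_stepUp s) (differentiable_stepUp s), sub_mul]
    · rw [mem_Ioo, not_and_or, not_lt, not_lt] at hs
      have ht1 := ht.1
      have ht2 := ht.2
      rcases hs with hs | hs
      · rw [stepUp_of_le (by linarith), stepUp_of_le (by linarith), sub_zero]
      · rw [stepUp_of_ge (by linarith), stepUp_of_ge (by linarith), sub_self]
  have l1 := (tendsto_integral_deriv_stepUp htm hV (hVc t htm)).sub
    (tendsto_integral_deriv_stepUp hbm hV (hVc b hbm))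
  have l2 : Tendsto (fun j => ∫ s in Ioo α ω, (stepUp t j s - stepUp b j s) * H s) atTop
      (𝓝 (∫ s in Ioo α ω, ((if t < s then 1 else 0) - if b < s then 1 else 0) * H s)) := by
    refine tendsto_integral_of_dominated_convergence
      (F := fun j s => (stepUp t j s - stepUp b j s) * H s) (fun s => |H s|) (fun j => ?_)
      (Integrable.abs hH) (fun j => Eventually.of_forall fun s => ?_) (Eventually.of_forall fun s => ?_)
    · exact ((contDiff_stepUp.continuous.sub contDiff_stepUp.continuous).aestronglyMeasurable).mul
        hH.aestronglyMeasurable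
    · rw [norm_mul]
      have h1 := stepUp_mem (c := t) (j := j) (t := s)
      have h2 := stepUp_mem (c := b) (j := j) (t := s)
      refine mul_le_of_le_one_left (norm_nonneg _) ?_
      rw [Real.norm_eq_abs, abs_le]
      constructor <;> linarith [h1.1, h1.2, h2.1, h2.2]
    · exact ((tendsto_stepUp t s).sub (tendsto_stepUp b s)).mul_const _
  have l3 := tendsto_nhds_unique (l1.congr' hE) l2
  have e : ∫ s in Ioo α ω, (((if t < s then 1 else 0) - if b < s then 1 else 0) : ℝ) * H s =
      ∫ s in t..b, H s := by
    rw [intervalIntegral.integral_of_le ht.2]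
    rw [setIntegral_eq_of_subset_of_forall_sdiff_eq_zero measurableSet_Ioo (s := Ioc t b)]
    · refine setIntegral_congr_fun measurableSet_Ioc fun s hs => ?_
      rw [if_pos hs.1, if_neg (not_lt.2 hs.2), sub_zero, one_mul]
    · exact fun s hs => ⟨htm.1.trans hs.1, hs.2.trans_lt hb⟩
    · intro s hs
      rcases lt_or_ge t s with h1 | h1
      · have : b < s := by
          by_contra h2
          exact hs.2 ⟨h1, not_lt.1 h2⟩
        rw [if_pos h1, if_pos this, sub_self, zero_mul]
      · rw [if_neg (not_lt.2 h1), if_neg (not_lt.2 (h1.trans ht.2)), sub_self, zero_mul]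
  rw [e] at l3
  linarith

lemma ae_eq_of_integral_smooth {α ω : ℝ} {Φ Ψ : ℝ → ℝ} (hΦ : IntegrableOn Φ (Ioo α ω))
    (hΨ : IntegrableOn Ψ (Ioo α ω))
    (h : ∀ η : ℝ → ℝ, ContDiff ℝ ((⊤ : ℕ∞) : WithTop ℕ∞) η → (∀ t, t ∉ Ioo α ω → η t = 0) →
      ∫ t in Ioo α ω, η t * Φ t = ∫ t in Ioo α ω, η t * Ψ t) :
    ∀ᵐ t ∂(volume.restrict (Ioo α ω)), Φ t = Ψ t := by
  have hi : IntegrableOn (fun t => Φ t - Ψ t) (Ioo α ω) := hΦ.sub hΨ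
  have := isOpen_Ioo.ae_eq_zero_of_integral_contDiff_smul_eq_zero hi.locallyIntegrableOn fun η hη hc hs => ?_
  · rw [ae_restrict_iff' measurableSet_Ioo]
    filter_upwards [this] with t ht htm
    exact sub_eq_zero.1 (ht htm)
  · have h0 : ∀ t, t ∉ Ioo α ω → η t = 0 := fun t ht => image_eq_zero_of_notMem_tsupport fun h => ht (hs h)
    have hb : ∀ g : ℝ → ℝ, IntegrableOn g (Ioo α ω) →
        Integrable (fun t => η t * g t) (volume.restrict (Ioo α ω)) := by
      intro g hg
      obtain ⟨C, hC⟩ := hc.exists_bound_of_continuous hη.continuous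
      exact Integrable.bdd_mul (c := C) hg hη.continuous.aestronglyMeasurable (Eventually.of_forall hC)
    rw [← setIntegral_eq_integral_of_forall_compl_eq_zero (s := Ioo α ω)]
    · simp only [smul_eq_mul, mul_sub]
      rw [integral_sub (hb Φ hΦ) (hb Ψ hΨ), h η hη h0, sub_self]
    · intro t ht
      simp [h0 t ht]

/-- The null set of times depends on x; a countable dense set of points and continuity in x remove
this dependence. -/
lemma ae_forall_eq {μ : Measure ℝ} {Φ Ψ : ℝ → Torus n → ℝ} (h : ∀ x, ∀ᵐ t ∂μ, Φ t x = Ψ t x)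
    (hΦ : ∀ᵐ t ∂μ, Continuous (Φ t)) (hΨ : ∀ᵐ t ∂μ, Continuous (Ψ t)) :
    ∀ᵐ t ∂μ, ∀ x, Φ t x = Ψ t x := by
  have h1 : ∀ᵐ t ∂μ, ∀ k, Φ t (TopologicalSpace.denseSeq (Torus n) k) =
      Ψ t (TopologicalSpace.denseSeq (Torus n) k) := ae_all_iff.2 fun k => h _
  filter_upwards [h1, hΦ, hΨ] with t ht c1 c2 x
  refine congrFun (Continuous.ext_on (TopologicalSpace.denseRange_denseSeq (Torus n)) c1 c2 ?_) x
  rintro _ ⟨k, rfl⟩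
  exact ht k

lemma integral_cylinder_eq {τ T α ω : ℝ} (hα : τ ≤ α) (hω : ω ≤ T) {ψ : ℝ × Torus n → ℝ}
    (hψ : ∀ z, z.1 ∉ Ioo α ω → ψ z = 0) :
    ∫ z, ψ z ∂cylinder n τ T = ∫ z, ψ z ∂((volume.restrict (Ioo α ω)).prod volume) := by
  have e : ((volume.restrict (Ioo α ω)).prod (volume : Measure (Torus n))) =
      (cylinder n τ T).restrict (Ioo α ω ×ˢ univ) := by
    rw [cylinder, ← Measure.prod_restrict, Measure.restrict_univ, Measure.restrict_restrict measurableSet_Ioo,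
      inter_eq_self_of_subset_left (Ioo_subset_Ioo hα hω)]
  rw [e, setIntegral_eq_integral_of_forall_compl_eq_zero]
  intro z hz
  exact hψ z fun h => hz ⟨h, mem_univ _⟩

section fubini

variable {α ω : ℝ} {η : ℝ → ℝ} {k : Torus n → ℝ} {g : ℝ → Torus n → ℝ}

lemma exists_bound_on_Ioo (hη : Continuous η) (α ω : ℝ) :
    ∃ C, ∀ᵐ t ∂(volume.restrict (Ioo α ω)), ‖η t‖ ≤ C := by
  obtain ⟨C, hC⟩ := (isCompact_Icc (a := α) (b := ω)).exists_bound_of_continuousOn hη.continuousOn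
  refine ⟨C, ?_⟩
  filter_upwards [ae_restrict_mem measurableSet_Ioo] with t ht using hC t (Ioo_subset_Icc_self ht)

lemma integrable_test (hη : Continuous η) (hk : Continuous k) (x : Torus n)
    (hg : Integrable (Function.uncurry g) ((volume.restrict (Ioo α ω)).prod volume)) :
    Integrable (fun z : ℝ × Torus n => η z.1 * (k (x - z.2) * g z.1 z.2))
      ((volume.restrict (Ioo α ω)).prod volume) := by
  obtain ⟨C, hC⟩ := exists_bound_on_Ioo hη α ω
  obtain ⟨C', _, hC'⟩ := exists_bound_of_continuous hk
  have h1 := hg.bdd_mul (c := C') (f := fun z : ℝ × Torus n => k (x - z.2)) (by fun_prop)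
    (Eventually.of_forall fun z => hC' _)
  refine Integrable.bdd_mul (c := C) (f := fun z : ℝ × Torus n => η z.1) h1 (by fun_prop) ?_
  exact Measure.quasiMeasurePreserving_fst.ae hC

lemma integral_test (hη : Continuous η) (hk : Continuous k) (x : Torus n)
    (hg : Integrable (Function.uncurry g) ((volume.restrict (Ioo α ω)).prod volume)) :
    ∫ z : ℝ × Torus n, η z.1 * (k (x - z.2) * g z.1 z.2) ∂((volume.restrict (Ioo α ω)).prod volume) =
      ∫ t in Ioo α ω, η t * conv k (g t) x := by
  rw [integral_prod _ (integrable_test hη hk x hg)]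
  simp only [integral_const_mul, conv]

lemma integrable_conv_slice (hk : Continuous k) (x : Torus n)
    (hg : Integrable (Function.uncurry g) ((volume.restrict (Ioo α ω)).prod volume)) :
    IntegrableOn (fun t => conv k (g t) x) (Ioo α ω) := by
  have := integrable_test (η := fun _ => 1) continuous_const hk x hg
  simp only [one_mul] at this
  exact this.integral_prod_left

lemma ae_continuous_conv (hk : Continuous k)
    (hg : Integrable (Function.uncurry g) ((volume.restrict (Ioo α ω)).prod volume)) :
    ∀ᵐ t ∂(volume.restrict (Ioo α ω)), Continuous (conv k (g t)) := by
  filter_upwards [hg.prod_right_ae] with t ht using continuous_conv hk ht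

end fubini

lemma TSmooth.grad_test {k : Torus n → ℝ} (hk : TSmooth k) (x y : Torus n) (c : ℝ) (i : Fin n) :
    DriftDiffusion.grad (fun y => c * k (x - y)) y i = -(c * DriftDiffusion.grad k (x - y) i) := by
  have h1 := ((hk.hasPD i).reflect x)
  have h2 : HasPD i (fun y => c * k (x - y)) (fun y => c * -DriftDiffusion.grad k (x - y) i) :=
    fun y => (h1 y).const_mul c
  rw [h2.grad_apply, mul_neg]

section weak

variable {τ T α ω : ℝ} {v d f : ℝ → Torus n → ℝ} {Dv b : ℝ → Torus n → Vec n}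

lemma memLp_component (hD : MemLp (Function.uncurry Dv) 2 ((volume.restrict (Ioo α ω)).prod volume))
    (i : Fin n) : MemLp (fun z : ℝ × Torus n => Dv z.1 z.2 i) 2 ((volume.restrict (Ioo α ω)).prod volume) :=
  hD.of_le ((EuclideanSpace.proj (𝕜 := ℝ) i).continuous.comp_aestronglyMeasurable hD.1)
    (Eventually.of_forall fun z => PiLp.norm_apply_le (Dv z.1 z.2) i)

lemma ae_memLp_slice {g : ℝ → Torus n → ℝ}
    (hg : MemLp (Function.uncurry g) 2 ((volume.restrict (Ioo α ω)).prod volume)) :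
    ∀ᵐ t ∂(volume.restrict (Ioo α ω)), MemLp (g t) 2 volume := by
  filter_upwards [hg.integrable_sq.prod_right_ae, hg.1.prodMk_left] with t h1 h2
  exact (memLp_two_iff_integrable_sq h2).2 h1

/-- Tested with η(t) k(x - y): the reflection in y supplies a minus sign, which cancels that of the
definition, and arbitrary η localises in time. -/
lemma ae_weakGrad (hα : τ < α) (hω : ω < T) (h : IsWeakGrad τ T v Dv)
    (hv : Integrable (Function.uncurry v) ((volume.restrict (Ioo α ω)).prod volume))
    (hD : MemLp (Function.uncurry Dv) 2 ((volume.restrict (Ioo α ω)).prod volume)) (j : ℕ) (i : Fin n) :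
    ∀ᵐ t ∂(volume.restrict (Ioo α ω)), ∀ x,
      conv (dkernel n j i) (v t) x = conv (kernel n j) (fun y => Dv t y i) x := by
  have ck := continuous_kernel (n := n) j
  have cd := continuous_dkernel j i
  have hDi : Integrable (Function.uncurry fun t y => Dv t y i) ((volume.restrict (Ioo α ω)).prod volume) :=
    (memLp_component hD i).integrable (by norm_num)
  refine ae_forall_eq (fun x => ?_) (ae_continuous_conv cd hv) (ae_continuous_conv ck hDi)
  refine ae_eq_of_integral_smooth (integrable_conv_slice cd x hv) (integrable_conv_slice ck x hDi)
    fun η hη h0 => ?_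
  have ht := h _ ((tsmooth_kernel j).isTestFunction x hη hα hω fun t ht => h0 t fun h' =>
    ht (Ioo_subset_Icc_self h')) i
  simp only [(tsmooth_kernel j).grad_test] at ht
  rw [integral_cylinder_eq hα.le hω.le fun z hz => by rw [h0 _ hz]; ring,
    integral_cylinder_eq hα.le hω.le fun z hz => by rw [h0 _ hz]; ring] at ht
  rw [← integral_test hη.continuous cd x hv, ← integral_test hη.continuous ck x hDi, ← neg_inj, ← integral_neg]
  refine Eq.trans ?_ (ht.trans ?_)
  · exact integral_congr_ae (Eventually.of_forall fun z => by simp only [dkernel]; ring)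
  · congr 1
    exact integral_congr_ae (Eventually.of_forall fun z => by simp only; ring)

lemma inner_eq_sum (x y : Vec n) : inner ℝ x y = ∑ i, x i * y i := by
  simp [PiLp.inner_apply, mul_comm]

lemma ae_weakDiv (hα : τ < α) (hω : ω < T) (h : IsWeakDiv τ T b d)
    (hd : Integrable (Function.uncurry d) ((volume.restrict (Ioo α ω)).prod volume))
    (hb : MemLp (Function.uncurry b) 2 ((volume.restrict (Ioo α ω)).prod volume)) (j : ℕ) :
    ∀ᵐ t ∂(volume.restrict (Ioo α ω)), ∀ x,
      ∑ i, conv (dkernel n j i) (fun y => b t y i) x = conv (kernel n j) (d t) x := by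
  have ck := continuous_kernel (n := n) j
  have hbi : ∀ i, Integrable (Function.uncurry fun t y => b t y i)
      ((volume.restrict (Ioo α ω)).prod volume) := fun i =>
    (memLp_component hb i).integrable (by norm_num)
  refine ae_forall_eq (fun x => ?_) ?_ (ae_continuous_conv ck hd)
  · refine ae_eq_of_integral_smooth (integrable_finsetSum _ fun i _ =>
      integrable_conv_slice (continuous_dkernel j i) x (hbi i)) (integrable_conv_slice ck x hd)
      fun η hη h0 => ?_
    have ht := h _ ((tsmooth_kernel j).isTestFunction x hη hα hω fun t ht => h0 t fun h' =>
      ht (Ioo_subset_Icc_self h'))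
    simp only [inner_eq_sum, (tsmooth_kernel j).grad_test] at ht
    rw [integral_cylinder_eq hα.le hω.le fun z hz => by simp [h0 _ hz],
      integral_cylinder_eq hα.le hω.le fun z hz => by rw [h0 _ hz]; ring] at ht
    obtain ⟨C, hC⟩ := exists_bound_on_Ioo hη.continuous α ω
    have e : ∫ t in Ioo α ω, η t * ∑ i, conv (dkernel n j i) (fun y => b t y i) x =
        ∑ i, ∫ t in Ioo α ω, η t * conv (dkernel n j i) (fun y => b t y i) x := by
      simp only [Finset.mul_sum]
      refine integral_finsetSum _ fun i _ => ?_
      exact (integrable_conv_slice (continuous_dkernel j i) x (hbi i)).bdd_mul (c := C)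
        hη.continuous.aestronglyMeasurable hC
    rw [e, ← integral_test hη.continuous ck x hd]
    simp only [← integral_test hη.continuous (continuous_dkernel j _) x (hbi _)]
    rw [← integral_finsetSum _ fun i _ => integrable_test hη.continuous (continuous_dkernel j i) x (hbi i),
      ← neg_inj, ← integral_neg]
    refine Eq.trans ?_ (ht.trans ?_)
    · refine integral_congr_ae (Eventually.of_forall fun z => ?_)
      simp only [← Finset.sum_neg_distrib]
      exact Finset.sum_congr rfl fun i _ => by simp only [dkernel]; ring
    · congr 1
      exact integral_congr_ae (Eventually.of_forall fun z => by simp only; ring)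
  · filter_upwards [ae_all_iff.2 fun i => ae_continuous_conv (continuous_dkernel j i) (hbi i)] with t ht
    exact continuous_finsetSum _ fun i _ => ht i

/-- The test function η(t) k(x - y) puts the derivative of the diffusion term on the kernel with a
minus sign, so diffusion, transport and source end up on the same side. -/
lemma integral_velocity_test (hα : τ < α) (hω : ω < T)
    (hv : Integrable (Function.uncurry v) ((volume.restrict (Ioo α ω)).prod volume))
    (hD : MemLp (Function.uncurry Dv) 2 ((volume.restrict (Ioo α ω)).prod volume))
    (hb : MemLp (Function.uncurry b) 2 ((volume.restrict (Ioo α ω)).prod volume))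
    (hf : Integrable (Function.uncurry f) ((volume.restrict (Ioo α ω)).prod volume))
    (h : ∀ φ : ℝ → Torus n → ℝ, IsTestFunction τ T φ →
      ∫ z, (v z.1 z.2 * deriv (fun s => φ s z.2) z.1
          + inner ℝ (Dv z.1 z.2) (grad (φ z.1) z.2)
          - inner ℝ (b z.1 z.2) (Dv z.1 z.2) * φ z.1 z.2) ∂cylinder n τ T =
        ∫ z, f z.1 z.2 * φ z.1 z.2 ∂cylinder n τ T) (j : ℕ) (x : Torus n)
    {η : ℝ → ℝ} (hη : ContDiff ℝ ((⊤ : ℕ∞) : WithTop ℕ∞) η) (h0 : ∀ t, t ∉ Ioo α ω → η t = 0) :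
    ∫ t in Ioo α ω, deriv η t * conv (kernel n j) (v t) x =
      ∫ t in Ioo α ω, η t * velocity j (fun i y => b t y i) (fun i y => Dv t y i) (f t) x := by
  have ck := continuous_kernel (n := n) j
  have cη' : Continuous (deriv η) := hη.continuous_deriv (by simp)
  -- The endpoints are included: there the derivative is computed from the outer side, where η
  -- vanishes identically.
  have h0' : ∀ t, t ∉ Ioo α ω → deriv η t = 0 := by
    intro t ht
    have hη1 : HasDerivAt η (deriv η t) t := (hη.differentiable (by simp) t).hasDerivAt
    rw [mem_Ioo, not_and_or, not_lt, not_lt] at ht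
    rcases ht with ht | ht
    · have h1 : HasDerivWithinAt η 0 (Iic t) t := by
        refine (hasDerivWithinAt_const t (Iic t) (0 : ℝ)).congr (fun s hs => h0 s fun h' => ?_)
          (h0 t fun h' => ?_)
        · exact absurd h'.1 (not_lt.2 (le_trans hs ht))
        · exact absurd h'.1 (not_lt.2 ht)
      exact (uniqueDiffWithinAt_Iic t).eq_deriv _ hη1.hasDerivWithinAt h1
    · have h1 : HasDerivWithinAt η 0 (Ici t) t := by
        refine (hasDerivWithinAt_const t (Ici t) (0 : ℝ)).congr (fun s hs => h0 s fun h' => ?_)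
          (h0 t fun h' => ?_)
        · exact absurd h'.2 (not_lt.2 (le_trans ht hs))
        · exact absurd h'.2 (not_lt.2 ht)
      exact (uniqueDiffWithinAt_Ici t).eq_deriv _ hη1.hasDerivWithinAt h1
  have hDi : ∀ i, Integrable (Function.uncurry fun t y => Dv t y i)
      ((volume.restrict (Ioo α ω)).prod volume) := fun i =>
    (memLp_component hD i).integrable (by norm_num)
  have hbD : Integrable (Function.uncurry fun t => transport (fun i y => b t y i) (fun i y => Dv t y i))
      ((volume.restrict (Ioo α ω)).prod volume) :=
    integrable_finsetSum (f := fun i (z : ℝ × Torus n) => b z.1 z.2 i * Dv z.1 z.2 i) Finset.univ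
      fun i _ => (memLp_component hb i).integrable_mul (memLp_component hD i)
  have ht := h _ ((tsmooth_kernel j).isTestFunction x hη hα hω fun t ht => h0 t fun h' =>
    ht (Ioo_subset_Icc_self h'))
  have e1 : ∀ z : ℝ × Torus n, deriv (fun s => η s * kernel n j (x - z.2)) z.1 =
      deriv η z.1 * kernel n j (x - z.2) := fun z =>
    deriv_mul_const (hη.differentiable (by simp) z.1) _
  simp only [e1, inner_eq_sum, (tsmooth_kernel j).grad_test] at ht
  rw [integral_cylinder_eq hα.le hω.le fun z hz => by simp [h0 _ hz, h0' _ hz],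
    integral_cylinder_eq hα.le hω.le fun z hz => by rw [h0 _ hz]; ring] at ht
  have i1 := integrable_test cη' ck x hv
  have i2 := integrable_finsetSum (Finset.univ : Finset (Fin n)) fun i _ =>
    integrable_test hη.continuous (continuous_dkernel j i) x (hDi i)
  have i3 := integrable_test hη.continuous ck x hbD
  have i4 := integrable_test hη.continuous ck x hf
  have s1 := integral_test cη' ck x hv
  have s2 : ∀ i, _ := fun i => integral_test hη.continuous (continuous_dkernel j i) x (hDi i)
  have s3 := integral_test hη.continuous ck x hbD
  have s4 := integral_test hη.continuous ck x hf
  have e2 : ∫ t in Ioo α ω, η t * velocity j (fun i y => b t y i) (fun i y => Dv t y i) (f t) x =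
      ∑ i, (∫ t in Ioo α ω, η t * conv (dkernel n j i) (fun y => Dv t y i) x) +
      (∫ t in Ioo α ω, η t * conv (kernel n j) (transport (fun i y => b t y i) (fun i y => Dv t y i)) x) +
      ∫ t in Ioo α ω, η t * conv (kernel n j) (f t) x := by
    obtain ⟨C, hC⟩ := exists_bound_on_Ioo hη.continuous α ω
    have bi : ∀ {φ : ℝ → ℝ}, IntegrableOn φ (Ioo α ω) →
        Integrable (fun t => η t * φ t) (volume.restrict (Ioo α ω)) := fun hφ =>
      Integrable.bdd_mul (c := C) hφ hη.continuous.aestronglyMeasurable hC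
    have j1 := fun i => bi (integrable_conv_slice (continuous_dkernel j i) x (hDi i))
    have j2 := bi (integrable_conv_slice ck x hbD)
    have j3 := bi (integrable_conv_slice ck x hf)
    rw [← integral_finsetSum _ fun i _ => j1 i, ← integral_add (integrable_finsetSum _ fun i _ => j1 i) j2,
      ← integral_add ((integrable_finsetSum _ fun i _ => j1 i).fadd j2) j3]
    refine integral_congr_ae (Eventually.of_forall fun t => ?_)
    simp only [velocity, laplacian, Finset.mul_sum, mul_add]
  rw [e2, ← s1, ← s3, ← s4, Finset.sum_congr rfl fun i _ => (s2 i).symm,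
    ← integral_finsetSum _ fun i _ => integrable_test hη.continuous (continuous_dkernel j i) x (hDi i),
    ← integral_add i2 i3]
  have e3 : ∫ z : ℝ × Torus n, η z.1 * (kernel n j (x - z.2) * f z.1 z.2)
      ∂((volume.restrict (Ioo α ω)).prod volume) =
      ∫ z : ℝ × Torus n, f z.1 z.2 * (η z.1 * kernel n j (x - z.2))
        ∂((volume.restrict (Ioo α ω)).prod volume) :=
    integral_congr_ae (Eventually.of_forall fun z => by simp only; ring)
  rw [e3, ← ht, ← sub_eq_iff_eq_add', ← integral_sub i1 (i2.fadd i3)]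
  refine integral_congr_ae (Eventually.of_forall fun z => ?_)
  have e4 : ∑ i, η z.1 * (dkernel n j i (x - z.2) * Dv z.1 z.2 i) =
      -∑ i, Dv z.1 z.2 i * -(η z.1 * grad (kernel n j) (x - z.2) i) := by
    rw [← Finset.sum_neg_distrib]
    exact Finset.sum_congr rfl fun i _ => by simp only [dkernel]; ring
  simp only [e4, transport]
  ring

end weak

/-! ### Mixed norms in time and space. -/

section slices

variable {μ : Measure ℝ} {q : ℝ≥0∞} {g : ℝ → Torus n → ℝ}

/-- The essential supremum of a slice exceeds a exactly when the slice of {g > a} has positive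
measure, and that measure depends measurably on t. -/
lemma measurable_essSup_slice {g : ℝ × Torus n → ℝ≥0∞} (hg : Measurable g) :
    Measurable fun t => essSup (fun y => g (t, y)) (volume : Measure (Torus n)) := by
  refine measurable_of_Ioi fun a => ?_
  have e : (fun t => essSup (fun y => g (t, y)) (volume : Measure (Torus n))) ⁻¹' Ioi a =
      {t | (volume : Measure (Torus n)) (Prod.mk t ⁻¹' {z | a < g z}) ≠ 0} := by
    ext t
    simp only [mem_preimage, mem_Ioi, mem_ofPred_eq]
    rw [← not_iff_not, not_lt, not_not]
    constructor
    · intro h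
      have : ∀ᵐ y ∂(volume : Measure (Torus n)), g (t, y) ≤ a := by
        filter_upwards [ENNReal.ae_le_essSup fun y => g (t, y)] with y hy using hy.trans h
      simpa [ae_iff] using this
    · intro h
      refine essSup_le_of_ae_le a ?_
      simpa [EventuallyLE, ae_iff] using h
  rw [e]
  exact (measurable_measure_prodMk_left (measurableSet_lt measurable_const hg))
    (measurableSet_singleton 0).compl

lemma aemeasurable_eLpNorm_slice (hq : q ≠ 0) (hg : AEStronglyMeasurable (Function.uncurry g) (μ.prod volume)) :
    AEMeasurable (fun t => eLpNorm (g t) q volume) μ := by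
  rcases eq_or_ne q ⊤ with rfl | hq'
  · obtain ⟨g', hg', hgg'⟩ := hg
    refine ⟨_, measurable_essSup_slice hg'.measurable.enorm, ?_⟩
    filter_upwards [Measure.ae_ae_of_ae_prod hgg'] with t ht
    rw [eLpNorm_exponent_top, eLpNormEssSup]
    refine essSup_congr_ae ?_
    filter_upwards [ht] with y hy
    rw [← hy]; rfl
  · simp only [eLpNorm_eq_lintegral_rpow_enorm_toReal hq hq']
    exact ((hg.enorm.pow_const q.toReal).lintegral_prod_right').pow_const _

lemma ae_memLp_of_ae_lt_top (hg : AEStronglyMeasurable (Function.uncurry g) (μ.prod volume))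
    (h : ∀ᵐ t ∂μ, eLpNorm (g t) q volume < ⊤) : ∀ᵐ t ∂μ, MemLp (g t) q volume := by
  filter_upwards [hg.prodMk_left, h] with t h1 h2 using ⟨h1, h2⟩

lemma integrable_of_slices (hq : 1 ≤ q) (hg : AEStronglyMeasurable (Function.uncurry g) (μ.prod volume))
    (h : ∀ᵐ t ∂μ, MemLp (g t) q volume) (hi : Integrable (fun t => (eLpNorm (g t) q volume).toReal) μ) :
    Integrable (Function.uncurry g) (μ.prod volume) := by
  rw [integrable_prod_iff hg]
  refine ⟨h.mono fun t ht => ht.integrable hq, hi.mono' hg.norm.integral_prod_right' ?_⟩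
  filter_upwards [h] with t ht
  rw [Real.norm_of_nonneg (integral_nonneg fun x => norm_nonneg _)]
  refine (integral_abs_eq (ht.integrable hq).1).trans_le (ENNReal.toReal_mono ht.2.ne ?_)
  exact eLpNorm_le_eLpNorm_of_exponent_le hq ht.1

end slices

section mixed

variable {τ T : ℝ} {r q p : ℝ≥0∞} {d f : ℝ → Torus n → ℝ}

lemma MemMixed.ae_memLp (h : MemMixed τ T r q d) (hr : 1 ≤ r) (hr' : r ≠ ⊤) (hq : 1 ≤ q) :
    (∀ᵐ s ∂(volume.restrict (Ioo τ T)), MemLp (d s) q volume) ∧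
    IntegrableOn (fun s => (eLpNorm (d s) q volume).toReal ^ r.toReal) (Ioo τ T) ∧
    Integrable (Function.uncurry d) ((volume.restrict (Ioo τ T)).prod volume) := by
  have hr0 : r ≠ 0 := (zero_lt_one.trans_le hr).ne'
  have hq0 : q ≠ 0 := (zero_lt_one.trans_le hq).ne'
  have hr1 : 1 ≤ r.toReal := by
    rw [← ENNReal.toReal_one]; exact (ENNReal.toReal_le_toReal ENNReal.one_ne_top hr').2 hr
  have hm := aemeasurable_eLpNorm_slice hq0 h.1
  have hfin := lintegral_rpow_enorm_lt_top_of_eLpNorm_lt_top hr0 hr' h.2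
  simp only [enorm_eq_self] at hfin
  have hae : ∀ᵐ s ∂(volume.restrict (Ioo τ T)), eLpNorm (d s) q volume < ⊤ := by
    filter_upwards [ae_lt_top' (hm.pow_const r.toReal) hfin.ne] with s hs
    exact (ENNReal.rpow_lt_top_iff_of_pos (by linarith)).1 hs
  have h1 := ae_memLp_of_ae_lt_top h.1 hae
  have h2 : IntegrableOn (fun s => (eLpNorm (d s) q volume).toReal ^ r.toReal) (Ioo τ T) := by
    simp only [ENNReal.toReal_rpow]
    exact integrable_toReal_of_lintegral_ne_top (hm.pow_const r.toReal) hfin.ne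
  refine ⟨h1, h2, integrable_of_slices hq h.1 h1 ?_⟩
  -- On a bounded interval X ≤ 1 + X^r, as r ≥ 1.
  refine ((integrable_const (1 : ℝ)).add h2).mono' hm.ennreal_toReal.aestronglyMeasurable
    (Eventually.of_forall fun s => ?_)
  rw [Real.norm_of_nonneg ENNReal.toReal_nonneg]
  have h0 : 0 ≤ (eLpNorm (d s) q volume).toReal := ENNReal.toReal_nonneg
  rcases le_total (eLpNorm (d s) q volume).toReal 1 with h | h
  · exact h.trans (le_add_of_nonneg_right (Real.rpow_nonneg h0 _))
  · refine le_trans ?_ (le_add_of_nonneg_left zero_le_one)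
    nth_rw 1 [← Real.rpow_one (eLpNorm (d s) q volume).toReal]
    exact Real.rpow_le_rpow_of_exponent_le h hr1

lemma MemMixed.integral_rpow_le (h : MemMixed τ T r q d) (hr : 1 ≤ r) (hr' : r ≠ ⊤) (hq : 1 ≤ q)
    {M : ℝ≥0} (hM : mixedNorm τ T r q d ≤ M) :
    ∫ s in Ioo τ T, (eLpNorm (d s) q volume).toReal ^ r.toReal ≤ (M : ℝ) ^ r.toReal := by
  have hr0 : r ≠ 0 := (zero_lt_one.trans_le hr).ne'
  have hq0 : q ≠ 0 := (zero_lt_one.trans_le hq).ne'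
  have hr1 : 0 < r.toReal := ENNReal.toReal_pos hr0 hr'
  have hm := aemeasurable_eLpNorm_slice hq0 h.1
  have hfin := lintegral_rpow_enorm_lt_top_of_eLpNorm_lt_top hr0 hr' h.2
  simp only [enorm_eq_self] at hfin
  have hM' := hM
  rw [mixedNorm, eLpNorm_eq_lintegral_rpow_enorm_toReal hr0 hr'] at hM'
  simp only [enorm_eq_self] at hM'
  have h1 := ENNReal.rpow_le_rpow hM' hr1.le
  rw [← ENNReal.rpow_mul, one_div_mul_cancel hr1.ne', ENNReal.rpow_one] at h1
  simp only [ENNReal.toReal_rpow]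
  rw [integral_toReal (hm.pow_const r.toReal) (ae_lt_top' (hm.pow_const r.toReal) hfin.ne)]
  refine (ENNReal.toReal_mono (by finiteness) h1).trans_eq ?_
  rw [← ENNReal.toReal_rpow, ENNReal.coe_toReal]

lemma MemMixed.hasMixedNorms (hd : MemMixed τ T r q d) (hr : 1 ≤ r) (hr' : r ≠ ⊤) (hq : 1 ≤ q)
    (hf : MemMixed τ T 1 p f) (hp : 1 ≤ p) (hp' : p ≠ ⊤) :
    HasMixedNorms τ T q r.toReal p.toReal d f := by
  obtain ⟨h1, h2, -⟩ := hd.ae_memLp hr hr' hq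
  obtain ⟨h3, h4, -⟩ := hf.ae_memLp le_rfl ENNReal.one_ne_top hp
  rw [ENNReal.toReal_one] at h4
  simp only [Real.rpow_one] at h4
  refine ⟨h1, ?_, h2, ?_⟩
  · rwa [ENNReal.ofReal_toReal hp']
  · rwa [ENNReal.ofReal_toReal hp']

lemma HasMixedNorms.mono {a b a' b' r p : ℝ} (h : HasMixedNorms a b q r p d f) (hs : Ioo a' b' ⊆ Ioo a b) :
    HasMixedNorms a' b' q r p d f :=
  ⟨ae_restrict_of_ae_restrict_of_subset hs h.1, ae_restrict_of_ae_restrict_of_subset hs h.2,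
    h.3.mono_set hs, h.4.mono_set hs⟩

end mixed

/-! ### Regularised energy solutions. -/

section solution

variable {τ T : ℝ} {r q p : ℝ≥0∞} {d f v : ℝ → Torus n → ℝ} {b : ℝ → Torus n → Vec n} {vT : Torus n → ℝ}

lemma IsSolution.integrable (h : IsSolution p τ T b f vT v) (hp : 1 ≤ p) {t : ℝ} (ht : t ∈ Ioc τ T) :
    Integrable (v t) volume :=
  (h.memLp t ht).integrable (le_min hp (by norm_num))

lemma IsSolution.tendsto_integral_abs (h : IsSolution p τ T b f vT v) (hp : 1 ≤ p) {t : ℝ} (ht : t ∈ Ioc τ T) :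
    Tendsto (fun s => ∫ x, |v s x - v t x|) (𝓝[Ioc τ T] t) (𝓝 0) := by
  have h1 := (ENNReal.tendsto_toReal ENNReal.zero_ne_top).comp (h.continuous t ht)
  rw [ENNReal.toReal_zero] at h1
  refine squeeze_zero' (Eventually.of_forall fun s => integral_nonneg fun x => abs_nonneg _) ?_ h1
  filter_upwards [self_mem_nhdsWithin] with s hs
  have hm := (h.memLp s hs).sub (h.memLp t ht)
  refine (integral_abs_eq hm.1).trans_le (ENNReal.toReal_mono hm.2.ne ?_)
  exact eLpNorm_le_eLpNorm_of_exponent_le (le_min hp (by norm_num)) hm.1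

lemma IsSolution.continuousAt_conv (h : IsSolution p τ T b f vT v) (hp : 1 ≤ p) {k : Torus n → ℝ}
    (hk : Continuous k) (x : Torus n) {t : ℝ} (ht : t ∈ Ioo τ T) :
    ContinuousAt (fun t => conv k (v t) x) t := by
  obtain ⟨C, _, hC⟩ := exists_bound_of_continuous hk
  have ht' : t ∈ Ioc τ T := ⟨ht.1, ht.2.le⟩
  have h1 : Tendsto (fun s => ∫ x, |v s x - v t x|) (𝓝 t) (𝓝 0) := by
    have := h.tendsto_integral_abs hp ht'
    rwa [nhdsWithin_eq_nhds.2 (Filter.mem_of_superset (Ioo_mem_nhds ht.1 ht.2) Ioo_subset_Ioc_self)] at this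
  rw [ContinuousAt, tendsto_iff_norm_sub_tendsto_zero]
  refine squeeze_zero' (Eventually.of_forall fun s => norm_nonneg _) ?_ (by simpa using h1.const_mul C)
  filter_upwards [Ioo_mem_nhds ht.1 ht.2] with s hs
  have i1 := h.integrable hp ⟨hs.1, hs.2.le⟩
  have i2 := h.integrable hp ht'
  rw [← conv_sub hk i1 i2]
  exact abs_conv_le hC (i1.sub i2) x

theorem IsSolution.exists_isEvolution (h : IsSolution p τ T b f vT v) (hp : 1 ≤ p) (hb : LocL2 τ T b)
    (hbd : IsWeakDiv τ T b d)
    (hd : Integrable (Function.uncurry d) ((volume.restrict (Ioo τ T)).prod volume))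
    (hf : Integrable (Function.uncurry f) ((volume.restrict (Ioo τ T)).prod volume))
    {s t : ℝ} (hs : τ < s) (hst : s ≤ t) (ht : t < T) :
    ∃ G B : ℝ → Fin n → Torus n → ℝ, IsEvolution s t v G B d f := by
  obtain ⟨Dv, hDv, hgrad, heq⟩ := h.equation
  -- A larger open interval, still compactly inside (τ, T): local square integrability holds on it,
  -- and the smooth steps at s and t fit into it.
  obtain ⟨α, hα, hαs⟩ := exists_between hs
  obtain ⟨ω, htω, hω⟩ := exists_between ht
  have hαω : α < ω := by linarith
  have mono : (volume.restrict (Ioo α ω)).prod (volume : Measure (Torus n)) ≤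
      (volume.restrict (Ioo τ T)).prod volume :=
    Measure.prod_mono (Measure.restrict_mono (Ioo_subset_Ioo hα.le hω.le) le_rfl) le_rfl
  have mono' : (volume.restrict (Ioo s t)).prod (volume : Measure (Torus n)) ≤
      (volume.restrict (Ioo α ω)).prod volume :=
    Measure.prod_mono (Measure.restrict_mono (Ioo_subset_Ioo hαs.le htω.le) le_rfl) le_rfl
  have hv2 := h.locL2 α ω hα hαω hω
  have hD2 := hDv α ω hα hαω hω
  have hb2 := hb α ω hα hαω hω
  rw [cylinder] at hv2 hD2 hb2
  have hv1 := hv2.integrable (by norm_num)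
  have hd1 := hd.mono_measure mono
  have hf1 := hf.mono_measure mono
  refine ⟨fun s i y => Dv s y i, fun s i y => b s y i, hst, hv1.mono_measure mono',
    fun i => (memLp_component hD2 i).mono_measure mono', fun i => (memLp_component hb2 i).mono_measure mono',
    hf1.mono_measure mono', ?_, fun r hr => h.integrable hp ⟨by linarith [hr.1], by linarith [hr.2]⟩,
    fun j x => ?_⟩
  · refine ae_restrict_of_ae_restrict_of_subset (Ioo_subset_Ioo hαs.le htω.le) ?_
    filter_upwards [hv1.prod_right_ae, hd1.prod_right_ae,
      ae_all_iff.2 fun i => ae_memLp_slice (g := fun s y => Dv s y i) (memLp_component hD2 i),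
      ae_all_iff.2 fun i => ae_memLp_slice (g := fun s y => b s y i) (memLp_component hb2 i),
      ae_all_iff.2 fun j => ae_all_iff.2 fun i => ae_weakGrad hα hω hgrad hv1 hD2 j i,
      ae_all_iff.2 fun j => ae_weakDiv hα hω hbd hd1 hb2 j] with r h1 h2 h3 h4 h5 h6
    exact ⟨h1, h3, h4, h2, h5, h6⟩
  · have hH : IntegrableOn (fun s => velocity j (fun i y => b s y i) (fun i y => Dv s y i) (f s) x)
        (Ioo α ω) := by
      have hDi : ∀ i, Integrable (Function.uncurry fun t y => Dv t y i)
          ((volume.restrict (Ioo α ω)).prod volume) := fun i =>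
        (memLp_component hD2 i).integrable (by norm_num)
      have hbD : Integrable (Function.uncurry fun t => transport (fun i y => b t y i) (fun i y => Dv t y i))
          ((volume.restrict (Ioo α ω)).prod volume) :=
        integrable_finsetSum (f := fun i (z : ℝ × Torus n) => b z.1 z.2 i * Dv z.1 z.2 i) Finset.univ
          fun i _ => (memLp_component hb2 i).integrable_mul (memLp_component hD2 i)
      exact ((integrable_finsetSum _ fun i _ => integrable_conv_slice (continuous_dkernel j i) x (hDi i)).add
        (integrable_conv_slice (continuous_kernel j) x hbD)).add
        (integrable_conv_slice (continuous_kernel j) x hf1)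
    exact isBackward_of_integral_deriv hαs hst htω (integrable_conv_slice (continuous_kernel j) x hv1)
      (fun r hr => h.continuousAt_conv hp (continuous_kernel j) x ⟨hα.trans hr.1, hr.2.trans hω⟩) hH
      fun η hη h0 => integral_velocity_test hα hω hv1 hD2 hb2 hf1 heq j x hη h0

end solution

/-! ### The limit at the later time and removal of the level k. -/

section timeLimit

variable {Ω : Type*} [MeasurableSpace Ω] {ν : Measure Ω} [IsFiniteMeasure ν] {p m : ℝ}

/-- Fatou's lemma along integer levels. Membership in L^p is a conclusion, because the solution is a
priori only in L^min(p,2). -/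
lemma memLp_of_truncations (hp : 1 < p) {w : Ω → ℝ} (hw : AEStronglyMeasurable w ν) {Q : ℝ} (hQ : 0 ≤ Q)
    (h : ∀ k : ℝ, 0 < k → (∫ x, min |w x| k ^ p ∂ν) ^ (1 / p) ≤ Q) :
    MemLp w (ENNReal.ofReal p) ν ∧ (eLpNorm w (ENNReal.ofReal p) ν).toReal ≤ Q := by
  have hp0 : 0 < p := by linarith
  have hwk : ∀ k : ℕ, AEStronglyMeasurable (fun x => min |w x| ((k : ℝ) + 1)) ν := fun k =>
    (continuous_abs.min continuous_const).comp_aestronglyMeasurable hw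
  have h0 : ∀ (k : ℕ) x, 0 ≤ min |w x| ((k : ℝ) + 1) := fun k x => le_min (abs_nonneg _) (by positivity)
  have h1 : ∀ k : ℕ, eLpNorm (fun x => min |w x| ((k : ℝ) + 1)) (ENNReal.ofReal p) ν ≤ ENNReal.ofReal Q := by
    intro k
    have hm : MemLp (fun x => min |w x| ((k : ℝ) + 1)) (ENNReal.ofReal p) ν :=
      MemLp.of_bound (hwk k) ((k : ℝ) + 1) (Eventually.of_forall fun x => by
        rw [Real.norm_of_nonneg (h0 k x)]; exact min_le_right _ _)
    have h2 := h ((k : ℝ) + 1) (by positivity)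
    have h3 := integral_abs_rpow hp0 hm
    simp only [abs_of_nonneg (h0 k _)] at h3
    rw [h3, ← Real.rpow_mul ENNReal.toReal_nonneg, mul_one_div_cancel hp0.ne', Real.rpow_one] at h2
    exact (ENNReal.le_ofReal_iff_toReal_le hm.2.ne hQ).2 h2
  have h2 : eLpNorm (fun x => |w x|) (ENNReal.ofReal p) ν ≤ ENNReal.ofReal Q := by
    refine (Lp.eLpNorm_lim_le_liminf_eLpNorm hwk _ (Eventually.of_forall fun x => ?_)).trans
      (liminf_le_of_le (by isBoundedDefault) fun b hb => ?_)
    · refine tendsto_const_nhds.congr' ?_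
      filter_upwards [eventually_ge_atTop ⌈|w x|⌉₊] with k hk
      rw [min_eq_left]
      linarith [Nat.le_of_ceil_le hk]
    · obtain ⟨k, hk⟩ := hb.exists
      exact hk.trans (h1 k)
  have h3 : eLpNorm w (ENNReal.ofReal p) ν ≤ ENNReal.ofReal Q := by
    rwa [eLpNorm_congr_norm_ae (g := w) (Eventually.of_forall fun x => by simp)] at h2
  exact ⟨⟨hw, h3.trans_lt ENNReal.ofReal_lt_top⟩, ENNReal.toReal_le_of_le_ofReal hQ h3⟩

/-- In w = w' + (w - w'), growth of order p is used for w' and growth of order m for the difference.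
The power of k is acceptable, because the difference tends to zero while k is fixed. -/
lemma integral_growth_le (hp : 1 < p) (hmp : m ≤ p) (hm : 1 < m) {k : ℝ} (hk : 0 < k) {w w' : Ω → ℝ}
    (hw : MemLp w (ENNReal.ofReal m) ν) (hw' : MemLp w' (ENNReal.ofReal p) ν) :
    (∫ x, growth p m k (w x) ∂ν) ^ (1 / p) ≤
      2 * ((eLpNorm w' (ENNReal.ofReal p) ν).toReal ^ p +
        k ^ (p - m) * (eLpNorm (w - w') (ENNReal.ofReal m) ν).toReal ^ m) ^ (1 / p) := by
  have hp0 : 0 < p := by linarith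
  have hw'm : MemLp w' (ENNReal.ofReal m) ν := hw'.mono_exponent (ENNReal.ofReal_le_ofReal hmp)
  have hd : MemLp (w - w') (ENNReal.ofReal m) ν := hw.sub hw'm
  have i1 := integrable_growth hmp hm hk hw
  have i2 := integrable_growth hmp hm hk hw'm
  have i3 := integrable_growth hmp hm hk hd
  have i4 : Integrable (fun x => |w' x| ^ p) ν := by
    have := hw'.integrable_norm_rpow (by simpa using hp0) ENNReal.ofReal_ne_top
    rwa [ENNReal.toReal_ofReal hp0.le] at this
  have i5 : Integrable (fun x => |(w - w') x| ^ m) ν := by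
    have := hd.integrable_norm_rpow (by simp; linarith) ENNReal.ofReal_ne_top
    rwa [ENNReal.toReal_ofReal (by linarith)] at this
  have h0 : 0 ≤ ∫ x, growth p m k (w x) ∂ν := integral_nonneg fun x => growth_nonneg hk _
  have key : ∫ x, growth p m k (w x) ∂ν ≤ 2 ^ p * ((eLpNorm w' (ENNReal.ofReal p) ν).toReal ^ p +
        k ^ (p - m) * (eLpNorm (w - w') (ENNReal.ofReal m) ν).toReal ^ m) := by
    rw [← integral_abs_rpow hp0 hw', ← integral_abs_rpow (by linarith) hd, ← integral_const_mul,
      ← integral_add i4 (i5.const_mul _), ← integral_const_mul]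
    refine integral_mono i1 ((i4.add (i5.const_mul _)).const_mul _) fun x => ?_
    have h1 := growth_add_le hmp hm hk (w' x) ((w - w') x)
    rw [show w' x + (w - w') x = w x by simp] at h1
    refine h1.trans (mul_le_mul_of_nonneg_left (add_le_add (growth_le_rpow hmp hm hk _)
      (growth_le_mul_rpow hmp hm hk _)) (by positivity))
  refine (Real.rpow_le_rpow h0 key (by positivity)).trans_eq ?_
  rw [Real.mul_rpow (by positivity) (by positivity), ← Real.rpow_mul (by norm_num),
    mul_one_div_cancel hp0.ne', Real.rpow_one]

/-- The equation is available only before the terminal time, so the later time b approaches it in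
the weak norm L^m at a fixed level k; then k → ∞. Membership in L^p is assumed of the limit alone.
-/
lemma limit_time (hp : 1 < p) (hmp : m ≤ p) (hm : 1 < m) {l : Filter ℝ} [l.NeBot] {wa ws : Ω → ℝ}
    {wb : ℝ → Ω → ℝ} (hwa : AEStronglyMeasurable wa ν) (hws : MemLp ws (ENNReal.ofReal p) ν)
    (hwb : ∀ᶠ b in l, MemLp (wb b) (ENNReal.ofReal m) ν)
    (hlim : Tendsto (fun b => eLpNorm (wb b - ws) (ENNReal.ofReal m) ν) l (𝓝 0))
    {S : ℝ → ℝ} {S' K Φ : ℝ} (hS : ∀ b, 0 ≤ S b) (hSl : Tendsto S l (𝓝 S')) (hS' : 0 ≤ S') (hK : 0 ≤ K)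
    (hΦ : 0 ≤ Φ)
    (h : ∀ k : ℝ, 0 < k → ∀ᶠ b in l, (∫ x, min |wa x| k ^ p ∂ν) ^ (1 / p) ≤
      2 * (K * (S b * (∫ x, growth p m k (wb b x) ∂ν) ^ (1 / p) + Φ))) :
    MemLp wa (ENNReal.ofReal p) ν ∧ (eLpNorm wa (ENNReal.ofReal p) ν).toReal ≤
      2 * (K * (S' * (2 * (eLpNorm ws (ENNReal.ofReal p) ν).toReal) + Φ)) := by
  have hp0 : 0 < p := by linarith
  refine memLp_of_truncations hp hwa (by positivity) fun k hk => ?_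
  have hl1 := (ENNReal.tendsto_toReal ENNReal.zero_ne_top).comp hlim
  have hl2 : Tendsto (fun b => (eLpNorm (wb b - ws) (ENNReal.ofReal m) ν).toReal ^ m) l (𝓝 0) := by
    have := hl1.rpow_const (p := m) (Or.inr (by linarith))
    rwa [ENNReal.toReal_zero, Real.zero_rpow (by linarith)] at this
  have hl3 : Tendsto (fun b => 2 * (K * (S b * (2 * ((eLpNorm ws (ENNReal.ofReal p) ν).toReal ^ p +
      k ^ (p - m) * (eLpNorm (wb b - ws) (ENNReal.ofReal m) ν).toReal ^ m) ^ (1 / p)) + Φ))) l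
      (𝓝 (2 * (K * (S' * (2 * ((eLpNorm ws (ENNReal.ofReal p) ν).toReal ^ p +
      k ^ (p - m) * 0) ^ (1 / p)) + Φ)))) :=
    (((hSl.mul ((((hl2.const_mul _).const_add _).rpow_const (Or.inr (by positivity))).const_mul 2)).add_const
      Φ).const_mul K).const_mul 2
  rw [mul_zero, add_zero, ← Real.rpow_mul ENNReal.toReal_nonneg, mul_one_div_cancel hp0.ne',
    Real.rpow_one] at hl3
  refine ge_of_tendsto hl3 ?_
  filter_upwards [h k hk, hwb] with b hb hbm
  refine hb.trans ?_
  have := integral_growth_le hp hmp hm hk hbm hws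
  have := hS b
  gcongr

end timeLimit

/-! ### L^p bounds between two times. -/

/-- The hypotheses of the main theorem on the solution and on the data. -/
structure IsControlled (τ T p : ℝ) (q r : ℝ≥0∞) (M : ℝ≥0) (b : ℝ → Torus n → Vec n)
    (d f v : ℝ → Torus n → ℝ) (vT : Torus n → ℝ) : Prop where
  drift : LocL2 τ T b
  weakDiv : IsWeakDiv τ T b d
  div : MemMixed τ T r q d
  div_le : mixedNorm τ T r q d ≤ M
  source : MemMixed τ T 1 (ENNReal.ofReal p) f
  solution : IsSolution (ENNReal.ofReal p) τ T b f vT v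

/-- The constants in the energy inequalities. -/
structure IsConstants (n : ℕ) (p m κ C : ℝ) (q : ℝ≥0∞) (r : ℝ≥0∞) : Prop where
  n_pos : 0 < n
  one_lt : 1 < p
  m_le : m ≤ p
  one_lt_m : 1 < m
  m_lt : m < 2
  pos : 0 < κ
  le_one : κ ≤ 2 / p
  le_two : κ ≤ 2 - 2 / p
  le_three : κ ≤ 2 / m
  le_four : κ ≤ 2 - 2 / m
  one_le_q : 1 ≤ q
  one_le_r : 1 ≤ r
  r_ne_top : r ≠ ⊤
  nonneg : 0 ≤ C
  absorbs : Absorbs n q r.toReal (κ / 4) (κ / (16 * n ^ 2)) C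

section bounds

variable {τ T p m κ C : ℝ} {q r : ℝ≥0∞} {M : ℝ≥0} {b : ℝ → Torus n → Vec n}
    {d f v : ℝ → Torus n → ℝ} {vT : Torus n → ℝ}

lemma IsConstants.one_le_ofReal (hc : IsConstants n p m κ C q r) : 1 ≤ ENNReal.ofReal p := by
  rw [← ENNReal.ofReal_one]; exact ENNReal.ofReal_le_ofReal hc.one_lt.le

lemma IsConstants.ofReal_m_le (hc : IsConstants n p m κ C q r) :
    ENNReal.ofReal m ≤ min (ENNReal.ofReal p) 2 := by
  refine le_min (ENNReal.ofReal_le_ofReal hc.m_le) ?_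
  rw [← ENNReal.ofReal_ofNat 2]
  exact ENNReal.ofReal_le_ofReal hc.m_lt.le

lemma IsConstants.isProfile (hc : IsConstants n p m κ C q r) {k l : ℝ} (hk : 0 < k) (hl : 0 < l) :
    IsProfile p κ (slope p m k l / l) (slope p m k l) (profF p m k l) (profFc p m k l)
      (profG p m k l) (profB p m k l) :=
  DriftDiffusion.isProfile hc.m_le hc.one_lt_m hk hl hc.pos hc.le_one hc.le_two hc.le_three hc.le_four

lemma IsControlled.hasMixedNorms (h : IsControlled τ T p q r M b d f v vT)
    (hc : IsConstants n p m κ C q r) : HasMixedNorms τ T q r.toReal p d f := by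
  have := h.div.hasMixedNorms hc.one_le_r hc.r_ne_top hc.one_le_q h.source hc.one_le_ofReal
    ENNReal.ofReal_ne_top
  rwa [ENNReal.toReal_ofReal (by linarith [hc.one_lt])] at this

lemma IsControlled.exists_isEvolution (h : IsControlled τ T p q r M b d f v vT)
    (hc : IsConstants n p m κ C q r) {s t : ℝ} (hs : τ < s) (hst : s ≤ t) (ht : t < T) :
    ∃ G B : ℝ → Fin n → Torus n → ℝ, IsEvolution s t v G B d f :=
  h.solution.exists_isEvolution hc.one_le_ofReal h.drift h.weakDiv
    (h.div.ae_memLp hc.one_le_r hc.r_ne_top hc.one_le_q).2.2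
    (h.source.ae_memLp le_rfl ENNReal.one_ne_top hc.one_le_ofReal).2.2 hs hst ht

/-- The growth factor due to the divergence of the drift. -/
def divFactor (C p : ℝ) (r : ℝ≥0∞) (M : ℝ≥0) : ℝ := Real.exp (4 * C * 2 ^ p * (M : ℝ) ^ r.toReal)

lemma IsControlled.exp_integral_le (h : IsControlled τ T p q r M b d f v vT)
    (hc : IsConstants n p m κ C q r) {s t : ℝ} (hs : τ ≤ s) (hst : s ≤ t) (ht : t ≤ T) :
    Real.exp (∫ σ in s..t, 4 * C * 2 ^ p * (eLpNorm (d σ) q volume).toReal ^ r.toReal) ≤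
      divFactor C p r M := by
  have hC := hc.nonneg
  rw [divFactor, Real.exp_le_exp, intervalIntegral.integral_const_mul]
  refine mul_le_mul_of_nonneg_left ?_ (by positivity)
  refine le_trans ?_ (h.div.integral_rpow_le hc.one_le_r hc.r_ne_top hc.one_le_q h.div_le)
  rw [intervalIntegral.integral_of_le hst, integral_Ioc_eq_integral_Ioo]
  exact setIntegral_mono_set (h.hasMixedNorms hc).integrable_div
    (Eventually.of_forall fun s => by positivity) (Ioo_subset_Ioo hs ht).eventuallyLE

lemma IsControlled.intervalIntegrable_source (h : IsControlled τ T p q r M b d f v vT)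
    (hc : IsConstants n p m κ C q r) {s t : ℝ} (hs : τ ≤ s) (hst : s ≤ t) (ht : t ≤ T) :
    IntervalIntegrable (fun σ => (eLpNorm (f σ) (ENNReal.ofReal p) volume).toReal) volume s t :=
  (intervalIntegrable_iff_integrableOn_Ioo_of_le hst).2
    ((h.hasMixedNorms hc).integrable_source.mono_set (Ioo_subset_Ioo hs ht))

lemma IsControlled.integral_exp_source_le (h : IsControlled τ T p q r M b d f v vT)
    (hc : IsConstants n p m κ C q r) (θ : ℝ) {a t t' : ℝ} (ha : τ ≤ a) (hat : a ≤ t) (htt' : t ≤ t')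
    (ht' : t' ≤ T) :
    ∫ s in a..t, Real.exp (θ * (s - a)) * (2 ^ p * (eLpNorm (f s) (ENNReal.ofReal p) volume).toReal) ≤
    ∫ s in a..t', Real.exp (θ * (s - a)) * (2 ^ p * (eLpNorm (f s) (ENNReal.ofReal p) volume).toReal) := by
  refine intervalIntegral.integral_mono_interval le_rfl hat htt'
    (Eventually.of_forall fun s => by positivity) ?_
  exact ((h.intervalIntegrable_source hc ha (hat.trans htt') ht').const_mul _).continuousOn_mul
    (by fun_prop)

lemma IsControlled.tendsto_sub (h : IsControlled τ T p q r M b d f v vT)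
    (hc : IsConstants n p m κ C q r) {a t : ℝ} (ha : τ < a) (hat : a < t) (ht : t ≤ T) :
    Tendsto (fun s => eLpNorm (v s - v t) (ENNReal.ofReal m) volume) (𝓝[Ioo a t] t) (𝓝 0) := by
  have hsub : Ioo a t ⊆ Ioc τ T := fun s hs => ⟨ha.trans hs.1, hs.2.le.trans ht⟩
  have h1 := (h.solution.continuous t ⟨ha.trans hat, ht⟩).mono_left (nhdsWithin_mono t hsub)
  refine tendsto_of_tendsto_of_tendsto_of_le_of_le' tendsto_const_nhds h1
    (Eventually.of_forall fun s => zero_le) ?_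
  filter_upwards [self_mem_nhdsWithin] with s hs
  exact eLpNorm_le_eLpNorm_of_exponent_le hc.ofReal_m_le
    ((h.solution.memLp s (hsub hs)).sub (h.solution.memLp t ⟨ha.trans hat, ht⟩)).1

lemma neBot_nhdsWithin_Ioo {a t : ℝ} (hat : a < t) : (𝓝[Ioo a t] t).NeBot := by
  rw [nhdsWithin_Ioo_eq_nhdsLT hat]; infer_instance

/-- The estimate for the distance to a constant, on a short time interval. -/
theorem IsControlled.const_bound (h : IsControlled τ T p q r M b d f v vT)
    (hc : IsConstants n p m κ C q r) {a t : ℝ} (ha : τ < a) (hat : a < t) (ht : t ≤ T)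
    (hv : MemLp (v t) (ENNReal.ofReal p) volume) (c : ℝ) :
    MemLp (fun x => v a x - c) (ENNReal.ofReal p) volume ∧
    (eLpNorm (fun x => v a x - c) (ENNReal.ofReal p) volume).toReal ≤
      2 * (divFactor C p r M * (Real.exp (2 * (κ / (16 * n ^ 2)) * 2 ^ p / p * (t - a)) *
        (2 * (eLpNorm (fun x => v t x - c) (ENNReal.ofReal p) volume).toReal) +
        ∫ s in a..t, Real.exp (2 * (κ / (16 * n ^ 2)) * 2 ^ p / p * (s - a)) *
          (2 ^ p * (eLpNorm (f s) (ENNReal.ofReal p) volume).toReal))) := by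
  have hκ := hc.pos
  have := neBot_nhdsWithin_Ioo hat
  have hmem : ∀ s ∈ Ioc τ T, MemLp (fun x => v s x - c) (ENNReal.ofReal m) volume := fun s hs =>
    ((h.solution.memLp s hs).mono_exponent hc.ofReal_m_le).sub (memLp_const c)
  refine limit_time (l := 𝓝[Ioo a t] t) (wb := fun s x => v s x - c)
    (S := fun s => Real.exp (2 * (κ / (16 * n ^ 2)) * 2 ^ p / p * (s - a)))
    hc.one_lt hc.m_le hc.one_lt_m
    (hmem a ⟨ha, by linarith⟩).1 (hv.sub (memLp_const c)) ?_ ?_ (fun s => by positivity) ?_ (by positivity)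
    (Real.exp_pos _).le
    (intervalIntegral.integral_nonneg hat.le fun s _ => by positivity) fun k hk => ?_
  · filter_upwards [self_mem_nhdsWithin] with s hs using hmem s ⟨ha.trans hs.1, hs.2.le.trans ht⟩
  · refine (h.tendsto_sub hc ha hat ht).congr fun s => ?_
    congr 1
    funext x
    simp
  · have c1 : Continuous fun s => Real.exp (2 * (κ / (16 * n ^ 2)) * 2 ^ p / p * (s - a)) := by fun_prop
    exact (c1.tendsto t).mono_left nhdsWithin_le_nhds
  · filter_upwards [self_mem_nhdsWithin] with s hs
    obtain ⟨G, B, hev⟩ := h.exists_isEvolution hc ha hs.1.le (hs.2.trans_le ht)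
    have hm := (h.hasMixedNorms hc).mono (Ioo_subset_Ioo ha.le (hs.2.le.trans ht))
    have hprof : ∀ l : ℕ, _ := fun l => hc.isProfile (k := k) (l := (l : ℝ) + 1) hk (by positivity)
    -- The truncation level on the left is taken equal to k, the largest allowed.
    have key := limit_profile hc.one_lt hc.m_le hc.one_lt_m hc.m_lt hk le_rfl
      (wa := fun x => v a x - c) (wb := fun x => v s x - c)
      ((h.solution.integrable hc.one_le_ofReal ⟨ha, by linarith⟩).sub (integrable_const c))
      (hmem s ⟨ha.trans hs.1, hs.2.le.trans ht⟩) hc.pos hc.le_one hc.le_two hc.le_three hc.le_four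
      (Real.exp_pos _).le (Real.exp_pos _).le
      (K := Real.exp (∫ σ in a..s, 4 * C * 2 ^ p * (eLpNorm (d σ) q volume).toReal ^ r.toReal))
      (S := Real.exp (2 * (κ / (16 * n ^ 2)) * 2 ^ p / p * (s - a)))
      (Φ := ∫ σ in a..s, Real.exp (2 * (κ / (16 * n ^ 2)) * 2 ^ p / p * (σ - a)) *
        (2 ^ p * (eLpNorm (f σ) (ENNReal.ofReal p) volume).toReal))
      (A := Real.exp (|2 * (κ / (16 * n ^ 2)) * 2 ^ p| * (s - a))) (E := ∫ σ in Ioo a s, ∑ i, ∫ x, G σ i x ^ 2)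
      (D := |2 * (κ / (16 * n ^ 2)) * 2 ^ p| * (s - a))
      fun l δ hδ => (hev.const_le hm (hprof l) hc.one_lt hc.pos
        (div_nonneg (slope_nonneg hk (by positivity)) (by positivity)) (slope_nonneg hk (by positivity))
        hc.one_le_q (by positivity) hc.absorbs hc.nonneg c hδ).trans_eq (by rw [mul_right_comm |_| δ])
    refine key.trans ?_
    have hY : 0 ≤ ∫ x, growth p m k (v s x - c) := integral_nonneg fun x => growth_nonneg hk _
    have hΦ : 0 ≤ ∫ σ in a..s, Real.exp (2 * (κ / (16 * n ^ 2)) * 2 ^ p / p * (σ - a)) *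
        (2 ^ p * (eLpNorm (f σ) (ENNReal.ofReal p) volume).toReal) :=
      intervalIntegral.integral_nonneg hs.1.le fun s _ => by positivity
    have h1 := h.exp_integral_le hc ha.le hs.1.le (hs.2.le.trans ht)
    have h2 := h.integral_exp_source_le hc (2 * (κ / (16 * n ^ 2)) * 2 ^ p / p) ha.le hs.1.le hs.2.le ht
    have h0 : 0 ≤ divFactor C p r M := (Real.exp_pos _).le
    gcongr

lemma eLpNorm_prod_fst {g : Torus n → ℝ} (hg : AEStronglyMeasurable g volume) (e : ℝ≥0∞) :
    eLpNorm (fun z : Torus n × Torus n => g z.1) e (volume.prod volume) = eLpNorm g e volume :=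
  eLpNorm_comp_measurePreserving hg measurePreserving_fst

lemma eLpNorm_prod_snd {g : Torus n → ℝ} (hg : AEStronglyMeasurable g volume) (e : ℝ≥0∞) :
    eLpNorm (fun z : Torus n × Torus n => g z.2) e (volume.prod volume) = eLpNorm g e volume :=
  eLpNorm_comp_measurePreserving hg measurePreserving_snd

/-- The difference of the values at two points. -/
def osc (g : Torus n → ℝ) (z : Torus n × Torus n) : ℝ := g z.1 - g z.2

lemma aestronglyMeasurable_osc {g : Torus n → ℝ} (hg : AEStronglyMeasurable g volume) :
    AEStronglyMeasurable (osc g) (volume.prod volume) :=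
  (hg.comp_measurePreserving measurePreserving_fst).sub (hg.comp_measurePreserving measurePreserving_snd)

lemma eLpNorm_osc_le {g : Torus n → ℝ} (hg : AEStronglyMeasurable g volume) {e : ℝ≥0∞} (he : 1 ≤ e) :
    eLpNorm (osc g) e (volume.prod volume) ≤ 2 * eLpNorm g e volume := by
  have := eLpNorm_sub_le (hg.comp_measurePreserving (measurePreserving_fst (ν := (volume : Measure (Torus n)))))
    (hg.comp_measurePreserving (measurePreserving_snd (μ := (volume : Measure (Torus n))))) he
  refine this.trans_eq ?_
  rw [two_mul]
  exact congrArg₂ _ (eLpNorm_prod_fst hg e) (eLpNorm_prod_snd hg e)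

lemma memLp_osc {g : Torus n → ℝ} {e : ℝ≥0∞} (hg : MemLp g e volume) (he : 1 ≤ e) :
    MemLp (osc g) e (volume.prod volume) :=
  ⟨aestronglyMeasurable_osc hg.1, (eLpNorm_osc_le hg.1 he).trans_lt (ENNReal.mul_lt_top (by norm_num) hg.2)⟩

/-- The decay of the oscillation. -/
theorem IsControlled.osc_bound (h : IsControlled τ T p q r M b d f v vT)
    (hc : IsConstants n p m κ C q r) {a t : ℝ} (ha : τ < a) (hat : a < t) (ht : t ≤ T)
    (hv : MemLp (v t) (ENNReal.ofReal p) volume) :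
    MemLp (osc (v a)) (ENNReal.ofReal p) (volume.prod volume) ∧
    (eLpNorm (osc (v a)) (ENNReal.ofReal p) (volume.prod volume)).toReal ≤
      2 * (divFactor C p r M * (Real.exp (-(κ / (8 * n ^ 2)) / p * (t - a)) *
        (2 * (eLpNorm (osc (v t)) (ENNReal.ofReal p) (volume.prod volume)).toReal) +
        ∫ s in a..t, Real.exp (-(κ / (8 * n ^ 2)) / p * (s - a)) *
          (2 ^ p * (eLpNorm (f s) (ENNReal.ofReal p) volume).toReal))) := by
  have hκ := hc.pos
  have := neBot_nhdsWithin_Ioo hat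
  have hm1 : (1 : ℝ≥0∞) ≤ ENNReal.ofReal m := by
    rw [← ENNReal.ofReal_one]; exact ENNReal.ofReal_le_ofReal hc.one_lt_m.le
  have hmem' : ∀ s ∈ Ioc τ T, MemLp (v s) (ENNReal.ofReal m) volume := fun s hs =>
    (h.solution.memLp s hs).mono_exponent hc.ofReal_m_le
  have hmem : ∀ s ∈ Ioc τ T, MemLp (osc (v s)) (ENNReal.ofReal m) (volume.prod volume) := fun s hs =>
    memLp_osc (hmem' s hs) hm1
  refine limit_time (l := 𝓝[Ioo a t] t) (wb := fun s => osc (v s))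
    (S := fun s => Real.exp (-(κ / (8 * n ^ 2)) / p * (s - a)))
    hc.one_lt hc.m_le hc.one_lt_m
    (hmem a ⟨ha, by linarith⟩).1 (memLp_osc hv hc.one_le_ofReal) ?_ ?_ (fun s => by positivity) ?_
    (by positivity) (Real.exp_pos _).le
    (intervalIntegral.integral_nonneg hat.le fun s _ => by positivity) fun k hk => ?_
  · filter_upwards [self_mem_nhdsWithin] with s hs using hmem s ⟨ha.trans hs.1, hs.2.le.trans ht⟩
  · have hlim := ENNReal.Tendsto.const_mul (a := 2) (h.tendsto_sub hc ha hat ht) (Or.inr (by norm_num))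
    rw [mul_zero] at hlim
    refine tendsto_of_tendsto_of_tendsto_of_le_of_le' tendsto_const_nhds hlim
      (Eventually.of_forall fun s => zero_le) ?_
    filter_upwards [self_mem_nhdsWithin] with s hs
    refine le_trans (le_of_eq ?_) (eLpNorm_osc_le
      ((hmem' s ⟨ha.trans hs.1, hs.2.le.trans ht⟩).sub (hmem' t ⟨ha.trans hat, ht⟩)).1 hm1)
    congr 1
    funext z
    simp only [osc, Pi.sub_apply]
    ring
  · have c1 : Continuous fun s => Real.exp (-(κ / (8 * n ^ 2)) / p * (s - a)) := by fun_prop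
    exact (c1.tendsto t).mono_left nhdsWithin_le_nhds
  · filter_upwards [self_mem_nhdsWithin] with s hs
    obtain ⟨G, B, hev⟩ := h.exists_isEvolution hc ha hs.1.le (hs.2.trans_le ht)
    have hm := (h.hasMixedNorms hc).mono (Ioo_subset_Ioo ha.le (hs.2.le.trans ht))
    have hprof : ∀ l : ℕ, _ := fun l => hc.isProfile (k := k) (l := (l : ℝ) + 1) hk (by positivity)
    -- The same removal of the truncations, now on the product of two tori and with a decaying
    -- factor `S`.
    have key := limit_profile hc.one_lt hc.m_le hc.one_lt_m hc.m_lt hk le_rfl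
      (wa := osc (v a)) (wb := osc (v s)) ((hmem a ⟨ha, by linarith⟩).integrable hm1)
      (hmem s ⟨ha.trans hs.1, hs.2.le.trans ht⟩) hc.pos hc.le_one hc.le_two hc.le_three hc.le_four
      (Real.exp_pos _).le (Real.exp_pos _).le
      (K := Real.exp (∫ σ in a..s, 4 * C * 2 ^ p * (eLpNorm (d σ) q volume).toReal ^ r.toReal))
      (S := Real.exp (-(κ / (8 * n ^ 2)) / p * (s - a)))
      (Φ := ∫ σ in a..s, Real.exp (-(κ / (8 * n ^ 2)) / p * (σ - a)) *
        (2 ^ p * (eLpNorm (f σ) (ENNReal.ofReal p) volume).toReal))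
      (A := Real.exp (|-(κ / (8 * n ^ 2))| * (s - a))) (E := ∫ σ in Ioo a s, ∑ i, ∫ x, G σ i x ^ 2)
      (D := |-(κ / (8 * n ^ 2))| * (s - a))
      fun l δ hδ => (hev.osc_le hc.n_pos hm (hprof l) hc.one_lt hc.pos
        (div_nonneg (slope_nonneg hk (by positivity)) (by positivity)) (slope_nonneg hk (by positivity))
        hc.one_le_q hc.absorbs hc.nonneg hδ).trans_eq (by rw [mul_right_comm |_| δ]; rfl)
    refine key.trans ?_
    have hY : 0 ≤ ∫ z, growth p m k (osc (v s) z) ∂(volume.prod volume) :=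
      integral_nonneg fun x => growth_nonneg hk _
    have hΦ : 0 ≤ ∫ σ in a..s, Real.exp (-(κ / (8 * n ^ 2)) / p * (σ - a)) *
        (2 ^ p * (eLpNorm (f σ) (ENNReal.ofReal p) volume).toReal) :=
      intervalIntegral.integral_nonneg hs.1.le fun s _ => by positivity
    have h1 := h.exp_integral_le hc ha.le hs.1.le (hs.2.le.trans ht)
    have h2 := h.integral_exp_source_le hc (-(κ / (8 * n ^ 2)) / p) ha.le hs.1.le hs.2.le ht
    have h0 : 0 ≤ divFactor C p r M := (Real.exp_pos _).le
    gcongr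

end bounds

/-- Admissibility supplies what `exists_absorption` needs: n/q < 2 from the range of q, and 2/(2 -
n/q) ≤ r from the scaling inequality. -/
lemma exists_isConstants {p : ℝ} (hp : 1 < p) {q r : ℝ≥0∞} (h : AdmissibleExponents n r q) :
    ∃ m κ C : ℝ, IsConstants n p m κ C q r := by
  obtain ⟨h1, h2⟩ := h
  have hn : 0 < n := by omega
  have hr1 : 1 ≤ r := by tauto
  have hrt : r ≠ ⊤ := by
    rcases h2 with h | h
    · exact h.2.2.1.ne
    · exact (h.2.2.1.trans_lt (by norm_num)).ne
  have hq1 : 1 ≤ q := by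
    rcases h2 with ⟨h, -, -, h'⟩ | h
    · refine le_trans ?_ h'.le
      rw [ENNReal.le_div_iff_mul_le (by simp) (by simp), one_mul]
      exact_mod_cast h
    · exact h.2.2.2
  have hR : 1 ≤ r.toReal := by
    rw [← ENNReal.toReal_one]; exact ENNReal.toReal_mono hrt hr1
  have hnq : (n : ℝ) * (1 / q.toReal) < 2 := by
    rcases eq_or_ne q ⊤ with rfl | hqt
    · simp
    have hQ : 1 ≤ q.toReal := by
      rw [← ENNReal.toReal_one]; exact ENNReal.toReal_mono hqt hq1
    rw [mul_one_div, div_lt_iff₀ (by linarith)]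
    rcases h2 with ⟨h, -, -, h'⟩ | h
    · have := ENNReal.toReal_strict_mono hqt h'
      rw [ENNReal.toReal_div] at this
      simp at this
      linarith
    · rw [h.1]; push_cast; linarith
  have hsum : (n : ℝ) * (1 / q.toReal) / 2 + 1 / r.toReal ≤ 1 := by
    have hq0 : 2 * q ≠ 0 := mul_ne_zero two_ne_zero (by positivity)
    have hr0 : r ≠ 0 := by positivity
    have := ENNReal.toReal_mono ENNReal.one_ne_top h1
    rw [ENNReal.toReal_add (ENNReal.div_ne_top (by simp) hq0) (ENNReal.div_ne_top (by simp) hr0),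
      ENNReal.toReal_div, ENNReal.toReal_div, ENNReal.toReal_mul] at this
    simp at this
    calc _ = (n : ℝ) / (2 * q.toReal) + r.toReal⁻¹ := by rw [mul_one_div, div_div, mul_comm, one_div]
      _ ≤ 1 := this
  have hr : 2 / (2 - n * (1 / q.toReal)) ≤ r.toReal := by
    rw [div_le_iff₀ (by linarith)]
    have : r.toReal * (1 / r.toReal) = 1 := mul_one_div_cancel (by linarith)
    nlinarith
  -- Any exponent with 1 < m < 2 and m ≤ p would do.
  set m := min p (3 / 2) with hm
  have hm1 : 1 < m := lt_min hp (by norm_num)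
  set κ := min (min (2 / p) (2 - 2 / p)) (min (2 / m) (2 - 2 / m)) with hκ
  have aux : ∀ s : ℝ, 1 < s → 0 < min (2 / s) (2 - 2 / s) := fun s hs => by
    refine lt_min (by positivity) ?_
    rw [sub_pos, div_lt_iff₀ (by linarith)]
    linarith
  have hκ0 : 0 < κ := lt_min (aux p hp) (aux m hm1)
  -- This zeroth order weight is small enough to be beaten by the Poincaré inequality in the
  -- estimate of the oscillation.
  obtain ⟨C, hC, hA⟩ := exists_absorption hq1 hnq hr (κ := κ / 4) (μ := κ / (16 * n ^ 2)) (by positivity)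
    (by positivity)
  exact ⟨m, κ, C, hn, hp, min_le_left _ _, hm1, (min_le_right _ _).trans_lt (by norm_num), hκ0,
    (min_le_left _ _).trans (min_le_left _ _), (min_le_left _ _).trans (min_le_right _ _),
    (min_le_right _ _).trans (min_le_left _ _), (min_le_right _ _).trans (min_le_right _ _),
    hq1, hr1, hrt, hC, hA⟩

/-- The oscillation to the power p is the mean over y of the integrals of |g - g(y)|^p, so some
value c = g(y) does at least as well as the mean. -/
lemma exists_sub_le_osc {p : ℝ} (hp : 1 < p) {g : Torus n → ℝ} (hg : MemLp g (ENNReal.ofReal p) volume) :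
    ∃ c : ℝ, (eLpNorm (fun x => g x - c) (ENNReal.ofReal p) volume).toReal ≤
      (eLpNorm (osc g) (ENNReal.ofReal p) (volume.prod volume)).toReal := by
  have hp0 : 0 < p := by linarith
  have he : 1 ≤ ENNReal.ofReal p := by
    rw [← ENNReal.ofReal_one]; exact ENNReal.ofReal_le_ofReal hp.le
  have ho := memLp_osc hg he
  have hi : Integrable (fun z => |osc g z| ^ p) (volume.prod volume) := by
    have := ho.integrable_norm_rpow (by simp; linarith) ENNReal.ofReal_ne_top
    rwa [ENNReal.toReal_ofReal hp0.le] at this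
  obtain ⟨y, hy⟩ := exists_le_integral hi.integral_prod_right
  refine ⟨g y, ?_⟩
  have h1 := integral_abs_rpow hp0 (hg.sub (memLp_const (g y)))
  have h2 := integral_abs_rpow hp0 ho
  rw [integral_prod_symm _ hi] at h2
  refine (Real.rpow_le_rpow_iff ENNReal.toReal_nonneg ENNReal.toReal_nonneg hp0).1 ?_
  rw [← h2]
  exact h1.symm.le.trans hy

/-! ### Iteration over time steps of fixed length. -/

/-- Bounds for the `L^p` norms of a solution over one time step of length at most `ℓ`. -/
structure HasSteps (τ T p K ℓ : ℝ) (f v : ℝ → Torus n → ℝ) : Prop where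
  const_le : ∀ a t : ℝ, τ < a → a < t → t ≤ T → MemLp (v t) (ENNReal.ofReal p) volume → t - a ≤ ℓ → ∀ c : ℝ,
    MemLp (fun x => v a x - c) (ENNReal.ofReal p) volume ∧
    (eLpNorm (fun x => v a x - c) (ENNReal.ofReal p) volume).toReal ≤
      K * ((eLpNorm (fun x => v t x - c) (ENNReal.ofReal p) volume).toReal +
        ∫ s in a..t, (eLpNorm (f s) (ENNReal.ofReal p) volume).toReal)
  osc_le : ∀ a t : ℝ, τ < a → a < t → t ≤ T → MemLp (v t) (ENNReal.ofReal p) volume → t - a = ℓ →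
    (eLpNorm (osc (v a)) (ENNReal.ofReal p) (volume.prod volume)).toReal ≤
      1 / 2 * (eLpNorm (osc (v t)) (ENNReal.ofReal p) (volume.prod volume)).toReal +
        K * ∫ s in a..t, (eLpNorm (f s) (ENNReal.ofReal p) volume).toReal
  integrable : IntegrableOn (fun s => (eLpNorm (f s) (ENNReal.ofReal p) volume).toReal) (Ioo τ T)

lemma HasSteps.intervalIntegrable {τ T p K ℓ : ℝ} {f v : ℝ → Torus n → ℝ} (h : HasSteps τ T p K ℓ f v)
    {s t : ℝ} (hs : τ ≤ s) (hst : s ≤ t) (ht : t ≤ T) :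
    IntervalIntegrable (fun σ => (eLpNorm (f σ) (ENNReal.ofReal p) volume).toReal) volume s t :=
  (intervalIntegrable_iff_integrableOn_Ioo_of_le hst).2 (h.integrable.mono_set (Ioo_subset_Ioo hs ht))

lemma exists_hasSteps {p m κ C : ℝ} {q r : ℝ≥0∞} (hc : IsConstants n p m κ C q r) (M : ℝ≥0) :
    ∃ K ℓ : ℝ, 1 ≤ K ∧ 0 < ℓ ∧ ∀ (τ T : ℝ) (b : ℝ → Torus n → Vec n) (d f v : ℝ → Torus n → ℝ)
      (vT : Torus n → ℝ), IsControlled τ T p q r M b d f v vT → HasSteps τ T p K ℓ f v := by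
  have hκ := hc.pos
  have hn := hc.n_pos
  have hp0 : 0 < p := by linarith [hc.one_lt]
  have hC := hc.nonneg
  set D := divFactor C p r M with hD
  have hD1 : 1 ≤ D := Real.one_le_exp (by positivity)
  set lam := κ / (8 * n ^ 2) / p with hlam
  have hlam0 : 0 < lam := by positivity
  set α := 2 * (κ / (16 * n ^ 2)) * 2 ^ p / p with hα
  have hα0 : 0 < α := by positivity
  -- With this length D exp(-λℓ) = D exp(-8D) ≤ 1/8, so the factor 4 D exp(-λℓ) in the oscillation
  -- bound is at most 1/2. Here D bounds the growth due to the divergence on any subinterval, so one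
  -- length serves every step.
  set ℓ := 8 * D / lam with hℓ
  have hℓ0 : 0 < ℓ := by positivity
  have hE : 1 ≤ Real.exp (α * ℓ) := Real.one_le_exp (by positivity)
  have h2p : (1 : ℝ) ≤ 2 ^ p := Real.one_le_rpow (by norm_num) hp0.le
  have hDE : 1 ≤ D * Real.exp (α * ℓ) := one_le_mul_of_one_le_of_one_le hD1 hE
  refine ⟨2 * (D * Real.exp (α * ℓ)) * (2 + 2 ^ p), ℓ, by nlinarith, hℓ0, fun τ T b d f v vT h => ⟨?_, ?_,
    (h.hasMixedNorms hc).integrable_source⟩⟩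
  · intro a t ha hat ht hv hℓt c
    obtain ⟨h1, h2⟩ := h.const_bound hc ha hat ht hv c
    refine ⟨h1, h2.trans ?_⟩
    have hI := h.intervalIntegrable_source hc ha.le hat.le ht
    have e1 : Real.exp (α * (t - a)) ≤ Real.exp (α * ℓ) := by gcongr
    have e2 : ∫ s in a..t, Real.exp (α * (s - a)) * (2 ^ p * (eLpNorm (f s) (ENNReal.ofReal p) volume).toReal) ≤
        Real.exp (α * ℓ) * (2 ^ p * ∫ s in a..t, (eLpNorm (f s) (ENNReal.ofReal p) volume).toReal) := by
      rw [← intervalIntegral.integral_const_mul, ← intervalIntegral.integral_const_mul]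
      refine intervalIntegral.integral_mono_on hat.le ((hI.const_mul _).continuousOn_mul (by fun_prop))
        ((hI.const_mul _).const_mul _) fun s hs => ?_
      have : s - a ≤ ℓ := by linarith [hs.2]
      gcongr
    have hN : 0 ≤ (eLpNorm (fun x => v t x - c) (ENNReal.ofReal p) volume).toReal := ENNReal.toReal_nonneg
    have hF : 0 ≤ ∫ s in a..t, (eLpNorm (f s) (ENNReal.ofReal p) volume).toReal :=
      intervalIntegral.integral_nonneg hat.le fun s _ => ENNReal.toReal_nonneg
    set N := (eLpNorm (fun x => v t x - c) (ENNReal.ofReal p) volume).toReal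
    set F := ∫ s in a..t, (eLpNorm (f s) (ENNReal.ofReal p) volume).toReal
    calc _ ≤ 2 * (D * (Real.exp (α * ℓ) * (2 * N) + Real.exp (α * ℓ) * (2 ^ p * F))) := by gcongr
      _ = 2 * (D * Real.exp (α * ℓ)) * (2 * N + 2 ^ p * F) := by ring
      _ ≤ 2 * (D * Real.exp (α * ℓ)) * ((2 + 2 ^ p) * (N + F)) := by
        gcongr
        nlinarith
      _ = _ := by ring
  · intro a t ha hat ht hv hℓt
    obtain ⟨-, h2⟩ := h.osc_bound hc ha hat ht hv
    refine h2.trans ?_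
    have hI := h.intervalIntegrable_source hc ha.le hat.le ht
    have e0 : -(κ / (8 * n ^ 2)) / p = -lam := by rw [hlam, neg_div]
    rw [e0, hℓt]
    have e1 : D * Real.exp (-lam * ℓ) ≤ 1 / 8 := by
      rw [show -lam * ℓ = -(8 * D) by rw [hℓ]; field_simp, Real.exp_neg, ← div_eq_mul_inv,
        div_le_iff₀ (Real.exp_pos _)]
      linarith [Real.add_one_le_exp (8 * D)]
    have e2 : ∫ s in a..t, Real.exp (-lam * (s - a)) * (2 ^ p * (eLpNorm (f s) (ENNReal.ofReal p) volume).toReal) ≤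
        2 ^ p * ∫ s in a..t, (eLpNorm (f s) (ENNReal.ofReal p) volume).toReal := by
      rw [← intervalIntegral.integral_const_mul]
      refine intervalIntegral.integral_mono_on hat.le ((hI.const_mul _).continuousOn_mul (by fun_prop))
        (hI.const_mul _) fun s hs => ?_
      refine mul_le_of_le_one_left (by positivity) (Real.exp_le_one_iff.2 ?_)
      nlinarith [hs.1]
    have hN : 0 ≤ (eLpNorm (osc (v t)) (ENNReal.ofReal p) (volume.prod volume)).toReal := ENNReal.toReal_nonneg
    have hF : 0 ≤ ∫ s in a..t, (eLpNorm (f s) (ENNReal.ofReal p) volume).toReal :=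
      intervalIntegral.integral_nonneg hat.le fun s _ => ENNReal.toReal_nonneg
    set N := (eLpNorm (osc (v t)) (ENNReal.ofReal p) (volume.prod volume)).toReal
    set F := ∫ s in a..t, (eLpNorm (f s) (ENNReal.ofReal p) volume).toReal
    calc _ ≤ 2 * (D * (Real.exp (-lam * ℓ) * (2 * N) + 2 ^ p * F)) := by gcongr
      _ = 4 * (D * Real.exp (-lam * ℓ)) * N + 2 * (D * 1) * (2 ^ p) * F := by ring
      _ ≤ 4 * (1 / 8) * N + 2 * (D * Real.exp (α * ℓ)) * (2 + 2 ^ p) * F := by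
        gcongr
        linarith
      _ = _ := by ring

section steps

variable {τ T p K ℓ : ℝ} {f v : ℝ → Torus n → ℝ}

lemma toReal_eLpNorm_add_le {p : ℝ} (hp : 1 < p) {g h : Torus n → ℝ} (hg : MemLp g (ENNReal.ofReal p) volume)
    (hh : MemLp h (ENNReal.ofReal p) volume) :
    (eLpNorm (g + h) (ENNReal.ofReal p) volume).toReal ≤ (eLpNorm g (ENNReal.ofReal p) volume).toReal +
      (eLpNorm h (ENNReal.ofReal p) volume).toReal := by
  rw [← ENNReal.toReal_add hg.2.ne hh.2.ne]
  refine ENNReal.toReal_mono (ENNReal.add_ne_top.2 ⟨hg.2.ne, hh.2.ne⟩) (eLpNorm_add_le hg.1 hh.1 ?_)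
  rw [← ENNReal.ofReal_one]; exact ENNReal.ofReal_le_ofReal hp.le

lemma toReal_eLpNorm_const {p : ℝ} (hp : 1 < p) (c : ℝ) :
    (eLpNorm (fun _ : Torus n => c) (ENNReal.ofReal p) volume).toReal = |c| := by
  rw [eLpNorm_const _ (by simp; linarith) (NeZero.ne _)]
  simp

lemma toReal_eLpNorm_le_sub_add {p : ℝ} (hp : 1 < p) {g : Torus n → ℝ}
    (hg : MemLp g (ENNReal.ofReal p) volume) (c : ℝ) :
    (eLpNorm g (ENNReal.ofReal p) volume).toReal ≤
      (eLpNorm (fun x => g x - c) (ENNReal.ofReal p) volume).toReal + |c| := by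
  have := toReal_eLpNorm_add_le hp (hg.sub (memLp_const c)) (memLp_const c)
  rwa [toReal_eLpNorm_const hp, sub_add_cancel] at this

lemma abs_sub_le_toReal_eLpNorm {p : ℝ} (hp : 1 < p) {g : Torus n → ℝ}
    (hg : MemLp g (ENNReal.ofReal p) volume) (c c' : ℝ) :
    |c - c'| ≤ (eLpNorm (fun x => g x - c) (ENNReal.ofReal p) volume).toReal +
      (eLpNorm (fun x => g x - c') (ENNReal.ofReal p) volume).toReal := by
  have := toReal_eLpNorm_add_le hp (hg.sub (memLp_const c)).neg (hg.sub (memLp_const c'))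
  rw [eLpNorm_neg, ← toReal_eLpNorm_const (n := n) hp] at *
  refine le_trans (le_of_eq ?_) this
  congr 2
  funext x
  simp

lemma HasSteps.memLp (h : HasSteps τ T p K ℓ f v) {a t : ℝ} (ha : τ < a) (hat : a < t) (ht : t ≤ T)
    (hv : MemLp (v t) (ENNReal.ofReal p) volume) (hℓ : t - a ≤ ℓ) : MemLp (v a) (ENNReal.ofReal p) volume := by
  simpa using (h.const_le a t ha hat ht hv hℓ 0).1

/-- The bound at the times which are a whole number of steps before the terminal time. -/
lemma HasSteps.exists_const (h : HasSteps τ T p K ℓ f v) (hp : 1 < p) (hK : 1 ≤ K) (hℓ : 0 < ℓ)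
    (hT : MemLp (v T) (ENNReal.ofReal p) volume) (j : ℕ) (hj : τ < T - j * ℓ) :
    MemLp (v (T - j * ℓ)) (ENNReal.ofReal p) volume ∧ ∃ c : ℝ,
      (eLpNorm (fun x => v (T - j * ℓ) x - c) (ENNReal.ofReal p) volume).toReal ≤
        (eLpNorm (osc (v (T - j * ℓ))) (ENNReal.ofReal p) (volume.prod volume)).toReal ∧
      |c| + (1 + 2 * K) * (eLpNorm (osc (v (T - j * ℓ))) (ENNReal.ofReal p) (volume.prod volume)).toReal ≤
        (5 + 4 * K) * (eLpNorm (v T) (ENNReal.ofReal p) volume).toReal +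
          (3 * K + 2 * K ^ 2) * ∫ s in (T - j * ℓ)..T, (eLpNorm (f s) (ENNReal.ofReal p) volume).toReal := by
  have he : 1 ≤ ENNReal.ofReal p := by
    rw [← ENNReal.ofReal_one]; exact ENNReal.ofReal_le_ofReal hp.le
  induction j with
  | zero =>
    simp only [Nat.cast_zero, zero_mul, sub_zero, intervalIntegral.integral_same, mul_zero, add_zero]
    refine ⟨hT, ?_⟩
    obtain ⟨c, hcU⟩ := exists_sub_le_osc hp hT
    refine ⟨c, hcU, ?_⟩
    have h1 := ENNReal.toReal_mono (ENNReal.mul_ne_top (by norm_num) hT.2.ne) (eLpNorm_osc_le hT.1 he)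
    rw [ENNReal.toReal_mul] at h1
    -- At time T, with N the norm of the terminal value, the oscillation U is at most 2N and |c| ≤ U
    -- + N ≤ 3N, so |c| + (1 + 2K) U ≤ (5 + 4K) N.
    have h2 := abs_sub_le_toReal_eLpNorm hp hT c 0
    simp only [sub_zero] at h2
    have h3 : (2 : ℝ≥0∞).toReal = 2 := rfl
    rw [h3] at h1
    nlinarith
  | succ j ih =>
    have hs : T - ((j + 1 : ℕ) : ℝ) * ℓ = T - j * ℓ - ℓ := by push_cast; ring
    rw [hs] at hj ⊢
    obtain ⟨hv, c, hcU, hcX⟩ := ih (by linarith)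
    have hjT : T - j * ℓ ≤ T := by
      have : 0 ≤ j * ℓ := by positivity
      linarith
    set t := T - j * ℓ with ht
    have hat : t - ℓ < t := by linarith
    have hva := h.memLp hj hat hjT hv (by linarith)
    obtain ⟨c', hcU'⟩ := exists_sub_le_osc hp hva
    refine ⟨hva, c', hcU', ?_⟩
    have h1 := (h.const_le _ _ hj hat hjT hv (by linarith) c).2
    have h2 := h.osc_le _ _ hj hat hjT hv (by linarith)
    have h3 := abs_sub_le_toReal_eLpNorm hp hva c' c
    have h4 : |c'| ≤ |c' - c| + |c| := by
      have := abs_add_le (c' - c) c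
      rwa [sub_add_cancel] at this
    rw [← intervalIntegral.integral_add_adjacent_intervals (h.intervalIntegrable hj.le hat.le hjT)
      (h.intervalIntegrable (hj.trans hat).le hjT le_rfl)]
    have hF : 0 ≤ ∫ s in (t - ℓ)..t, (eLpNorm (f s) (ENNReal.ofReal p) volume).toReal :=
      intervalIntegral.integral_nonneg hat.le fun s _ => ENNReal.toReal_nonneg
    set F := ∫ s in (t - ℓ)..t, (eLpNorm (f s) (ENNReal.ofReal p) volume).toReal
    set U := (eLpNorm (osc (v t)) (ENNReal.ofReal p) (volume.prod volume)).toReal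
    set U' := (eLpNorm (osc (v (t - ℓ))) (ENNReal.ofReal p) (volume.prod volume)).toReal
    -- The combination |c| + (1 + 2K) U is chosen not to grow, apart from the source. From |c'| ≤
    -- |c| + U' + K(U + F) and U' ≤ U/2 + KF, the new value is at most |c| + (2 + 2K)(U/2 + KF) + KU
    -- + KF, that is, the old value plus (3K + 2K²) F.
    have h5 := mul_le_mul_of_nonneg_left h2 (show 0 ≤ 2 + 2 * K by linarith)
    have h6 := mul_le_mul_of_nonneg_left hcU (show 0 ≤ K by linarith)
    nlinarith

theorem HasSteps.norm_le (h : HasSteps τ T p K ℓ f v) (hp : 1 < p) (hK : 1 ≤ K) (hℓ : 0 < ℓ)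
    (hT : MemLp (v T) (ENNReal.ofReal p) volume) {t : ℝ} (ht : t ∈ Ioo τ T) :
    MemLp (v t) (ENNReal.ofReal p) volume ∧
    (eLpNorm (v t) (ENNReal.ofReal p) volume).toReal ≤ (5 + 4 * K + 2 * K ^ 2) *
      ((eLpNorm (v T) (ENNReal.ofReal p) volume).toReal +
        ∫ s in t..T, (eLpNorm (f s) (ENNReal.ofReal p) volume).toReal) := by
  -- As many whole steps as fit between t and T. The incomplete step that remains is covered by the
  -- bound for the distance to the constant c, with K U ≤ (1 + 2K) U.
  set j := ⌊(T - t) / ℓ⌋₊ with hj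
  have hTt : 0 ≤ (T - t) / ℓ := div_nonneg (by linarith [ht.2]) hℓ.le
  have hj1 : j * ℓ ≤ T - t := (le_div_iff₀ hℓ).1 (Nat.floor_le hTt)
  have hj2 : T - t < (j + 1) * ℓ := (div_lt_iff₀ hℓ).1 (Nat.lt_floor_add_one _)
  obtain ⟨hv, c, hcU, hcX⟩ := h.exists_const hp hK hℓ hT j (by linarith [ht.1])
  have hjT : T - j * ℓ ≤ T := by
    have : 0 ≤ j * ℓ := by positivity
    linarith
  set s := T - j * ℓ with hs
  have hts : t ≤ s := by linarith
  have hF : 0 ≤ ∫ σ in t..s, (eLpNorm (f σ) (ENNReal.ofReal p) volume).toReal :=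
    intervalIntegral.integral_nonneg hts fun s _ => ENNReal.toReal_nonneg
  have hF' : 0 ≤ ∫ σ in s..T, (eLpNorm (f σ) (ENNReal.ofReal p) volume).toReal :=
    intervalIntegral.integral_nonneg hjT fun s _ => ENNReal.toReal_nonneg
  have hN : 0 ≤ (eLpNorm (v T) (ENNReal.ofReal p) volume).toReal := ENNReal.toReal_nonneg
  have hU : 0 ≤ (eLpNorm (osc (v s)) (ENNReal.ofReal p) (volume.prod volume)).toReal := ENNReal.toReal_nonneg
  have key : MemLp (v t) (ENNReal.ofReal p) volume ∧
      (eLpNorm (fun x => v t x - c) (ENNReal.ofReal p) volume).toReal ≤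
        K * ((eLpNorm (fun x => v s x - c) (ENNReal.ofReal p) volume).toReal +
          ∫ σ in t..s, (eLpNorm (f σ) (ENNReal.ofReal p) volume).toReal) := by
    rcases hts.eq_or_lt with hts | hts
    · rw [hts, intervalIntegral.integral_same, add_zero]
      exact ⟨hv, le_mul_of_one_le_left ENNReal.toReal_nonneg hK⟩
    · exact ⟨h.memLp ht.1 hts hjT hv (by linarith), (h.const_le t s ht.1 hts hjT hv (by linarith) c).2⟩
  refine ⟨key.1, (toReal_eLpNorm_le_sub_add hp key.1 c).trans ?_⟩
  rw [← intervalIntegral.integral_add_adjacent_intervals (h.intervalIntegrable ht.1.le hts hjT)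
      (h.intervalIntegrable (ht.1.le.trans hts) hjT le_rfl)]
  have h1 := key.2
  set F := ∫ σ in t..s, (eLpNorm (f σ) (ENNReal.ofReal p) volume).toReal
  set F' := ∫ σ in s..T, (eLpNorm (f σ) (ENNReal.ofReal p) volume).toReal
  set N := (eLpNorm (v T) (ENNReal.ofReal p) volume).toReal
  have h6 := mul_le_mul_of_nonneg_left hcU (show 0 ≤ K by linarith)
  nlinarith [mul_nonneg (show 0 ≤ K by linarith) hF, mul_nonneg (show 0 ≤ K by linarith) hF',
    mul_nonneg (show 0 ≤ K by linarith) hU, mul_nonneg (sq_nonneg K) hF, mul_nonneg (sq_nonneg K) hN]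

end steps

end

end DriftDiffusion

theorem mainTheorem6 (n : ℕ) (p r q : ℝ≥0∞) (hp : 1 < p) (hp' : p < ⊤)
    (hrq : DriftDiffusion.AdmissibleExponents n r q) (M : ℝ≥0) :
    ∃ C : ℝ≥0, ∀ (τ T : ℝ), τ < T →
      ∀ (b : ℝ → DriftDiffusion.Torus n → DriftDiffusion.Vec n)
        (divb f v : ℝ → DriftDiffusion.Torus n → ℝ) (vT : DriftDiffusion.Torus n → ℝ),
        DriftDiffusion.LocL2 τ T b →
        DriftDiffusion.IsWeakDiv τ T b divb →
        DriftDiffusion.MemMixed τ T r q divb →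
        DriftDiffusion.mixedNorm τ T r q divb ≤ M →
        DriftDiffusion.MemMixed τ T 1 p f →
        MemLp vT p volume →
        DriftDiffusion.IsSolution p τ T b f vT v →
        ∀ t ∈ Ioo τ T,
          eLpNorm (v t) p volume ≤
            C * (eLpNorm vT p volume + ∫⁻ s in Ioo t T, eLpNorm (f s) p volume) := by
  obtain ⟨p, rfl⟩ : ∃ p' : ℝ, p = ENNReal.ofReal p' := ⟨p.toReal, (ENNReal.ofReal_toReal hp'.ne).symm⟩
  have hp1 : 1 < p := by rwa [← ENNReal.ofReal_one, ENNReal.ofReal_lt_ofReal_iff_of_nonneg zero_le_one] at hp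
  obtain ⟨m, κ, C, hc⟩ := DriftDiffusion.exists_isConstants hp1 hrq
  obtain ⟨K, ℓ, hK, hℓ, h⟩ := DriftDiffusion.exists_hasSteps hc M
  refine ⟨(5 + 4 * K + 2 * K ^ 2).toNNReal, fun τ T _ b divb f v vT hb hdiv hd hM hf hvT hv t ht => ?_⟩
  have hs := h τ T b divb f v vT ⟨hb, hdiv, hd, hM, hf, hv⟩
  -- The iteration starts from the representative v T, which is only almost everywhere equal to the
  -- terminal datum.
  have hT := (memLp_congr_ae hv.terminal).2 hvT
  obtain ⟨h1, h2⟩ := hs.norm_le hp1 hK hℓ hT ht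
  rw [eLpNorm_congr_ae hv.terminal] at h2
  rw [← ENNReal.ofReal_toReal h1.2.ne]
  refine (ENNReal.ofReal_le_ofReal h2).trans ?_
  rw [ENNReal.ofReal_mul (by positivity)]
  refine mul_le_mul_right (ENNReal.ofReal_add_le.trans ?_) _
  rw [ENNReal.ofReal_toReal hvT.2.ne, intervalIntegral.integral_of_le ht.2.le, integral_Ioc_eq_integral_Ioo,
    ofReal_integral_eq_lintegral_ofReal (hs.integrable.mono_set (Ioo_subset_Ioo ht.1.le le_rfl))
      (Filter.Eventually.of_forall fun s => ENNReal.toReal_nonneg)]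
  exact add_le_add_right (lintegral_mono fun s => ENNReal.ofReal_toReal_le) _
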